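/- Let $p$ be a prime and let $k$ be an algebraically closed field, complete with respect to a real-valued non-archimedean absolute value (possibly trivial), with $|p|<1$ (residue characteristic $p$). For $r\in|k^\times|$, $r\le 1$, let $A(r,1)=\mathcal M(k\{T,rT^{-1}\})$ be the standard closed annulus. A closed annulus of modulus $r$ is a $k$-analytic space $Y=\mathcal M(\mathcal A)$ isomorphic to $A(r,1)$; a monic coordinate on $Y$ is an element $y\in\mathcal A$ inducing such an isomorphism. Two monic coordinates define the same orientation if the expansion of one of them as a series in the other has dominant term of degree $1$ (rather than $-1$); here a term of a series $\sum_i c_iT^i$ is dominant if $|c_i|\rho^i<|c_n|\rho^n$ for this term $c_nT^n$, every $i\ne n$ and every $\rho\in[r,1]$. Let $f\colon Y\to X$ be an étale annular $p$-cover, that is, a finite étale morphism of degree $p$ between closed annuli. A monic presentation of $f$ is a series $x=\varphi(y)=\sum_{i\in\mathbb Z} c_iy^i$ describing $f$ in monic coordinates $y$ on $Y$ and $x$ on $X$, with dominant term $y^p$. The dominant tame term of $\varphi$ is $0$ if the dominant term of $\varphi'$ is $p\,y^{p-1}$, and is $c_ny^n$ if the dominant term of $\varphi'$ is $nc_ny^{n-1}$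 with $p\nmid n$. For a fixed orientation of $Y$ (only monic coordinates $y$ inducing it are used), a dominant tame term of $f$ is a monomial which, for one and hence for every monic presentation $\varphi$ of $f$, is the dominant tame term of $\varphi$ multiplied by some $c\in k$ with $|c|=1$ (formal monomials in the variable are compared). The cover $f$ is Kummer if it has a presentation $x=y^p$ in some monic coordinates. **Theorem.** Let $f\colon Y\to X$ be an étale annular $p$-cover. 1. For each orientation of $Y$, $f$ admits a monic presentation $x=y^p+t$, where $t$ is a dominant tame term of $f$. 2. In particular, $f$ is Kummer or binomial: either $f$ is Kummer, or, for a suitable orientation of $Y$, it admits a monic presentation $x=y^p+cy^n$ with $c\in k^\times$, $n>p$ and $p\nmid n$, where $cy^n$ is a dominant tame term of $f$. 3. Conversely, for each orientation of $Y$: if $x=y^p$ is a monic presentation of $f$, then $0$ is a dominant tame term of $f$; and if $f$ is not Kummer and $x=y^p+cy^n$ (with $c\in k$, $n\in\mathbb Z$) is a monic presentation of $f$, then $cy^n$ is a dominant tame term of $f$. -/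

import Mathlib

open Filter Topology
open scoped NNReal

set_option linter.unusedSectionVars false

noncomputable section

namespace BerkovichAnnulus

/-! The algebra of analytic functions on the standard closed annulus `A(r,1)`. -/

/-- The largest value of `ρ ^ i` for radii `ρ ∈ [r, 1]` (when `0 < r ≤ 1`):
it is `1` for `i ≥ 0` and `r ^ i` for `i ≤ 0`. -/
def weight (r : ℝ≥0) (i : ℤ) : ℝ := max 1 ((r : ℝ) ^ i)

theorem one_le_weight (r : ℝ≥0) (i : ℤ) : 1 ≤ weight r i := le_max_left _ _

theorem weight_pos (r : ℝ≥0) (i : ℤ) : 0 < weight r i :=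
  lt_of_lt_of_le one_pos (one_le_weight r i)

theorem weight_zero (r : ℝ≥0) : weight r 0 = 1 := by simp [weight]

theorem weight_add_le (r : ℝ≥0) (i j : ℤ) : weight r (i + j) ≤ weight r i * weight r j := by
  have h1 : 1 ≤ weight r i * weight r j :=
    one_le_mul_of_one_le_of_one_le (one_le_weight r i) (one_le_weight r j)
  refine max_le h1 ?_
  rcases eq_or_ne (r : ℝ) 0 with h | h
  · rw [h]
    rcases eq_or_ne (i + j) 0 with h0 | h0
    · simpa [h0] using h1
    · rw [zero_zpow _ h0]
      exact le_trans zero_le_one h1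
  · rw [zpow_add₀ h]
    exact mul_le_mul (le_max_right _ _) (le_max_right _ _) (zpow_nonneg r.2 _) (weight_pos r i).le

section Space

variable (k : Type*) [NormedField k]

/-- The bilateral series `∑ aᵢ Tⁱ` that converge on `r ≤ |T| ≤ 1`: the coefficients satisfy
`|aᵢ| → 0` for `i → +∞` and `|aᵢ| rⁱ → 0` for `i → -∞`. -/
def convergentSeries (r : ℝ≥0) : Submodule k (ℤ → k) where
  carrier := {a | Tendsto (fun i => ‖a i‖ * weight r i) cofinite (𝓝 0)}
  zero_mem' := by simp
  add_mem' := by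
    intro a b ha hb
    have h := Tendsto.add ha hb
    rw [add_zero] at h
    refine squeeze_zero (fun i => mul_nonneg (norm_nonneg _) (weight_pos r i).le) (fun i => ?_) h
    rw [← add_mul]
    exact mul_le_mul_of_nonneg_right (norm_add_le _ _) (weight_pos r i).le
  smul_mem' := by
    intro c a ha
    have h := Tendsto.const_mul ‖c‖ ha
    rw [mul_zero] at h
    refine h.congr (fun i => ?_)
    simp [mul_assoc]

/-- The algebra `k{T, r T⁻¹}` of analytic functions on the standard closed annulus `A(r,1)` of
radii `r` and `1`, with the multiplication of bilateral series and the spectral (Gauss) norm. -/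
def AnnulusAlgebra (r : ℝ≥0) : Type _ := convergentSeries k r

instance instAddCommGroup (r : ℝ≥0) : AddCommGroup (AnnulusAlgebra k r) :=
  inferInstanceAs (AddCommGroup (convergentSeries k r))

instance instModule (r : ℝ≥0) : Module k (AnnulusAlgebra k r) :=
  inferInstanceAs (Module k (convergentSeries k r))

end Space

namespace AnnulusAlgebra

variable {k : Type*} [NormedField k] {r : ℝ≥0}

/-- The coefficient of `Tⁱ`. -/
def coeff (a : AnnulusAlgebra k r) (i : ℤ) : k := a.1 i

theorem tendsto_coeff (a : AnnulusAlgebra k r) :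
    Tendsto (fun i => ‖a.coeff i‖ * weight r i) cofinite (𝓝 0) := a.2

@[ext] theorem ext {a b : AnnulusAlgebra k r} (h : ∀ i, a.coeff i = b.coeff i) : a = b :=
  Subtype.ext (funext h)

@[simp] theorem coeff_add (a b : AnnulusAlgebra k r) (i : ℤ) :
    (a + b).coeff i = a.coeff i + b.coeff i := rfl

@[simp] theorem coeff_zero (i : ℤ) : (0 : AnnulusAlgebra k r).coeff i = 0 := rfl

@[simp] theorem coeff_neg (a : AnnulusAlgebra k r) (i : ℤ) : (-a).coeff i = -a.coeff i := rfl

@[simp] theorem coeff_smul (c : k) (a : AnnulusAlgebra k r) (i : ℤ) :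
    (c • a).coeff i = c * a.coeff i := rfl

/-- The monomial `c Tⁿ`. -/
def monomial (r : ℝ≥0) (n : ℤ) (c : k) : AnnulusAlgebra k r :=
  ⟨Pi.single n c, by
    change Tendsto _ _ _
    refine tendsto_const_nhds.congr' ?_
    rw [EventuallyEq, eventually_cofinite]
    refine (Set.finite_singleton n).subset (fun i hi => ?_)
    by_contra h
    exact hi (by simp [Pi.single_eq_of_ne (show i ≠ n from h)])⟩

theorem coeff_monomial (n : ℤ) (c : k) (i : ℤ) :
    (monomial r n c).coeff i = if i = n then c else 0 := by
  change (Pi.single n c : ℤ → k) i = _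
  rw [Pi.single_apply]

/-! The norm `max |aᵢ| max(1, rⁱ)`. -/

theorem bddAbove (a : AnnulusAlgebra k r) :
    BddAbove (Set.range fun i => ‖a.coeff i‖ * weight r i) := by
  have h : ∀ᶠ i in cofinite, ‖a.coeff i‖ * weight r i < 1 :=
    a.tendsto_coeff.eventually_lt_const one_pos
  rw [eventually_cofinite] at h
  obtain ⟨M, hM⟩ := (h.image fun i => ‖a.coeff i‖ * weight r i).bddAbove
  refine ⟨max M 1, ?_⟩
  rintro _ ⟨i, rfl⟩
  by_cases hi : ‖a.coeff i‖ * weight r i < 1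
  · exact le_max_of_le_right hi.le
  · exact le_max_of_le_left (hM ⟨i, hi, rfl⟩)

/-- The spectral norm on `A(r,1)`: `|a| = supᵢ |aᵢ| max(1, rⁱ)`. -/
def gaussNorm (a : AnnulusAlgebra k r) : ℝ := ⨆ i, ‖a.coeff i‖ * weight r i

theorem term_le_gaussNorm (a : AnnulusAlgebra k r) (i : ℤ) :
    ‖a.coeff i‖ * weight r i ≤ gaussNorm a :=
  le_ciSup a.bddAbove i

theorem gaussNorm_le_of {a : AnnulusAlgebra k r} {C : ℝ}
    (h : ∀ i, ‖a.coeff i‖ * weight r i ≤ C) : gaussNorm a ≤ C := ciSup_le h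

theorem coeff_le_gaussNorm (a : AnnulusAlgebra k r) (i : ℤ) : ‖a.coeff i‖ ≤ gaussNorm a :=
  le_trans (le_mul_of_one_le_right (norm_nonneg _) (one_le_weight r i)) (a.term_le_gaussNorm i)

/-- The spectral norm as a norm on the additive group. -/
def gaussAddNorm (k : Type*) [NormedField k] (r : ℝ≥0) : AddGroupNorm (AnnulusAlgebra k r) where
  toFun := gaussNorm
  map_zero' := le_antisymm (gaussNorm_le_of fun i => by simp)
    (le_trans (norm_nonneg _) (coeff_le_gaussNorm (0 : AnnulusAlgebra k r) 0))
  add_le' := fun a b => gaussNorm_le_of fun i => by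
    refine le_trans ?_ (add_le_add (a.term_le_gaussNorm i) (b.term_le_gaussNorm i))
    rw [← add_mul]
    exact mul_le_mul_of_nonneg_right (norm_add_le _ _) (weight_pos r i).le
  neg' := fun a => by simp [gaussNorm]
  eq_zero_of_map_eq_zero' := fun a h => by
    ext i
    have := a.coeff_le_gaussNorm i
    rw [h] at this
    simpa using this

/-! Multiplication of bilateral series. -/

variable [IsUltrametricDist k]

theorem norm_tsum_le_of_forall {ι : Type*} {f : ι → k} {C : ℝ} (hC : 0 ≤ C)
    (h : ∀ i, ‖f i‖ ≤ C) : ‖∑' i, f i‖ ≤ C := by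
  by_cases hf : Summable f
  · refine le_of_tendsto hf.hasSum.norm (Eventually.of_forall fun s => ?_)
    exact IsUltrametricDist.norm_sum_le_of_forall_le_of_nonneg hC (fun i _ => h i)
  · rw [tsum_eq_zero_of_not_summable hf]
    simpa using hC

/-- The coefficients of the product of two bilateral series. -/
def mulCoeff (a b : AnnulusAlgebra k r) (n : ℤ) : k := ∑' i, a.coeff i * b.coeff (n - i)

theorem tendsto_coeff_zero (a : AnnulusAlgebra k r) : Tendsto a.coeff cofinite (𝓝 0) := by
  rw [tendsto_zero_iff_norm_tendsto_zero]
  exact squeeze_zero (fun _ => norm_nonneg _)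
    (fun i => le_mul_of_one_le_right (norm_nonneg _) (one_le_weight r i)) a.tendsto_coeff

theorem term_mul_le (a b : AnnulusAlgebra k r) (n i : ℤ) :
    ‖a.coeff i * b.coeff (n - i)‖ * weight r n
      ≤ (‖a.coeff i‖ * weight r i) * (‖b.coeff (n - i)‖ * weight r (n - i)) := by
  have h := weight_add_le r i (n - i)
  rw [add_sub_cancel] at h
  calc ‖a.coeff i * b.coeff (n - i)‖ * weight r n
      ≤ ‖a.coeff i * b.coeff (n - i)‖ * (weight r i * weight r (n - i)) :=
        mul_le_mul_of_nonneg_left h (norm_nonneg _)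
    _ = _ := by rw [norm_mul]; ring

theorem mulCoeff_le (a b : AnnulusAlgebra k r) {n : ℤ} {C : ℝ} (hC : 0 ≤ C)
    (h : ∀ i, (‖a.coeff i‖ * weight r i) * (‖b.coeff (n - i)‖ * weight r (n - i)) ≤ C) :
    ‖mulCoeff a b n‖ * weight r n ≤ C := by
  rw [← le_div_iff₀ (weight_pos r n)]
  refine norm_tsum_le_of_forall (div_nonneg hC (weight_pos r n).le) (fun i => ?_)
  rw [le_div_iff₀ (weight_pos r n)]
  exact (term_mul_le a b n i).trans (h i)

theorem tendsto_mulCoeff (a b : AnnulusAlgebra k r) :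
    Tendsto (fun n => ‖mulCoeff a b n‖ * weight r n) cofinite (𝓝 0) := by
  have hp := tendsto_mul_cofinite_nhds_zero a.tendsto_coeff b.tendsto_coeff
  rw [Metric.tendsto_nhds]
  intro ε hε
  have h := hp.eventually_lt_const (half_pos hε)
  rw [eventually_cofinite] at h ⊢
  refine (h.image fun x : ℤ × ℤ => x.1 + x.2).subset (fun n hn => ?_)
  by_contra hcon
  apply hn
  rw [Real.dist_0_eq_abs, abs_of_nonneg (mul_nonneg (norm_nonneg _) (weight_pos r n).le)]
  refine lt_of_le_of_lt (mulCoeff_le a b (half_pos hε).le fun i => ?_) (half_lt_self hε)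
  by_contra hi
  exact hcon ⟨(i, n - i), fun hlt => hi (le_of_lt hlt), by simp⟩

instance : Mul (AnnulusAlgebra k r) := ⟨fun a b => ⟨mulCoeff a b, tendsto_mulCoeff a b⟩⟩

theorem coeff_mul (a b : AnnulusAlgebra k r) (n : ℤ) :
    (a * b).coeff n = ∑' i, a.coeff i * b.coeff (n - i) := rfl

instance : One (AnnulusAlgebra k r) := ⟨monomial r 0 1⟩

theorem coeff_one (i : ℤ) : (1 : AnnulusAlgebra k r).coeff i = if i = 0 then 1 else 0 :=
  coeff_monomial 0 1 i

theorem gaussNorm_nonneg (a : AnnulusAlgebra k r) : 0 ≤ gaussNorm a :=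
  le_trans (norm_nonneg _) (a.coeff_le_gaussNorm 0)

theorem gaussNorm_mul_le (a b : AnnulusAlgebra k r) :
    gaussNorm (a * b) ≤ gaussNorm a * gaussNorm b :=
  gaussNorm_le_of fun _ => mulCoeff_le a b (mul_nonneg a.gaussNorm_nonneg b.gaussNorm_nonneg)
    fun i => mul_le_mul (a.term_le_gaussNorm i) (b.term_le_gaussNorm _)
      (mul_nonneg (norm_nonneg _) (weight_pos r _).le) a.gaussNorm_nonneg

variable [CompleteSpace k]

theorem summable_mul (a b : AnnulusAlgebra k r) (n : ℤ) :
    Summable fun i => a.coeff i * b.coeff (n - i) := by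
  have h := tendsto_mul_cofinite_nhds_zero a.tendsto_coeff_zero b.tendsto_coeff_zero
  refine NonarchimedeanAddGroup.summable_of_tendsto_cofinite_zero ?_
  have hinj : Function.Injective fun i : ℤ => (i, n - i) := fun i j hij => congrArg Prod.fst hij
  exact h.comp hinj.tendsto_cofinite

theorem mul_comm' (a b : AnnulusAlgebra k r) : a * b = b * a := by
  ext n
  rw [coeff_mul, coeff_mul, ← (Equiv.subLeft n).tsum_eq]
  refine tsum_congr fun i => ?_
  simp [mul_comm]

theorem add_mul' (a b c : AnnulusAlgebra k r) : (a + b) * c = a * c + b * c := by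
  ext n
  rw [coeff_add, coeff_mul, coeff_mul, coeff_mul,
    ← (summable_mul a c n).tsum_add (summable_mul b c n)]
  exact tsum_congr fun i => by rw [coeff_add, add_mul]

theorem zero_mul' (a : AnnulusAlgebra k r) : 0 * a = 0 := by
  ext n
  rw [coeff_mul, coeff_zero]
  exact (tsum_congr fun i => by rw [coeff_zero, zero_mul]).trans tsum_zero

theorem one_mul' (a : AnnulusAlgebra k r) : 1 * a = a := by
  ext n
  rw [coeff_mul, tsum_eq_single 0 (fun i hi => by rw [coeff_one, if_neg hi, zero_mul])]
  simp [coeff_one]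

theorem smul_mul' (c : k) (a b : AnnulusAlgebra k r) : c • a * b = c • (a * b) := by
  ext n
  rw [coeff_smul, coeff_mul, coeff_mul, ← tsum_mul_left]
  exact tsum_congr fun i => by rw [coeff_smul, mul_assoc]

theorem summable_triple (a b c : AnnulusAlgebra k r) (n : ℤ) :
    Summable fun x : ℤ × ℤ => a.coeff x.2 * (b.coeff (x.1 - x.2) * c.coeff (n - x.1)) := by
  refine NonarchimedeanAddGroup.summable_of_tendsto_cofinite_zero ?_
  have h := tendsto_mul_cofinite_nhds_zero a.tendsto_coeff_zero
    (tendsto_mul_cofinite_nhds_zero b.tendsto_coeff_zero c.tendsto_coeff_zero)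
  have hinj : Function.Injective fun x : ℤ × ℤ => (x.2, (x.1 - x.2, n - x.1)) := by
    rintro ⟨i, j⟩ ⟨i', j'⟩ hij
    simp only [Prod.mk.injEq] at hij
    obtain ⟨h1, -, h2⟩ := hij
    rw [h1, sub_right_injective h2]
  exact h.comp hinj.tendsto_cofinite

theorem mul_assoc' (a b c : AnnulusAlgebra k r) : a * b * c = a * (b * c) := by
  ext n
  calc (a * b * c).coeff n
      = ∑' m, ∑' i, a.coeff i * (b.coeff (m - i) * c.coeff (n - m)) := by
        rw [coeff_mul]
        refine tsum_congr fun m => ?_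
        rw [coeff_mul, ← tsum_mul_right]
        exact tsum_congr fun i => mul_assoc _ _ _
    _ = ∑' i, ∑' m, a.coeff i * (b.coeff (m - i) * c.coeff (n - m)) :=
        (Summable.tsum_comm
          (f := fun m i => a.coeff i * (b.coeff (m - i) * c.coeff (n - m)))
          (summable_triple a b c n)).symm
    _ = (a * (b * c)).coeff n := by
        rw [coeff_mul]
        refine tsum_congr fun i => ?_
        rw [coeff_mul, tsum_mul_left, ← (Equiv.addRight i).tsum_eq]
        refine congrArg (a.coeff i * ·) (tsum_congr fun j => ?_)
        rw [Equiv.coe_addRight, add_sub_cancel_right, sub_sub, add_comm i j]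

instance instCommRing : CommRing (AnnulusAlgebra k r) :=
  { instAddCommGroup k r with
    mul := (· * ·)
    one := 1
    mul_assoc := mul_assoc'
    one_mul := one_mul'
    mul_one := fun a => (mul_comm' a 1).trans (one_mul' a)
    zero_mul := zero_mul'
    mul_zero := fun a => (mul_comm' a 0).trans (zero_mul' a)
    left_distrib := fun a b c => by
      refine (mul_comm' a (b + c)).trans ((add_mul' b c a).trans ?_)
      rw [mul_comm' b, mul_comm' c]
    right_distrib := add_mul'
    mul_comm := mul_comm' }

instance instNormedCommRing : NormedCommRing (AnnulusAlgebra k r) :=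
  { instCommRing,
    (gaussAddNorm k r).toNormedAddCommGroup with
    norm_mul_le := gaussNorm_mul_le }

theorem norm_def (a : AnnulusAlgebra k r) : ‖a‖ = ⨆ i, ‖a.coeff i‖ * weight r i := rfl

instance : Algebra k (AnnulusAlgebra k r) :=
  Algebra.ofModule smul_mul' fun c a b =>
    (mul_comm' a (c • b)).trans ((smul_mul' c b a).trans (by rw [mul_comm' b a]))

/-- The standard coordinate `T` of `A(r,1)`. -/
def coord (k : Type*) [NormedField k] (r : ℝ≥0) : AnnulusAlgebra k r := monomial r 1 1

end AnnulusAlgebra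

open AnnulusAlgebra

section Dominance

variable {k : Type*} [NormedField k]

/-- `c n Tⁿ` is the dominant term of the series `∑ cᵢ Tⁱ` on the annulus with skeleton `[r, 1]`:
it strictly dominates every other term, i.e. `|cᵢ| ρⁱ < |cₙ| ρⁿ` for all `i ≠ n` and all radii
`ρ ∈ [r, 1]`. -/
def IsDominantTerm (r : ℝ≥0) (c : ℤ → k) (n : ℤ) : Prop :=
  ∀ i : ℤ, i ≠ n → ∀ ρ : ℝ, (r : ℝ) ≤ ρ → ρ ≤ 1 → ‖c i‖ * ρ ^ i < ‖c n‖ * ρ ^ n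

/-- The coefficients of the derivative `∑ i cᵢ Tⁱ⁻¹` of a series `∑ cᵢ Tⁱ`. -/
def derivCoeff (c : ℤ → k) : ℤ → k := fun j => ((j + 1 : ℤ) : k) * c (j + 1)

/-- `t` is the dominant tame term of the series `φ = ∑ cᵢ Tⁱ` (a monic presentation of an étale
annular `p`-cover): if the dominant term of `φ'` is `p c_p Tᵖ⁻¹` then `t = 0`, and if it is
`n cₙ Tⁿ⁻¹` with `n` prime to `p`, then `t = cₙ Tⁿ`. -/
def IsDominantTameTermOfSeries (p : ℕ) {r : ℝ≥0} (φ t : AnnulusAlgebra k r) : Prop :=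
  (IsDominantTerm r (derivCoeff φ.coeff) ((p : ℤ) - 1) ∧ t = 0) ∨
    ∃ n : ℤ, ¬ (p : ℤ) ∣ n ∧ IsDominantTerm r (derivCoeff φ.coeff) (n - 1) ∧
      t = monomial r n (φ.coeff n)

end Dominance

/-! Closed annuli `Y = M(A)`, `X = M(B)` are given by their algebras of functions, and morphisms
`Y → X` by continuous `k`-algebra homomorphisms `B → A`. -/

section Covers

variable (k : Type*) [NormedField k] [IsUltrametricDist k] [CompleteSpace k]

/-- A monic coordinate on `M(A)`, given through the isomorphism `A ≃ k{T, r T⁻¹}` that it induces;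
the coordinate function itself is the preimage of `T`. -/
abbrev MonicCoordinate (r : ℝ≥0) (A : Type*) [CommRing A] [TopologicalSpace A] [Algebra k A] :=
  A ≃A[k] AnnulusAlgebra k r

/-- `M(A)` is a (strictly analytic) closed annulus of exponential modulus `r`. -/
def IsClosedAnnulus (r : ℝ≥0) (A : Type*) [CommRing A] [TopologicalSpace A] [Algebra k A] :
    Prop :=
  (∃ a : k, a ≠ 0 ∧ ‖a‖₊ = r) ∧ r ≤ 1 ∧ Nonempty (MonicCoordinate k r A)

variable {k}
variable {r s : ℝ≥0}
variable {A : Type*} [CommRing A] [TopologicalSpace A] [Algebra k A]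
variable {B : Type*} [CommRing B] [TopologicalSpace B] [Algebra k B]

/-- The morphism `M(A) → M(B)` given by `f` is finite étale of degree `m`. -/
structure IsFiniteEtaleOfDegree (m : ℕ) (f : B →A[k] A) : Prop where
  finite : (f : B →+* A).Finite
  etale : (f : B →+* A).Etale
  degree : letI : Algebra B A := (f : B →+* A).toAlgebra
    Module.finrank B A = m

/-- Two monic coordinates induce the same orientation of the annulus (of its skeleton, if `r < 1`,
and of the pair of infinite points of the reduction, if `r = 1`): the expansion of the first
one in powers of the second one has a dominant term of degree `1` (rather than `-1`). -/
def SameOrientation (e e' : MonicCoordinate k r A) : Prop :=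
  IsDominantTerm r (e' (e.symm (coord k r))).coeff 1

/-- The presentation of `f` in monic coordinates `y` (given by `eY`) and `x` (given by `eX`):
the series `φ` such that `x = φ(y)`. -/
def presentation (f : B →A[k] A) (eY : MonicCoordinate k r A) (eX : MonicCoordinate k s B) :
    AnnulusAlgebra k r :=
  eY (f (eX.symm (coord k s)))

/-- `φ` is a monic presentation (with dominant term `Tᵐ`) of `f`, with respect to some monic
coordinate on `X` and some monic coordinate on `Y` that induces the same orientation as `o`. -/
def IsMonicPresentation (m : ℕ) (s : ℝ≥0) (f : B →A[k] A) (o : MonicCoordinate k r A)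
    (φ : AnnulusAlgebra k r) : Prop :=
  (∃ (eY : MonicCoordinate k r A) (eX : MonicCoordinate k s B),
      SameOrientation o eY ∧ presentation f eY eX = φ) ∧
    IsDominantTerm r φ.coeff m ∧ φ.coeff m = 1

/-- `t` is a dominant tame term of the cover `f` of `Y` oriented by `o`: `t` is the dominant
tame term of a monic presentation (equivalently, of every monic presentation) up to
multiplication by a constant of absolute value `1`. -/
def IsDominantTameTerm (p : ℕ) (s : ℝ≥0) (f : B →A[k] A) (o : MonicCoordinate k r A)
    (t : AnnulusAlgebra k r) : Prop :=
  (∃ φ, IsMonicPresentation p s f o φ) ∧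
    ∀ φ, IsMonicPresentation p s f o φ →
      ∃ (t₀ : AnnulusAlgebra k r) (c : k),
        IsDominantTameTermOfSeries p φ t₀ ∧ ‖c‖ = 1 ∧ t = c • t₀

/-- `f` is a Kummer cover of degree `m`: `x = yᵐ` in some monic coordinates. -/
def IsKummer (m : ℕ) (r s : ℝ≥0) (f : B →A[k] A) : Prop :=
  ∃ (eY : MonicCoordinate k r A) (eX : MonicCoordinate k s B),
    presentation f eY eX = coord k r ^ m

end Covers

end BerkovichAnnulus

end

/-! A unit of `k{T, r T⁻¹}` has a single strictly dominant term on the whole annulus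
(`exists_hasLead_of_isUnit`), and the proof follows two such units. The first is a presentation `φ`
of the cover: finiteness of degree `p` forces its dominant term to have degree `p` or `-p` and its
image to fill the target annulus (`degree_eq`), so an inversion and a scaling of the coordinate on
`X` make it monic. The second is `T φ'`, given by the Euler derivation `euler`; it is invertible
because the cover is étale (`isUnit_euler_presentation`). Its dominant term `μ Tˡ` has `l = p` or `p
∤ l`: if `p ∣ l` and `l ≠ p`, then `|l c_l| ≤ |p|`, so this term cannot dominate the one of degree
`p`.

Normal form (`NormalFormData.exists_coordinates`). Put `c = 0` if `l = p` and `c = c_l` otherwise,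
and write `F` for the homomorphism with `F(T) = φ`. One looks for small `g` and `ε = w - 1` with `φ
(1 + F(g)) = (T w)ᵖ + c (T w)ˡ`, and separates exponents divisible by `p` from the others. In the
divisible exponents `F` is close to `T ↦ Tᵖ`, so these terms determine `g` from `ε`. The remaining
terms give an equation for `ε` whose linear part is `μ Tˡ ε`. The nonlinear terms of `(1 + ε)ᵖ` need
not be small compared with `μ`; but an exponent `i` prime to `p` satisfies `|i| = 1`, so the tame
part of a series is bounded by its derivative, and the derivative of a `p`-th power carries a factor
`p`. Measured in this way, the iteration is a contraction.

Invariance. The logarithmic derivative `T φ' / φ` has dominant degree `l - p`. A change of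
coordinates multiplies it only by units with constant dominant term `±1`, apart from the
substitution on the source (`hasLead_dlog_of_transition`). Hence `l` and `|μ|` depend only on the
orientation, and reversing the orientation replaces `l` by `2p - l`. A cover that is not Kummer has
`l ≠ p`, so `l > p` for one of the two orientations. The converse holds because the dominant term of
the derivative of a binomial comes from one of its two terms, and `l = p` makes the cover Kummer by
the normal form. -/

noncomputable section

namespace BerkovichAnnulus

/-! ### Norm, completeness and monomials in the annulus algebra. -/

namespace AnnulusAlgebra

variable {k : Type*} [NormedField k] [IsUltrametricDist k] [CompleteSpace k] {r s : ℝ≥0}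

theorem norm_le_iff {a : AnnulusAlgebra k r} {C : ℝ} :
    ‖a‖ ≤ C ↔ ∀ i, ‖a.coeff i‖ * weight r i ≤ C :=
  ⟨fun h i => (a.term_le_gaussNorm i).trans h, gaussNorm_le_of⟩

theorem term_le_norm (a : AnnulusAlgebra k r) (i : ℤ) : ‖a.coeff i‖ * weight r i ≤ ‖a‖ :=
  a.term_le_gaussNorm i

/-- Only finitely many terms exceed half of the norm, so the supremum is a maximum. This lets strict
bounds on the norm be tested term by term. -/
theorem exists_term_eq_norm (a : AnnulusAlgebra k r) : ∃ i, ‖a.coeff i‖ * weight r i = ‖a‖ := by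
  rcases eq_or_ne a 0 with rfl | ha
  · exact ⟨0, by simp⟩
  have hpos : 0 < ‖a‖ := norm_pos_iff.2 ha
  have h : ∀ᶠ i in cofinite, ‖a.coeff i‖ * weight r i < ‖a‖ / 2 :=
    a.tendsto_coeff.eventually_lt_const (half_pos hpos)
  rw [eventually_cofinite] at h
  by_contra! hne
  have hfin : {i | ¬‖a.coeff i‖ * weight r i < ‖a‖ / 2}.Finite := h
  rcases Set.eq_empty_or_nonempty {i | ¬‖a.coeff i‖ * weight r i < ‖a‖ / 2} with he | hn
  · have : ‖a‖ ≤ ‖a‖ / 2 := norm_le_iff.2 fun i => by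
      by_contra hi
      have : i ∈ {i | ¬‖a.coeff i‖ * weight r i < ‖a‖ / 2} := fun h => hi h.le
      rw [he] at this
      exact this
    linarith
  · obtain ⟨j, hj, hmax⟩ := hfin.exists_maximalFor (fun i => ‖a.coeff i‖ * weight r i) _ hn
    refine hne j (le_antisymm (term_le_norm a j) (norm_le_iff.2 fun i => ?_))
    by_cases hi : ‖a.coeff i‖ * weight r i < ‖a‖ / 2
    · exact hi.le.trans (not_lt.1 hj)
    · by_contra hlt
      exact hlt (hmax hi (not_le.1 hlt).le)

theorem norm_lt_iff {a : AnnulusAlgebra k r} {C : ℝ} :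
    ‖a‖ < C ↔ ∀ i, ‖a.coeff i‖ * weight r i < C := by
  refine ⟨fun h i => (term_le_norm a i).trans_lt h, fun h => ?_⟩
  obtain ⟨i, hi⟩ := exists_term_eq_norm a
  exact hi ▸ h i

instance : IsUltrametricDist (AnnulusAlgebra k r) :=
  IsUltrametricDist.isUltrametricDist_of_forall_norm_add_le_max_norm fun a b =>
    norm_le_iff.2 fun i => by
      have h1 := term_le_norm a i
      have h2 := term_le_norm b i
      have h3 := IsUltrametricDist.norm_add_le_max (a.coeff i) (b.coeff i)
      rw [coeff_add]
      rcases le_max_iff.1 h3 with h | h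
      · exact le_max_of_le_left ((mul_le_mul_of_nonneg_right h (weight_pos r i).le).trans h1)
      · exact le_max_of_le_right ((mul_le_mul_of_nonneg_right h (weight_pos r i).le).trans h2)

@[simp] theorem coeff_sub (a b : AnnulusAlgebra k r) (i : ℤ) :
    (a - b).coeff i = a.coeff i - b.coeff i := rfl

theorem norm_smul_eq (c : k) (a : AnnulusAlgebra k r) : ‖c • a‖ = ‖c‖ * ‖a‖ := by
  refine le_antisymm (norm_le_iff.2 fun i => ?_) ?_
  · rw [coeff_smul, norm_mul, mul_assoc]
    exact mul_le_mul_of_nonneg_left (term_le_norm a i) (norm_nonneg c)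
  · obtain ⟨i, hi⟩ := exists_term_eq_norm a
    rw [← hi, ← mul_assoc, ← norm_mul, ← coeff_smul]
    exact term_le_norm _ i

instance instNormedAlgebra : NormedAlgebra k (AnnulusAlgebra k r) :=
  { (inferInstance : Algebra k (AnnulusAlgebra k r)) with
    norm_smul_le := fun c a => (norm_smul_eq c a).le }

theorem norm_monomial (n : ℤ) (c : k) : ‖monomial r n c‖ = ‖c‖ * weight r n := by
  refine le_antisymm (norm_le_iff.2 fun i => ?_) ?_
  · rw [coeff_monomial]
    split_ifs with h
    · rw [h]
    · simpa using mul_nonneg (norm_nonneg c) (weight_pos r n).le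
  · have := term_le_norm (monomial r n c) n
    rwa [coeff_monomial, if_pos rfl] at this

instance : NormOneClass (AnnulusAlgebra k r) :=
  ⟨(norm_monomial (k := k) (r := r) 0 1).trans (by simp [weight_zero])⟩

theorem coeff_monomial_mul (n : ℤ) (c : k) (a : AnnulusAlgebra k r) (i : ℤ) :
    (monomial r n c * a).coeff i = c * a.coeff (i - n) := by
  rw [coeff_mul, tsum_eq_single n fun j hj => by rw [coeff_monomial, if_neg hj, zero_mul],
    coeff_monomial, if_pos rfl]

theorem monomial_mul_monomial (m n : ℤ) (c d : k) :
    monomial r m c * monomial r n d = monomial r (m + n) (c * d) := by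
  ext i
  rw [coeff_monomial_mul, coeff_monomial, coeff_monomial]
  by_cases h : i = m + n
  · rw [if_pos (by omega), if_pos h]
  · rw [if_neg (by omega), if_neg h, mul_zero]

theorem one_eq_monomial : (1 : AnnulusAlgebra k r) = monomial r 0 1 := rfl

theorem smul_monomial (c d : k) (n : ℤ) : c • monomial r n d = monomial r n (c * d) := by
  ext i
  rw [coeff_smul, coeff_monomial, coeff_monomial, mul_ite, mul_zero]

theorem monomial_zero_right (n : ℤ) : monomial r n (0 : k) = 0 := by
  ext i
  rw [coeff_monomial, ite_self, coeff_zero]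

theorem monomial_pow (m : ℤ) (c : k) (n : ℕ) :
    monomial r m c ^ n = monomial r (n * m) (c ^ n) := by
  induction n with
  | zero => simp [one_eq_monomial]
  | succ n ih =>
    rw [pow_succ, ih, monomial_mul_monomial, pow_succ]
    congr 1
    push_cast
    ring

theorem coord_pow (n : ℕ) : coord k r ^ n = monomial r n 1 := by
  rw [coord, monomial_pow, one_pow, mul_one]

/-- A nonzero monomial as a unit. -/
def monomialUnit (r : ℝ≥0) (n : ℤ) (c : k) (hc : c ≠ 0) : (AnnulusAlgebra k r)ˣ where
  val := monomial r n c
  inv := monomial r (-n) c⁻¹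
  val_inv := by rw [monomial_mul_monomial, add_neg_cancel, mul_inv_cancel₀ hc]; rfl
  inv_val := by rw [monomial_mul_monomial, neg_add_cancel, inv_mul_cancel₀ hc]; rfl

theorem coe_monomialUnit_zpow (n : ℤ) (c : k) (hc : c ≠ 0) (i : ℤ) :
    ((monomialUnit r n c hc ^ i : (AnnulusAlgebra k r)ˣ) : AnnulusAlgebra k r)
      = monomial r (i * n) (c ^ i) := by
  have h (u : (AnnulusAlgebra k r)ˣ) (j : ℕ) (hu : (u : AnnulusAlgebra k r) = monomial r n c) :
      ((u ^ j : (AnnulusAlgebra k r)ˣ) : AnnulusAlgebra k r) = monomial r (j * n) (c ^ j) := by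
    rw [Units.val_pow_eq_pow_val, hu, monomial_pow]
  obtain ⟨j, rfl | rfl⟩ := i.eq_nat_or_neg
  · rw [zpow_natCast, h _ j rfl, zpow_natCast]
  · rw [zpow_neg, zpow_natCast, ← inv_pow, Units.val_pow_eq_pow_val]
    change monomial r (-n) c⁻¹ ^ j = _
    rw [monomial_pow, zpow_neg, zpow_natCast, inv_pow]
    congr 1
    ring

/-- The limit is taken coefficientwise. The Cauchy estimate for weighted coefficients is uniform in
the index, so it survives the limit and gives both the decay of the limit coefficients and
convergence in norm. -/
instance : CompleteSpace (AnnulusAlgebra k r) := by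
  refine Metric.complete_of_cauchySeq_tendsto fun u hu => ?_
  have hc (i : ℤ) : CauchySeq fun n => (u n).coeff i := by
    rw [Metric.cauchySeq_iff'] at hu ⊢
    intro ε hε
    obtain ⟨N, hN⟩ := hu ε hε
    refine ⟨N, fun n hn => lt_of_le_of_lt ?_ (hN n hn)⟩
    rw [dist_eq_norm, dist_eq_norm, ← coeff_sub]
    exact coeff_le_gaussNorm _ i
  choose L hL using fun i => cauchySeq_tendsto_of_complete (hc i)
  have key : ∀ ε > 0, ∃ N, ∀ n ≥ N, ∀ i, ‖(u n).coeff i - L i‖ * weight r i ≤ ε := by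
    intro ε hε
    obtain ⟨N, hN⟩ := Metric.cauchySeq_iff.1 hu ε hε
    refine ⟨N, fun n hn i => ?_⟩
    have ht : Tendsto (fun m => ‖(u n).coeff i - (u m).coeff i‖ * weight r i) atTop
        (𝓝 (‖(u n).coeff i - L i‖ * weight r i)) :=
      ((hL i).const_sub _).norm.mul_const _
    refine le_of_tendsto ht ((eventually_ge_atTop N).mono fun m hm => ?_)
    have := hN n hn m hm
    rw [dist_eq_norm] at this
    exact (term_le_norm (u n - u m) i).trans this.le
  have hmem : Tendsto (fun i => ‖L i‖ * weight r i) cofinite (𝓝 0) := by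
    rw [Metric.tendsto_nhds]
    intro ε hε
    obtain ⟨N, hN⟩ := key (ε / 2) (half_pos hε)
    have h := (u N).tendsto_coeff.eventually_lt_const (half_pos hε)
    filter_upwards [h] with i hi
    rw [Real.dist_0_eq_abs, abs_of_nonneg (mul_nonneg (norm_nonneg _) (weight_pos r i).le)]
    have h1 : ‖L i‖ ≤ ‖(u N).coeff i‖ + ‖(u N).coeff i - L i‖ := by
      rw [← norm_neg ((u N).coeff i - L i)]
      refine le_trans (le_of_eq ?_) (norm_add_le _ _)
      congr 1
      ring
    have h2 := mul_le_mul_of_nonneg_right h1 (weight_pos r i).le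
    rw [add_mul] at h2
    linarith [hN N le_rfl i]
  obtain ⟨b, rfl⟩ : ∃ b : AnnulusAlgebra k r, L = b.coeff :=
    ⟨(⟨L, hmem⟩ : convergentSeries k r), rfl⟩
  refine ⟨b, Metric.tendsto_atTop.2 ?_⟩
  intro ε hε
  obtain ⟨N, hN⟩ := key (ε / 2) (half_pos hε)
  refine ⟨N, fun n hn => ?_⟩
  rw [dist_eq_norm]
  exact lt_of_le_of_lt (norm_le_iff.2 (hN n hn)) (half_lt_self hε)

/-- The coefficient of `Tⁱ` as a continuous linear functional. -/
def coeffL (k : Type*) [NormedField k] [IsUltrametricDist k] [CompleteSpace k] (r : ℝ≥0) (i : ℤ) :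
    AnnulusAlgebra k r →L[k] k where
  toFun a := a.coeff i
  map_add' _ _ := rfl
  map_smul' _ _ := rfl
  cont := by
    refine continuous_iff_continuousAt.2 fun a => ?_
    refine tendsto_iff_norm_sub_tendsto_zero.2 ?_
    have h := tendsto_iff_norm_sub_tendsto_zero.1 (tendsto_id (x := 𝓝 a))
    exact squeeze_zero (fun _ => norm_nonneg _) (fun b => (b - a).coeff_le_gaussNorm i) h

/-- In an ultrametric complete group, terms tending to zero are summable; the coefficient
functionals then identify the sum. Consequently continuous linear maps can be compared on monomials.
-/
theorem hasSum_monomial (a : AnnulusAlgebra k r) :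
    HasSum (fun i => a.coeff i • monomial r i (1 : k)) a := by
  have hs : Summable fun i => a.coeff i • monomial r i (1 : k) := by
    refine NonarchimedeanAddGroup.summable_of_tendsto_cofinite_zero ?_
    rw [tendsto_zero_iff_norm_tendsto_zero]
    refine a.tendsto_coeff.congr fun i => ?_
    rw [norm_smul_eq, norm_monomial, norm_one, one_mul]
  convert hs.hasSum using 1
  ext j
  have h := (coeffL k r j).map_tsum hs
  change (∑' i, a.coeff i • monomial r i (1 : k)).coeff j = _ at h
  rw [h, tsum_eq_single j fun i hi => by
    change (a.coeff i • monomial r i (1 : k)).coeff j = 0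
    rw [coeff_smul, coeff_monomial, if_neg (Ne.symm hi), mul_zero]]
  change _ = (a.coeff j • monomial r j (1 : k)).coeff j
  rw [coeff_smul, coeff_monomial, if_pos rfl, mul_one]

/-- Continuous linear maps out of an annulus algebra are determined on the monomials `Tⁱ`. -/
theorem continuousLinearMap_ext {M : Type*} [AddCommGroup M] [TopologicalSpace M] [T2Space M]
    [Module k M] {f g : AnnulusAlgebra k r →L[k] M}
    (h : ∀ i, f (monomial r i 1) = g (monomial r i 1)) : f = g := by
  ext a
  have hf := (hasSum_monomial a).mapL f
  have hg := (hasSum_monomial a).mapL g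
  simp only [map_smul, h] at hf hg
  exact hf.unique hg

/-! Series with prescribed values on the monomials. -/

theorem summable_smul {g : ℤ → AnnulusAlgebra k r} {C : ℝ} (hg : ∀ i, ‖g i‖ ≤ C * weight s i)
    (a : AnnulusAlgebra k s) : Summable fun i => a.coeff i • g i := by
  refine NonarchimedeanAddGroup.summable_of_tendsto_cofinite_zero ?_
  rw [tendsto_zero_iff_norm_tendsto_zero]
  have h := a.tendsto_coeff.const_mul C
  rw [mul_zero] at h
  refine squeeze_zero (fun _ => norm_nonneg _) (fun i => ?_) h
  rw [norm_smul_eq]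
  calc _ ≤ ‖a.coeff i‖ * (C * weight s i) := mul_le_mul_of_nonneg_left (hg i) (norm_nonneg _)
    _ = _ := by ring

theorem norm_tsum_le {ι : Type*} {f : ι → AnnulusAlgebra k r} {C : ℝ} (hC : 0 ≤ C)
    (h : ∀ i, ‖f i‖ ≤ C) : ‖∑' i, f i‖ ≤ C := by
  by_cases hf : Summable f
  · refine le_of_tendsto hf.hasSum.norm (Eventually.of_forall fun s => ?_)
    exact IsUltrametricDist.norm_sum_le_of_forall_le_of_nonneg hC (fun i _ => h i)
  · rw [tsum_eq_zero_of_not_summable hf]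
    simpa using hC

theorem norm_tsum_smul_le {g : ℤ → AnnulusAlgebra k r} {C : ℝ}
    (hg : ∀ i, ‖g i‖ ≤ C * weight s i) (a : AnnulusAlgebra k s) :
    ‖∑' i, a.coeff i • g i‖ ≤ C * ‖a‖ := by
  have hC : 0 ≤ C := by
    have := (norm_nonneg _).trans (hg 0)
    rwa [weight_zero, mul_one] at this
  refine norm_tsum_le (mul_nonneg hC (norm_nonneg a)) fun i => ?_
  rw [norm_smul_eq]
  calc _ ≤ ‖a.coeff i‖ * (C * weight s i) := mul_le_mul_of_nonneg_left (hg i) (norm_nonneg _)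
    _ = C * (‖a.coeff i‖ * weight s i) := by ring
    _ ≤ _ := mul_le_mul_of_nonneg_left (term_le_norm a i) hC

theorem continuous_of_norm_map_le {M N : Type*} [SeminormedAddCommGroup M]
    [SeminormedAddCommGroup N] (f : M →+ N) {C : ℝ} (h : ∀ a, ‖f a‖ ≤ C * ‖a‖) :
    Continuous f := by
  refine continuous_of_continuousAt_zero f ?_
  rw [ContinuousAt, map_zero]
  refine squeeze_zero_norm h ?_
  simpa using (tendsto_norm_zero (E := M)).const_mul C

/-- The continuous linear map with prescribed values on the monomials `Tⁱ`. -/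
def ofMonomials (g : ℤ → AnnulusAlgebra k r) {C : ℝ} (hg : ∀ i, ‖g i‖ ≤ C * weight s i) :
    AnnulusAlgebra k s →L[k] AnnulusAlgebra k r :=
  let f : AnnulusAlgebra k s →ₗ[k] AnnulusAlgebra k r :=
    { toFun := fun a => ∑' i, a.coeff i • g i
      map_add' := fun a b => by
        rw [← (summable_smul hg a).tsum_add (summable_smul hg b)]
        exact tsum_congr fun i => by rw [coeff_add, add_smul]
      map_smul' := fun c a => by
        rw [RingHom.id_apply, ← (summable_smul hg a).tsum_const_smul c]
        exact tsum_congr fun i => by rw [coeff_smul, mul_smul] }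
  { f with cont := continuous_of_norm_map_le f.toAddMonoidHom (norm_tsum_smul_le hg) }

section
variable {g : ℤ → AnnulusAlgebra k r} {C : ℝ} (hg : ∀ i, ‖g i‖ ≤ C * weight s i)
include hg

theorem ofMonomials_apply (a : AnnulusAlgebra k s) :
    ofMonomials g hg a = ∑' i, a.coeff i • g i := rfl

theorem ofMonomials_monomial (n : ℤ) (c : k) :
    ofMonomials g hg (monomial s n c) = c • g n := by
  rw [ofMonomials_apply, tsum_eq_single n fun i hi => by
    rw [coeff_monomial, if_neg hi, zero_smul], coeff_monomial, if_pos rfl]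

end

theorem norm_ofMonomials_le {g : ℤ → AnnulusAlgebra k r} {C : ℝ}
    (hg : ∀ i, ‖g i‖ ≤ C * weight s i) (a : AnnulusAlgebra k s) :
    ‖ofMonomials g hg a‖ ≤ C * ‖a‖ := norm_tsum_smul_le hg a

/-- A bound on monomials extends to all series. -/
theorem norm_map_le_of_monomial (f : AnnulusAlgebra k s →L[k] AnnulusAlgebra k r) {C : ℝ}
    (h : ∀ i, ‖f (monomial s i 1)‖ ≤ C * weight s i) (a : AnnulusAlgebra k s) :
    ‖f a‖ ≤ C * ‖a‖ := by
  have : f = ofMonomials (fun i => f (monomial s i 1)) h :=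
    continuousLinearMap_ext fun i => by rw [ofMonomials_monomial, one_smul]
  rw [this]
  exact norm_ofMonomials_le h a

/-! Perturbations of the identity. -/

theorem norm_eq_of_norm_sub_lt {M : Type*} [SeminormedAddCommGroup M] [IsUltrametricDist M]
    {a b : M} (h : ‖a - b‖ < ‖b‖) : ‖a‖ = ‖b‖ := by
  have := IsUltrametricDist.norm_add_eq_max_of_norm_ne_norm (x := a - b) (y := b) h.ne
  rw [sub_add_cancel] at this
  rw [this, max_eq_right h.le]

/-- A fixed point theorem on a closed ball in an ultrametric Banach space. -/
theorem exists_fixedPoint_of_ball {M : Type*} [NormedAddCommGroup M] [IsUltrametricDist M]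
    [CompleteSpace M] (K : M → M) {η θ : ℝ} (hη : 0 ≤ η) (hθ : 0 ≤ θ) (hθ1 : θ < 1)
    (h0 : ‖K 0‖ ≤ η)
    (hK : ∀ a b, ‖a‖ ≤ η → ‖b‖ ≤ η → ‖K a - K b‖ ≤ θ * ‖a - b‖) :
    ∃ a, ‖a‖ ≤ η ∧ K a = a := by
  have hmaps : Set.MapsTo K (Metric.closedBall 0 η) (Metric.closedBall 0 η) := by
    intro a ha
    rw [mem_closedBall_zero_iff] at ha ⊢
    have h1 := hK a 0 ha (by simpa using hη)
    rw [sub_zero] at h1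
    have h2 : ‖K a - K 0‖ ≤ η := h1.trans ((mul_le_of_le_one_left (norm_nonneg _) hθ1.le).trans ha)
    have h3 := IsUltrametricDist.norm_add_le_max (K a - K 0) (K 0)
    rw [sub_add_cancel] at h3
    exact h3.trans (max_le h2 h0)
  have hcontr : ContractingWith ⟨θ, hθ⟩ (hmaps.restrict K _ _) := by
    refine ⟨by exact_mod_cast hθ1, LipschitzWith.of_dist_le_mul fun a b => ?_⟩
    rw [Subtype.dist_eq, Subtype.dist_eq, dist_eq_norm, dist_eq_norm]
    exact hK a b (mem_closedBall_zero_iff.1 a.2) (mem_closedBall_zero_iff.1 b.2)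
  obtain ⟨a, ha, hfix, -⟩ := ContractingWith.exists_fixedPoint' Metric.isClosed_closedBall.isComplete
    hmaps hcontr (x := 0) (by simpa using hη) (edist_ne_top _ _)
  exact ⟨a, by simpa using ha, hfix⟩

section
variable {M : Type*} [NormedAddCommGroup M] [IsUltrametricDist M] {E : M →+ M} {θ : ℝ}
  (hθ : θ < 1) (hE : ∀ a, ‖E a - a‖ ≤ θ * ‖a‖)
include hθ hE

theorem norm_map_eq_of_near_id (a : M) : ‖E a‖ = ‖a‖ := by
  rcases eq_or_ne a 0 with rfl | ha
  · simp
  · exact norm_eq_of_norm_sub_lt ((hE a).trans_lt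
      (mul_lt_of_lt_one_left (norm_pos_iff.2 ha) hθ))

/-- Injectivity holds because `E` is isometric. For surjectivity, a preimage of `b` is a fixed point
of the contraction `a ↦ b - (E a - a)`. -/
theorem bijective_of_near_id [CompleteSpace M] : Function.Bijective E := by
  refine ⟨(injective_iff_map_eq_zero E).2 fun a ha => ?_, fun b => ?_⟩
  · have := norm_map_eq_of_near_id hθ hE a
    rw [ha, norm_zero] at this
    exact norm_eq_zero.1 this.symm
  -- The fixed point theorem needs a nonnegative constant, and nothing prevents `θ` from being
  -- negative.
  · have hE' (a : M) : ‖E a - a‖ ≤ max θ 0 * ‖a‖ :=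
      (hE a).trans (mul_le_mul_of_nonneg_right (le_max_left _ _) (norm_nonneg _))
    obtain ⟨a, -, ha⟩ := exists_fixedPoint_of_ball (fun a => b - (E a - a)) (norm_nonneg b)
      (le_max_right θ 0) (max_lt hθ one_pos) (by simp) fun a a' _ _ => by
        have : b - (E a - a) - (b - (E a' - a')) = -(E (a - a') - (a - a')) := by
          rw [map_sub]; abel
        rw [this, norm_neg]
        exact hE' _
    refine ⟨a, ?_⟩
    have h2 : b - (E a - a) = a := ha
    rw [sub_eq_iff_eq_add, add_sub_cancel] at h2
    exact h2.symm

end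

end AnnulusAlgebra
-- Principal units and their powers in an ultrametric normed ring.
section PrincipalUnits

variable {R : Type*} [NormedCommRing R] [NormOneClass R] [IsUltrametricDist R]

theorem norm_add_lt_of_lt {M : Type*} [SeminormedAddCommGroup M] [IsUltrametricDist M] {a b : M}
    {C : ℝ} (ha : ‖a‖ < C) (hb : ‖b‖ < C) : ‖a + b‖ < C :=
  (IsUltrametricDist.norm_add_le_max a b).trans_lt (max_lt ha hb)

theorem norm_add_le_of_le' {M : Type*} [SeminormedAddCommGroup M] [IsUltrametricDist M] {a b : M}
    {C : ℝ} (ha : ‖a‖ ≤ C) (hb : ‖b‖ ≤ C) : ‖a + b‖ ≤ C :=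
  (IsUltrametricDist.norm_add_le_max a b).trans (max_le ha hb)

theorem norm_sub_le_of_le' {M : Type*} [SeminormedAddCommGroup M] [IsUltrametricDist M] {a b : M}
    {C : ℝ} (ha : ‖a‖ ≤ C) (hb : ‖b‖ ≤ C) : ‖a - b‖ ≤ C := by
  rw [sub_eq_add_neg]
  exact norm_add_le_of_le' ha (by rwa [norm_neg])

theorem norm_sub_lt_of_lt {M : Type*} [SeminormedAddCommGroup M] [IsUltrametricDist M] {a b : M}
    {C : ℝ} (ha : ‖a‖ < C) (hb : ‖b‖ < C) : ‖a - b‖ < C := by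
  rw [sub_eq_add_neg]
  exact norm_add_lt_of_lt ha (by rwa [norm_neg])

theorem norm_mul_le_of_le_one_left {a b : R} {C : ℝ} (ha : ‖a‖ ≤ 1) (hb : ‖b‖ ≤ C) :
    ‖a * b‖ ≤ C :=
  (norm_mul_le a b).trans ((mul_le_of_le_one_left (norm_nonneg b) ha).trans hb)

theorem norm_mul_le_of_le_one_right {a b : R} {C : ℝ} (ha : ‖a‖ ≤ C) (hb : ‖b‖ ≤ 1) :
    ‖a * b‖ ≤ C := by
  rw [mul_comm]
  exact norm_mul_le_of_le_one_left hb ha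

theorem norm_intCast_le_one (n : ℤ) : ‖(n : R)‖ ≤ 1 := by
  have h (m : ℕ) : ‖(m : R)‖ ≤ 1 := IsUltrametricDist.norm_natCast_le_one R m
  obtain ⟨m, rfl | rfl⟩ := n.eq_nat_or_neg
  · simpa using h m
  · simpa using h m

theorem norm_le_one_of_near_one {a : R} {η : ℝ} (hη : η ≤ 1) (ha : ‖a - 1‖ ≤ η) : ‖a‖ ≤ 1 := by
  have := norm_add_le_of_le' (ha.trans hη) (norm_one (α := R)).le
  rwa [sub_add_cancel] at this

theorem norm_mul_sub_one_le {a b : R} {η : ℝ} (hη : η ≤ 1) (ha : ‖a - 1‖ ≤ η)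
    (hb : ‖b - 1‖ ≤ η) : ‖a * b - 1‖ ≤ η := by
  have : a * b - 1 = a * (b - 1) + (a - 1) := by ring
  rw [this]
  exact norm_add_le_of_le' (norm_mul_le_of_le_one_left (norm_le_one_of_near_one hη ha) hb) ha

/-- From `u⁻¹ - 1 = -(u - 1) u⁻¹`, the distance from `u⁻¹` to `1` is smaller than the norm of `u⁻¹`,
which is therefore `1`; the same identity then gives the bound. -/
theorem norm_inv_sub_one_le (u : Rˣ) {η : ℝ} (hη : η < 1) (hu : ‖(u : R) - 1‖ ≤ η) :
    ‖((u⁻¹ : Rˣ) : R) - 1‖ ≤ η := by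
  have : Nontrivial R := NormOneClass.nontrivial
  have h1 : ((u⁻¹ : Rˣ) : R) - 1 = -(((u : R) - 1) * (u⁻¹ : Rˣ)) := by
    rw [sub_mul, Units.mul_inv]; ring
  have h0 : 0 < ‖((u⁻¹ : Rˣ) : R)‖ := norm_pos_iff.2 (Units.ne_zero _)
  have h2 : ‖((u⁻¹ : Rˣ) : R) - 1‖ ≤ η * ‖((u⁻¹ : Rˣ) : R)‖ := by
    rw [h1, norm_neg]
    exact (norm_mul_le _ _).trans (mul_le_mul_of_nonneg_right hu h0.le)
  have h3 : ‖((u⁻¹ : Rˣ) : R)‖ = 1 := by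
    have h4 : ‖1 - ((u⁻¹ : Rˣ) : R)‖ < ‖((u⁻¹ : Rˣ) : R)‖ := by
      rw [norm_sub_rev]
      exact h2.trans_lt (mul_lt_of_lt_one_left h0 hη)
    rw [← AnnulusAlgebra.norm_eq_of_norm_sub_lt h4, norm_one]
  rwa [h3, mul_one] at h2

theorem norm_zpow_sub_one_le (u : Rˣ) {η : ℝ} (hη : η < 1) (hu : ‖(u : R) - 1‖ ≤ η) (i : ℤ) :
    ‖((u ^ i : Rˣ) : R) - 1‖ ≤ η := by
  have h (w : Rˣ) (hw : ‖(w : R) - 1‖ ≤ η) (n : ℕ) : ‖((w ^ n : Rˣ) : R) - 1‖ ≤ η := by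
    induction n with
    | zero => simpa using (norm_nonneg _).trans hu
    | succ n ih =>
      rw [pow_succ, Units.val_mul]
      exact norm_mul_sub_one_le hη.le ih hw
  obtain ⟨n, rfl | rfl⟩ := i.eq_nat_or_neg
  · simpa using h u hu n
  · rw [zpow_neg, zpow_natCast, ← inv_pow]
    exact h _ (norm_inv_sub_one_le u hη hu) n

/-- The power map with exponent `j` has derivative close to `j` near `1`. -/
theorem norm_zpow_sub_zpow_sub_le (u w : Rˣ) {η : ℝ} (hη : η < 1) (hu : ‖(u : R) - 1‖ ≤ η)
    (hw : ‖(w : R) - 1‖ ≤ η) (j : ℤ) :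
    ‖((u ^ j : Rˣ) : R) - (w ^ j : Rˣ) - j * (u - w)‖ ≤ η * ‖(u : R) - w‖ := by
  have hη0 : 0 ≤ η := (norm_nonneg _).trans hu
  have hnat (u w : Rˣ) (hu : ‖(u : R) - 1‖ ≤ η) (hw : ‖(w : R) - 1‖ ≤ η) (n : ℕ) :
      ‖((u ^ n : Rˣ) : R) - (w ^ n : Rˣ) - n * (u - w)‖ ≤ η * ‖(u : R) - w‖ := by
    induction n with
    | zero => simpa using mul_nonneg hη0 (norm_nonneg _)
    | succ n ih =>
      have hwn := norm_zpow_sub_one_le w hη hw n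
      rw [zpow_natCast] at hwn
      -- Besides the inductive remainder, the new error terms are products of `u - w` with `u - 1`
      -- or `wⁿ - 1`.
      have e : ((u ^ (n + 1) : Rˣ) : R) - (w ^ (n + 1) : Rˣ) - (n + 1 : ℕ) * (u - w)
          = u * (((u ^ n : Rˣ) : R) - (w ^ n : Rˣ) - n * (u - w))
            + (n * ((u - 1) * (u - w)) + (((w ^ n : Rˣ) : R) - 1) * (u - w)) := by
        simp only [Units.val_pow_eq_pow_val]; push_cast; ring
      have hn : ‖(n : R)‖ ≤ 1 := IsUltrametricDist.norm_natCast_le_one R n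
      rw [e]
      refine norm_add_le_of_le'
        (norm_mul_le_of_le_one_left (norm_le_one_of_near_one hη.le hu) ih)
        (norm_add_le_of_le' (norm_mul_le_of_le_one_left hn ?_) ?_)
      · exact (norm_mul_le _ _).trans (mul_le_mul_of_nonneg_right hu (norm_nonneg _))
      · exact (norm_mul_le _ _).trans (mul_le_mul_of_nonneg_right hwn (norm_nonneg _))
  obtain ⟨n, rfl | rfl⟩ := j.eq_nat_or_neg
  · simpa using hnat u w hu hw n
  · have hu' := norm_inv_sub_one_le u hη hu
    have hw' := norm_inv_sub_one_le w hη hw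
    have h1 := hnat _ _ hu' hw' n
    have e1 : ((u⁻¹ : Rˣ) : R) - (w⁻¹ : Rˣ) = -((u - w) * ((u⁻¹ : Rˣ) * (w⁻¹ : Rˣ))) := by
      linear_combination (-((u⁻¹ : Rˣ) : R)) * Units.mul_inv w + ((w⁻¹ : Rˣ) : R) * Units.mul_inv u
    have h2 : ‖((u⁻¹ : Rˣ) : R) - (w⁻¹ : Rˣ)‖ ≤ ‖(u : R) - w‖ := by
      rw [e1, norm_neg]
      refine norm_mul_le_of_le_one_right le_rfl ?_
      exact norm_mul_le_of_le_one_left (norm_le_one_of_near_one hη.le hu')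
        (norm_le_one_of_near_one hη.le hw')
    have h3 := norm_mul_sub_one_le hη.le hu' hw'
    -- Negative powers are positive powers of the inverses, and `u⁻¹ - w⁻¹` equals `-(u - w)` up to
    -- the factor `u⁻¹ w⁻¹`, which is close to `1`.
    have e2 : ((u ^ (-(n : ℤ)) : Rˣ) : R) - (w ^ (-(n : ℤ)) : Rˣ) - ((-(n : ℤ) : ℤ) : R) * (u - w)
        = (((u⁻¹ ^ n : Rˣ) : R) - (w⁻¹ ^ n : Rˣ) - n * ((u⁻¹ : Rˣ) - (w⁻¹ : Rˣ)))
          - n * ((((u⁻¹ : Rˣ) : R) * (w⁻¹ : Rˣ) - 1) * (u - w)) := by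
      rw [e1, zpow_neg, zpow_neg, zpow_natCast, zpow_natCast, inv_pow, inv_pow]
      push_cast
      ring
    rw [e2]
    refine norm_sub_le_of_le' (h1.trans (mul_le_mul_of_nonneg_left h2 hη0))
      (norm_mul_le_of_le_one_left (IsUltrametricDist.norm_natCast_le_one R n) ?_)
    exact (norm_mul_le _ _).trans (mul_le_mul_of_nonneg_right h3 (norm_nonneg _))

theorem norm_zpow_sub_zpow_le (u w : Rˣ) {η : ℝ} (hη : η < 1) (hu : ‖(u : R) - 1‖ ≤ η)
    (hw : ‖(w : R) - 1‖ ≤ η) (j : ℤ) :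
    ‖((u ^ j : Rˣ) : R) - (w ^ j : Rˣ)‖ ≤ max ‖(j : R)‖ η * ‖(u : R) - w‖ := by
  have h := norm_add_le_of_le'
    ((norm_zpow_sub_zpow_sub_le u w hη hu hw j).trans
      (mul_le_mul_of_nonneg_right (le_max_right ‖(j : R)‖ η) (norm_nonneg _)))
    ((norm_mul_le (j : R) (u - w)).trans
      (mul_le_mul_of_nonneg_right (le_max_left ‖(j : R)‖ η) (norm_nonneg _)))
  rwa [sub_add_cancel] at h

theorem exists_unit_eq_one_add [CompleteSpace R] {v : R} (hv : ‖v‖ < 1) :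
    ∃ u : Rˣ, (u : R) = 1 + v :=
  ⟨Units.oneSub (-v) (by rwa [norm_neg]), by simp⟩

end PrincipalUnits

/-- Otherwise a Bézout relation `a p + b n = 1` would write `1` as a sum of two elements of norm
less than `1`. -/
theorem norm_intCast_eq_one_of_not_dvd {k : Type*} [NormedField k] [IsUltrametricDist k] {p : ℕ}
    (hp : p.Prime) (hkp : ‖(p : k)‖ < 1) {n : ℤ} (hn : ¬ (p : ℤ) ∣ n) : ‖(n : k)‖ = 1 := by
  have hc : IsCoprime (p : ℤ) n :=
    (Prime.coprime_iff_not_dvd (Nat.prime_iff_prime_int.1 hp)).2 hn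
  obtain ⟨a, b, hab⟩ := hc
  refine le_antisymm (norm_intCast_le_one n) ?_
  by_contra! hlt
  have h1 : ‖((a * p + b * n : ℤ) : k)‖ < 1 := by
    push_cast
    refine norm_add_lt_of_lt ?_ ?_
    · rw [norm_mul]
      exact (mul_le_of_le_one_left (norm_nonneg _) (norm_intCast_le_one a)).trans_lt hkp
    · rw [norm_mul]
      exact (mul_le_of_le_one_left (norm_nonneg _) (norm_intCast_le_one b)).trans_lt hlt
  rw [hab] at h1
  simp at h1

theorem norm_intCast_le_of_dvd {k : Type*} [NormedField k] [IsUltrametricDist k] {p : ℕ}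
    {n : ℤ} (hn : (p : ℤ) ∣ n) : ‖(n : k)‖ ≤ ‖(p : k)‖ := by
  obtain ⟨m, rfl⟩ := hn
  push_cast
  rw [norm_mul]
  exact mul_le_of_le_one_right (norm_nonneg _) (norm_intCast_le_one m)

/-- A strict bound is not preserved by limits in general; here a finite partial sum is strictly
bounded and the rest of the sum can be made strictly smaller than `C`. -/
theorem norm_tsum_lt {k ι : Type*} [NormedField k] [IsUltrametricDist k] {f : ι → k} {C : ℝ}
    (hC : 0 < C) (h : ∀ i, ‖f i‖ < C) : ‖∑' i, f i‖ < C := by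
  by_cases hf : Summable f
  · have h1 := hf.hasSum
    have h2 : ∀ᶠ t : Finset ι in atTop, ‖∑' i, f i - ∑ i ∈ t, f i‖ < C := by
      have := (tendsto_iff_norm_sub_tendsto_zero.1 h1).eventually_lt_const hC
      filter_upwards [this] with t ht
      rwa [norm_sub_rev]
    obtain ⟨t, ht⟩ := h2.exists
    have h3 : ‖∑ i ∈ t, f i‖ < C :=
      Finset.sum_induction f (fun x => ‖x‖ < C) (fun _ _ => norm_add_lt_of_lt) (by simpa)
        fun i _ => h i
    have := norm_add_lt_of_lt ht h3
    rwa [sub_add_cancel] at this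
  · rw [tsum_eq_zero_of_not_summable hf]
    simpa using hC

/-! ### Dominant terms and the structure of units. -/

namespace AnnulusAlgebra

variable {k : Type*} [NormedField k] [IsUltrametricDist k] [CompleteSpace k] {r s : ℝ≥0}

instance : Nontrivial (AnnulusAlgebra k r) := NormOneClass.nontrivial

/-- The series `g` is `κ Tⁿ` times a series that differs from `1` by a series of norm less
than `1`. -/
def HasLead (g : AnnulusAlgebra k r) (κ : k) (n : ℤ) : Prop :=
  κ ≠ 0 ∧ ∃ v, ‖v‖ < 1 ∧ g = monomial r n κ * (1 + v)

theorem weight_of_nonneg (hr1 : r ≤ 1) {i : ℤ} (hi : 0 ≤ i) : weight r i = 1 := by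
  lift i to ℕ using hi
  refine max_eq_left ?_
  rw [zpow_natCast]
  exact pow_le_one₀ r.2 hr1

theorem weight_of_nonpos (hr0 : 0 < r) (hr1 : r ≤ 1) {i : ℤ} (hi : i ≤ 0) :
    weight r i = (r : ℝ) ^ i :=
  max_eq_right (one_le_zpow_of_nonpos₀ (by exact_mod_cast hr0) hr1 hi)

theorem zpow_le_weight (hr0 : 0 < r) {ρ : ℝ} (h1 : (r : ℝ) ≤ ρ) (h2 : ρ ≤ 1)
    (i : ℤ) : ρ ^ i ≤ weight r i := by
  have hr : (0 : ℝ) < r := by exact_mod_cast hr0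
  rcases le_total 0 i with hi | hi
  · lift i to ℕ using hi
    rw [zpow_natCast]
    exact (pow_le_one₀ (hr.le.trans h1) h2).trans (one_le_weight r i)
  · obtain ⟨n, rfl⟩ : ∃ n : ℕ, i = -n := ⟨(-i).toNat, by omega⟩
    refine le_trans ?_ (le_max_right _ _)
    rw [zpow_neg, zpow_neg, zpow_natCast, zpow_natCast]
    exact inv_anti₀ (pow_pos hr n) (pow_le_pow_left₀ hr.le h1 n)

theorem HasLead.coeff_add {g : AnnulusAlgebra k r} {κ : k} {n : ℤ} {v : AnnulusAlgebra k r}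
    (h : g = monomial r n κ * (1 + v)) (i : ℤ) :
    g.coeff (n + i) = κ * ((if i = 0 then 1 else 0) + v.coeff i) := by
  rw [h, coeff_monomial_mul, add_sub_cancel_left, AnnulusAlgebra.coeff_add, coeff_one]

/-- The constant `κ` need not be the coefficient itself: only its absolute value is determined by
the series. -/
theorem HasLead.norm_coeff {g : AnnulusAlgebra k r} {κ : k} {n : ℤ} (h : HasLead g κ n) :
    ‖g.coeff n‖ = ‖κ‖ := by
  obtain ⟨-, v, hv, hg⟩ := h
  have := HasLead.coeff_add hg 0
  rw [add_zero, if_pos rfl] at this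
  rw [this, norm_mul]
  have h1 : ‖1 + v.coeff 0‖ = ‖(1 : k)‖ := norm_eq_of_norm_sub_lt (by
    rw [add_sub_cancel_left, norm_one]
    exact (coeff_le_gaussNorm v 0).trans_lt hv)
  rw [h1, norm_one, mul_one]

theorem HasLead.isDominantTerm (hr0 : 0 < r) {g : AnnulusAlgebra k r} {κ : k} {n : ℤ}
    (h : HasLead g κ n) : IsDominantTerm r g.coeff n := by
  intro i hi ρ h1 h2
  have hρ : 0 < ρ := lt_of_lt_of_le (by exact_mod_cast hr0) h1
  rw [h.norm_coeff]
  obtain ⟨hκ, v, hv, hg⟩ := h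
  have := HasLead.coeff_add hg (i - n)
  rw [add_sub_cancel, if_neg (sub_ne_zero.2 hi), zero_add] at this
  have h3 : ρ ^ i = ρ ^ n * ρ ^ (i - n) := by rw [← zpow_add₀ hρ.ne']; congr 1; ring
  have h4 : ‖v.coeff (i - n)‖ * ρ ^ (i - n) < 1 :=
    (mul_le_mul_of_nonneg_left (zpow_le_weight hr0 h1 h2 _) (norm_nonneg _)).trans_lt
      ((term_le_norm v _).trans_lt hv)
  rw [this, norm_mul, h3]
  calc _ = (‖κ‖ * ρ ^ n) * (‖v.coeff (i - n)‖ * ρ ^ (i - n)) := by ring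
    _ < (‖κ‖ * ρ ^ n) * 1 :=
      mul_lt_mul_of_pos_left h4 (mul_pos (norm_pos_iff.2 hκ) (zpow_pos hρ n))
    _ = _ := mul_one _

/-- It suffices to compare terms on the two boundary circles. -/
theorem hasLead_of_boundary (hr0 : 0 < r) {g : AnnulusAlgebra k r} {n : ℤ}
    (h1 : ∀ i ≠ n, ‖g.coeff i‖ < ‖g.coeff n‖)
    (h2 : ∀ i ≠ n, ‖g.coeff i‖ * (r : ℝ) ^ i < ‖g.coeff n‖ * (r : ℝ) ^ n) :
    HasLead g (g.coeff n) n := by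
  have hr : (0 : ℝ) < r := by exact_mod_cast hr0
  have h0 : g.coeff n ≠ 0 := by
    have := (norm_nonneg _).trans_lt (h1 (n + 1) (by omega))
    exact norm_pos_iff.1 this
  -- The weight is the larger of the values at the radii `1` and `r`, so only the two boundary
  -- circles enter the norm of the quotient of `g` by its leading monomial.
  refine ⟨h0, monomial r (-n) (g.coeff n)⁻¹ * g - 1, norm_lt_iff.2 fun i => ?_, ?_⟩
  · rw [coeff_sub, coeff_monomial_mul, coeff_one, sub_neg_eq_add]
    rcases eq_or_ne i 0 with rfl | hi
    · simp [h0]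
    · rw [if_neg hi, sub_zero, norm_mul, norm_inv, mul_assoc,
        inv_mul_lt_iff₀ (norm_pos_iff.2 h0), mul_one, weight,
        mul_max_of_nonneg _ _ (norm_nonneg _), mul_one]
      refine max_lt (h1 _ (by omega)) ?_
      have := h2 (i + n) (by omega)
      rw [zpow_add₀ hr.ne', ← mul_assoc] at this
      exact lt_of_mul_lt_mul_right this (zpow_pos hr n).le
  · rw [add_sub_cancel, ← mul_assoc, monomial_mul_monomial, add_neg_cancel, mul_inv_cancel₀ h0,
      ← one_eq_monomial, one_mul]

theorem IsDominantTerm.hasLead (hr0 : 0 < r) (hr1 : r ≤ 1) {g : AnnulusAlgebra k r} {n : ℤ}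
    (h : IsDominantTerm r g.coeff n) : HasLead g (g.coeff n) n :=
  hasLead_of_boundary hr0 (fun i hi => by simpa using h i hi 1 hr1 le_rfl)
    fun i hi => h i hi r le_rfl hr1

theorem IsDominantTerm.eq {K : Type*} [NormedField K] (hr1 : r ≤ 1) {c : ℤ → K} {m n : ℤ}
    (hm : IsDominantTerm r c m) (hn : IsDominantTerm r c n) : m = n := by
  by_contra h
  exact lt_asymm (hm n (Ne.symm h) 1 hr1 le_rfl) (hn m h 1 hr1 le_rfl)

theorem HasLead.self (hr0 : 0 < r) (hr1 : r ≤ 1) {g : AnnulusAlgebra k r} {κ : k} {n : ℤ}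
    (h : HasLead g κ n) : HasLead g (g.coeff n) n :=
  IsDominantTerm.hasLead hr0 hr1 (h.isDominantTerm hr0)

theorem HasLead.unique (hr0 : 0 < r) (hr1 : r ≤ 1) {g : AnnulusAlgebra k r} {κ κ' : k} {n n' : ℤ}
    (h : HasLead g κ n) (h' : HasLead g κ' n') : n = n' ∧ ‖κ‖ = ‖κ'‖ := by
  have hn := IsDominantTerm.eq hr1 (h.isDominantTerm hr0) (h'.isDominantTerm hr0)
  refine ⟨hn, ?_⟩
  rw [← h.norm_coeff, ← h'.norm_coeff, hn]

theorem HasLead.mul {g h : AnnulusAlgebra k r} {κ μ : k} {m n : ℤ} (hg : HasLead g κ m)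
    (hh : HasLead h μ n) : HasLead (g * h) (κ * μ) (m + n) := by
  obtain ⟨hκ, v, hv, rfl⟩ := hg
  obtain ⟨hμ, w, hw, rfl⟩ := hh
  refine ⟨mul_ne_zero hκ hμ, v + w + v * w, ?_, ?_⟩
  · refine norm_add_lt_of_lt (norm_add_lt_of_lt hv hw) ?_
    exact (norm_mul_le v w).trans_lt (mul_lt_one_of_nonneg_of_lt_one_left (norm_nonneg _) hv hw.le)
  · rw [← monomial_mul_monomial]; ring

theorem hasLead_monomial (n : ℤ) {κ : k} (hκ : κ ≠ 0) : HasLead (monomial r n κ) κ n :=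
  ⟨hκ, 0, by simp, by simp⟩

theorem hasLead_one_add {v : AnnulusAlgebra k r} (hv : ‖v‖ < 1) : HasLead (1 + v) 1 0 :=
  ⟨one_ne_zero, v, hv, by rw [← one_eq_monomial, one_mul]⟩

theorem HasLead.one : HasLead (1 : AnnulusAlgebra k r) 1 0 := hasLead_monomial 0 one_ne_zero

theorem HasLead.isUnit {g : AnnulusAlgebra k r} {κ : k} {n : ℤ} (h : HasLead g κ n) :
    IsUnit g := by
  obtain ⟨hκ, v, hv, rfl⟩ := h
  obtain ⟨u, hu⟩ := exists_unit_eq_one_add hv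
  rw [← hu]
  exact (monomialUnit r n κ hκ).isUnit.mul u.isUnit

section UnitLead

/-- One term of the convolution sum is strictly larger than all the others, and in the ultrametric
setting it cannot be cancelled. -/
theorem coeff_mul_ne_zero_of_dominant {a b : AnnulusAlgebra k r} {i j : ℤ}
    (h0 : 0 < ‖a.coeff i * b.coeff j‖)
    (h : ∀ l, l ≠ i → ‖a.coeff l * b.coeff (i + j - l)‖ < ‖a.coeff i * b.coeff j‖) :
    (a * b).coeff (i + j) ≠ 0 := by
  intro h1
  rw [coeff_mul, (summable_mul a b (i + j)).tsum_eq_add_tsum_ite i, add_sub_cancel_left] at h1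
  have h2 : ‖∑' l, if l = i then (0 : k) else a.coeff l * b.coeff (i + j - l)‖
      < ‖a.coeff i * b.coeff j‖ := norm_tsum_lt h0 fun l => by
    split_ifs with hl
    · simpa using h0
    · exact h l hl
  rw [eq_neg_of_add_eq_zero_right h1, norm_neg] at h2
  exact lt_irrefl _ h2

/-- The first and the last index at which a family tending to zero attains its maximum. -/
theorem exists_extremal_indices {f : ℤ → ℝ} (hf : Tendsto f cofinite (𝓝 0)) {i₀ : ℤ}
    (h0 : 0 < f i₀) : ∃ m n, f m = f n ∧ 0 < f n ∧ (∀ i, f i ≤ f n) ∧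
      (∀ i < m, f i < f n) ∧ ∀ i > n, f i < f n := by
  have hfin : {i | f i₀ ≤ f i}.Finite := by
    have := hf.eventually_lt_const h0
    rw [eventually_cofinite] at this
    exact this.subset fun i hi => not_lt.2 hi
  obtain ⟨j, hj, hmax⟩ := hfin.exists_maximalFor f _ ⟨i₀, le_refl (f i₀)⟩
  have hle (i : ℤ) : f i ≤ f j := by
    rcases le_total (f i) (f j) with h | h
    · exact h
    · exact hmax (le_trans (show f i₀ ≤ f j from hj) h) h
  have hS : {i | f i = f j}.Finite := hfin.subset fun i hi => by
    have hi' : f i = f j := hi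
    change f i₀ ≤ f i
    rw [hi']; exact hj
  obtain ⟨m, hm, hmin⟩ := hS.exists_minimalFor id _ ⟨j, rfl⟩
  obtain ⟨n, hn, hmaxn⟩ := hS.exists_maximalFor id _ ⟨j, rfl⟩
  have hm' : f m = f j := hm
  have hn' : f n = f j := hn
  refine ⟨m, n, by rw [hm', hn'], by rw [hn']; exact h0.trans_le hj, by rwa [hn'], ?_, ?_⟩
  · intro i hi
    rw [hn']
    refine lt_of_le_of_ne (hle i) fun he => ?_
    exact absurd (hmin (j := i) he hi.le) (not_le.2 hi)
  · intro i hi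
    rw [hn']
    refine lt_of_le_of_ne (hle i) fun he => ?_
    exact absurd (hmaxn (j := i) he (le_of_lt hi)) (not_le.2 hi)

/-- On each boundary circle a unit has a term that strictly dominates all others. -/
theorem exists_dominant_of_mul_eq_one (hr0 : 0 < r) {a b : AnnulusAlgebra k r} (hab : a * b = 1)
    {ρ : ℝ} (h1 : (r : ℝ) ≤ ρ) (h2 : ρ ≤ 1) :
    ∃ n, (∀ i ≠ n, ‖a.coeff i‖ * ρ ^ i < ‖a.coeff n‖ * ρ ^ n) ∧
      ∀ i ≠ -n, ‖b.coeff i‖ * ρ ^ i < ‖b.coeff (-n)‖ * ρ ^ (-n) := by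
  have hρ : 0 < ρ := lt_of_lt_of_le (by exact_mod_cast hr0) h1
  have hext (c : AnnulusAlgebra k r) {i : ℤ} (hi : 0 < ‖c.coeff i‖ * ρ ^ i) :=
    exists_extremal_indices (f := fun i => ‖c.coeff i‖ * ρ ^ i)
      (squeeze_zero (fun i => mul_nonneg (norm_nonneg _) (zpow_pos hρ i).le)
        (fun i => mul_le_mul_of_nonneg_left (zpow_le_weight hr0 h1 h2 i) (norm_nonneg _))
        c.tendsto_coeff) (i₀ := i) hi
  have hne (c : AnnulusAlgebra k r) (hc : c ≠ 0) : ∃ i, 0 < ‖c.coeff i‖ * ρ ^ i := by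
    by_contra! hcon
    refine hc (AnnulusAlgebra.ext fun i => ?_)
    by_contra hi
    exact absurd (hcon i) (not_le.2 (mul_pos (norm_pos_iff.2 hi) (zpow_pos hρ i)))
  have ha : a ≠ 0 := fun h => by simp [h, zero_ne_one] at hab
  have hb : b ≠ 0 := fun h => by simp [h, zero_ne_one] at hab
  obtain ⟨ia, hia⟩ := hne a ha
  obtain ⟨ib, hib⟩ := hne b hb
  obtain ⟨m, n, hmn, hn0, hle, hm, hn⟩ := hext a hia
  obtain ⟨m', n', hmn', hn0', hle', hm', hn'⟩ := hext b hib
  -- A strictly largest product of terms yields a nonzero coefficient of `a b = 1`, so its degree is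
  -- zero.
  have hprod (i j : ℤ) (h0 : 0 < ‖a.coeff i‖ * ρ ^ i * (‖b.coeff j‖ * ρ ^ j))
      (h : ∀ l, l ≠ i → ‖a.coeff l‖ * ρ ^ l * (‖b.coeff (i + j - l)‖ * ρ ^ (i + j - l))
        < ‖a.coeff i‖ * ρ ^ i * (‖b.coeff j‖ * ρ ^ j)) : i + j = 0 := by
    have e (l : ℤ) : ‖a.coeff l‖ * ρ ^ l * (‖b.coeff (i + j - l)‖ * ρ ^ (i + j - l))
        = ‖a.coeff l * b.coeff (i + j - l)‖ * ρ ^ (i + j) := by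
      have : ρ ^ (i + j) = ρ ^ l * ρ ^ (i + j - l) := by
        rw [← zpow_add₀ hρ.ne', add_sub_cancel]
      rw [norm_mul, this]; ring
    have e' := e i
    rw [add_sub_cancel_left] at e'
    rw [e'] at h0
    have := coeff_mul_ne_zero_of_dominant (a := a) (b := b) (i := i) (j := j)
      (pos_of_mul_pos_left h0 (zpow_pos hρ _).le) fun l hl => by
        have := h l hl
        rw [e, e'] at this
        exact lt_of_mul_lt_mul_right this (zpow_pos hρ _).le
    rw [hab, coeff_one] at this
    by_contra hij
    exact this (if_neg hij)
  have nn (c : AnnulusAlgebra k r) (i : ℤ) : 0 ≤ ‖c.coeff i‖ * ρ ^ i :=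
    mul_nonneg (norm_nonneg _) (zpow_pos hρ i).le
  -- Last maximal indices pair to a strict maximum: if `l > n` the term of `a` drops, and if `l < n`
  -- the complementary index exceeds `n'` and the term of `b` drops. First maximal indices behave in
  -- the same way.
  have s1 : n + n' = 0 := hprod n n' (mul_pos hn0 hn0') fun l hl => by
    rcases lt_or_gt_of_ne hl with h | h
    · exact mul_lt_mul' (hle l) (hn' _ (by omega)) (nn _ _) hn0
    · exact mul_lt_mul_of_lt_of_le_of_nonneg_of_pos (hn l h) (hle' _) (nn _ _) hn0'
  have s2 : m + m' = 0 := hprod m m' (by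
      rw [show ‖a.coeff m‖ * ρ ^ m = _ from hmn, show ‖b.coeff m'‖ * ρ ^ m' = _ from hmn']
      exact mul_pos hn0 hn0') fun l hl => by
    rw [show ‖a.coeff m‖ * ρ ^ m = _ from hmn, show ‖b.coeff m'‖ * ρ ^ m' = _ from hmn']
    rcases lt_or_gt_of_ne hl with h | h
    · exact mul_lt_mul_of_lt_of_le_of_nonneg_of_pos (hm l h) (hle' _) (nn _ _) hn0'
    · exact mul_lt_mul' (hle l) (hm' _ (by omega)) (nn _ _) hn0
  have l1 : m ≤ n := by
    by_contra h
    exact absurd hmn (hn m (by omega)).ne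
  have l2 : m' ≤ n' := by
    by_contra h
    exact absurd hmn' (hn' m' (by omega)).ne
  -- Both sums vanish while `m ≤ n` and `m' ≤ n'`, so first and last maximal indices coincide and
  -- each maximum is strict.
  obtain rfl : m = n := by omega
  obtain rfl : m' = n' := by omega
  obtain rfl : m' = -m := by omega
  refine ⟨m, fun i hi => ?_, fun i hi => ?_⟩
  · rcases lt_or_gt_of_ne hi with h | h
    · exact hm i h
    · exact hn i h
  · rcases lt_or_gt_of_ne hi with h | h
    · exact hm' i h
    · exact hn' i h

/-- Passing from radius `1` to radius `r` favours lower exponents, so the dominant degree can only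
drop. The same holds for the inverse, whose dominant degrees are the opposite ones; hence the two
boundary circles have the same dominant degree. -/
theorem exists_hasLead_of_isUnit (hr0 : 0 < r) (hr1 : r ≤ 1) {a : AnnulusAlgebra k r}
    (ha : IsUnit a) : ∃ κ n, HasLead a κ n := by
  have hr : (0 : ℝ) < r := by exact_mod_cast hr0
  obtain ⟨b, hab⟩ := ha.exists_right_inv
  obtain ⟨m, hm, hm'⟩ := exists_dominant_of_mul_eq_one hr0 hab (ρ := 1) hr1 le_rfl
  obtain ⟨n, hn, hn'⟩ := exists_dominant_of_mul_eq_one hr0 hab (ρ := r) le_rfl hr1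
  simp only [one_zpow, mul_one] at hm hm'
  have key (c : AnnulusAlgebra k r) (i j : ℤ) (hi : ∀ l ≠ i, ‖c.coeff l‖ < ‖c.coeff i‖)
      (hj : ∀ l ≠ j, ‖c.coeff l‖ * (r : ℝ) ^ l < ‖c.coeff j‖ * (r : ℝ) ^ j) : j ≤ i := by
    by_contra! hij
    have h1 := hi j hij.ne'
    have h2 := hj i hij.ne
    have h3 : (r : ℝ) ^ j ≤ (r : ℝ) ^ i := zpow_le_zpow_right_of_le_one₀ hr hr1 hij.le
    have h4 := mul_le_mul h1.le h3 (zpow_pos hr j).le (norm_nonneg _)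
    exact absurd h2 (not_lt.2 h4)
  have h1 := key a m n hm hn
  have h2 := key b (-m) (-n) hm' hn'
  obtain rfl : m = n := by omega
  exact ⟨_, _, hasLead_of_boundary hr0 hm hn⟩

end UnitLead

theorem HasLead.of_mul_eq_one {a b : AnnulusAlgebra k r} {κ : k}
    {n : ℤ} (ha : HasLead a κ n) (hab : a * b = 1) : HasLead b κ⁻¹ (-n) := by
  obtain ⟨hκ, v, hv, rfl⟩ := ha
  obtain ⟨u, hu⟩ := exists_unit_eq_one_add hv
  refine ⟨inv_ne_zero hκ, ((u⁻¹ : (AnnulusAlgebra k r)ˣ) : AnnulusAlgebra k r) - 1, ?_, ?_⟩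
  · exact (norm_inv_sub_one_le u hv (by rw [hu, add_sub_cancel_left])).trans_lt hv
  · rw [add_sub_cancel]
    have h1 : monomial r n κ * u * (monomial r (-n) κ⁻¹ * (u⁻¹ : (AnnulusAlgebra k r)ˣ)) = 1 := by
      calc _ = (monomial r n κ * monomial r (-n) κ⁻¹) * (u * (u⁻¹ : (AnnulusAlgebra k r)ˣ)) := by
            ring
        _ = 1 := by
          rw [Units.mul_inv, monomial_mul_monomial, add_neg_cancel, mul_inv_cancel₀ hκ, mul_one]
          rfl
    rw [hu] at h1
    exact (left_inv_eq_right_inv ((mul_comm _ _).trans hab) h1)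

theorem HasLead.zpow {u : (AnnulusAlgebra k r)ˣ} {κ : k} {n : ℤ}
    (h : HasLead (u : AnnulusAlgebra k r) κ n) (i : ℤ) :
    HasLead ((u ^ i : (AnnulusAlgebra k r)ˣ) : AnnulusAlgebra k r) (κ ^ i) (i * n) := by
  have hnat (j : ℕ) : HasLead ((u ^ j : (AnnulusAlgebra k r)ˣ) : AnnulusAlgebra k r) (κ ^ j)
      (j * n) := by
    induction j with
    | zero => simpa using HasLead.one
    | succ j ih =>
      have := ih.mul h
      rw [pow_succ, Units.val_mul, pow_succ]
      convert this using 1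
      push_cast; ring
  obtain ⟨j, rfl | rfl⟩ := i.eq_nat_or_neg
  · simpa using hnat j
  · have := (hnat j).of_mul_eq_one (Units.mul_inv (u ^ j))
    rw [zpow_neg, zpow_natCast, zpow_neg, zpow_natCast, neg_mul]
    exact this

end AnnulusAlgebra
/-- The moduli of closed annuli over `k` (that admit monic coordinates). -/
def IsModulus (k : Type*) [NormedField k] (r : ℝ≥0) : Prop :=
  (∃ a : k, a ≠ 0 ∧ ‖a‖₊ = r) ∧ r ≤ 1

theorem IsModulus.pos {k : Type*} [NormedField k] {r : ℝ≥0} (h : IsModulus k r) : 0 < r := by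
  obtain ⟨⟨a, ha, rfl⟩, -⟩ := h
  exact nnnorm_pos.2 ha

theorem IsModulus.le_one {k : Type*} [NormedField k] {r : ℝ≥0} (h : IsModulus k r) : r ≤ 1 := h.2

/-! ### Euler derivation, logarithmic derivatives and homomorphisms of annulus algebras. -/

namespace AnnulusAlgebra

variable {k : Type*} [NormedField k] [IsUltrametricDist k] [CompleteSpace k] {r s : ℝ≥0}

theorem HasLead.norm_le {g : AnnulusAlgebra k r} {κ : k} {n : ℤ} (h : HasLead g κ n) :
    ‖g‖ ≤ ‖κ‖ * weight r n := by
  obtain ⟨-, v, hv, rfl⟩ := h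
  rw [← norm_monomial (r := r)]
  refine norm_mul_le_of_le_one_right le_rfl ?_
  exact norm_add_le_of_le' norm_one.le hv.le

theorem HasLead.le_norm {g : AnnulusAlgebra k r} {κ : k} {n : ℤ} (h : HasLead g κ n) :
    ‖κ‖ * weight r n ≤ ‖g‖ := by
  rw [← h.norm_coeff]
  exact term_le_norm g n

theorem monomial_zero_mul (c : k) (a : AnnulusAlgebra k r) : monomial r 0 c * a = c • a := by
  rw [← mul_one c, ← smul_monomial, ← one_eq_monomial, smul_mul_assoc, one_mul, mul_one]

/-! The Euler derivation `T d/dT`. -/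

theorem norm_intCast_mul_le (n : ℤ) (c : k) : ‖(n : k) * c‖ ≤ ‖c‖ :=
  norm_mul_le_of_le_one_left (norm_intCast_le_one n) le_rfl

theorem tendsto_eulerCoeff (a : AnnulusAlgebra k r) :
    Tendsto (fun i : ℤ => ‖(i : k) * a.coeff i‖ * weight r i) cofinite (𝓝 0) :=
  squeeze_zero (fun i => mul_nonneg (norm_nonneg _) (weight_pos r i).le)
    (fun i => mul_le_mul_of_nonneg_right (norm_intCast_mul_le i _) (weight_pos r i).le)
    a.tendsto_coeff

/-- The underlying function of the Euler derivation. -/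
def eulerFun (a : AnnulusAlgebra k r) : AnnulusAlgebra k r :=
  ⟨fun i => (i : k) * a.coeff i, tendsto_eulerCoeff a⟩

theorem coeff_eulerFun (a : AnnulusAlgebra k r) (i : ℤ) :
    (eulerFun a).coeff i = (i : k) * a.coeff i := rfl

theorem norm_eulerFun_le (a : AnnulusAlgebra k r) : ‖eulerFun a‖ ≤ ‖a‖ :=
  norm_le_iff.2 fun i => (mul_le_mul_of_nonneg_right (norm_intCast_mul_le i _)
    (weight_pos r i).le).trans (term_le_norm a i)

theorem eulerFun_mul (a b : AnnulusAlgebra k r) :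
    eulerFun (a * b) = a * eulerFun b + b * eulerFun a := by
  ext n
  rw [coeff_eulerFun, AnnulusAlgebra.coeff_add, mul_comm b, coeff_mul, coeff_mul, coeff_mul,
    ← tsum_mul_left, ← (summable_mul a (eulerFun b) n).tsum_add (summable_mul (eulerFun a) b n)]
  refine tsum_congr fun i => ?_
  rw [coeff_eulerFun, coeff_eulerFun]
  push_cast
  ring

/-- The Euler derivation `T d/dT`. -/
def euler : AnnulusAlgebra k r →L[k] AnnulusAlgebra k r :=
  let f : AnnulusAlgebra k r →ₗ[k] AnnulusAlgebra k r :=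
    { toFun := eulerFun
      map_add' := fun a b => by
        ext i
        simp only [coeff_eulerFun, AnnulusAlgebra.coeff_add, mul_add]
      map_smul' := fun c a => by
        ext i
        simp only [coeff_eulerFun, coeff_smul, RingHom.id_apply]
        ring }
  { f with cont := continuous_of_norm_map_le f.toAddMonoidHom (C := 1) fun a =>
      (norm_eulerFun_le a).trans_eq (one_mul _).symm }

theorem coeff_euler (a : AnnulusAlgebra k r) (i : ℤ) :
    (euler a).coeff i = (i : k) * a.coeff i := rfl

theorem norm_euler_le (a : AnnulusAlgebra k r) : ‖euler a‖ ≤ ‖a‖ := norm_eulerFun_le a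

theorem euler_mul (a b : AnnulusAlgebra k r) : euler (a * b) = a * euler b + b * euler a :=
  eulerFun_mul a b

theorem euler_monomial (n : ℤ) (c : k) : euler (monomial r n c) = monomial r n (n * c) := by
  ext i
  rw [coeff_euler, coeff_monomial, coeff_monomial]
  split_ifs with h
  · rw [h]
  · rw [mul_zero]

theorem euler_one : euler (1 : AnnulusAlgebra k r) = 0 := by
  rw [one_eq_monomial, euler_monomial, Int.cast_zero, zero_mul, monomial_zero_right]

/-- The logarithmic derivative on units. -/
def dlog : Additive (AnnulusAlgebra k r)ˣ →+ AnnulusAlgebra k r :=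
  AddMonoidHom.mk' (fun u => ((u.toMul⁻¹ : (AnnulusAlgebra k r)ˣ) : AnnulusAlgebra k r)
      * euler (u.toMul : AnnulusAlgebra k r)) fun u w => by
    rw [toMul_add, Units.val_mul, euler_mul, mul_inv_rev, Units.val_mul]
    have h1 := Units.inv_mul u.toMul
    have h2 := Units.inv_mul w.toMul
    linear_combination (((w.toMul⁻¹ : (AnnulusAlgebra k r)ˣ) : AnnulusAlgebra k r)
      * euler (w.toMul : AnnulusAlgebra k r)) * h1
      + (((u.toMul⁻¹ : (AnnulusAlgebra k r)ˣ) : AnnulusAlgebra k r)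
      * euler (u.toMul : AnnulusAlgebra k r)) * h2

theorem euler_unit (u : (AnnulusAlgebra k r)ˣ) :
    euler (u : AnnulusAlgebra k r) = u * dlog (Additive.ofMul u) := by
  change _ = (u : AnnulusAlgebra k r) * (((u⁻¹ : (AnnulusAlgebra k r)ˣ) : AnnulusAlgebra k r) * _)
  rw [Units.mul_inv_cancel_left]
  rfl

theorem dlog_mul (u w : (AnnulusAlgebra k r)ˣ) :
    dlog (Additive.ofMul (u * w)) = dlog (Additive.ofMul u) + dlog (Additive.ofMul w) := by
  rw [ofMul_mul, map_add]

theorem dlog_zpow (u : (AnnulusAlgebra k r)ˣ) (i : ℤ) :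
    dlog (Additive.ofMul (u ^ i)) = i * dlog (Additive.ofMul u) := by
  rw [ofMul_zpow, map_zsmul, zsmul_eq_mul]

theorem euler_zpow (u : (AnnulusAlgebra k r)ˣ) (i : ℤ) :
    euler ((u ^ i : (AnnulusAlgebra k r)ˣ) : AnnulusAlgebra k r)
      = i * ((u ^ (i - 1) : (AnnulusAlgebra k r)ˣ) * euler (u : AnnulusAlgebra k r)) := by
  rw [euler_unit, euler_unit, dlog_zpow]
  have : (u ^ i : (AnnulusAlgebra k r)ˣ) = u ^ (i - 1) * u := by
    rw [← zpow_add_one, sub_add_cancel]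
  rw [this, Units.val_mul]
  ring

/-! Continuous homomorphisms between annulus algebras. -/

/-- The coordinate as a unit. -/
def coordUnit (k : Type*) [NormedField k] [IsUltrametricDist k] [CompleteSpace k] (r : ℝ≥0) :
    (AnnulusAlgebra k r)ˣ := monomialUnit r 1 1 one_ne_zero

theorem coe_coordUnit_zpow (i : ℤ) :
    ((coordUnit k r ^ i : (AnnulusAlgebra k r)ˣ) : AnnulusAlgebra k r) = monomial r i 1 := by
  rw [coordUnit, coe_monomialUnit_zpow, mul_one, one_zpow]

theorem map_coe_zpow {R S H : Type*} [Monoid R] [Monoid S] [FunLike H R S] [MonoidHomClass H R S]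
    (F : H) (u : Rˣ) (w : Sˣ) (h : F u = w) (i : ℤ) :
    F ((u ^ i : Rˣ) : R) = ((w ^ i : Sˣ) : S) := by
  have : Units.map (F : R →* S) u = w := Units.ext h
  rw [← this, ← map_zpow]
  rfl

/-- The image of the coordinate under a homomorphism, as a unit. -/
def coordImage (F : AnnulusAlgebra k s →A[k] AnnulusAlgebra k r) : (AnnulusAlgebra k r)ˣ :=
  Units.map (F : AnnulusAlgebra k s →* AnnulusAlgebra k r) (coordUnit k s)

theorem coe_coordImage (F : AnnulusAlgebra k s →A[k] AnnulusAlgebra k r) :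
    (coordImage F : AnnulusAlgebra k r) = F (coord k s) := rfl

theorem map_monomial (F : AnnulusAlgebra k s →A[k] AnnulusAlgebra k r) (i : ℤ) (c : k) :
    F (monomial s i c)
      = c • ((coordImage F ^ i : (AnnulusAlgebra k r)ˣ) : AnnulusAlgebra k r) := by
  rw [← map_coe_zpow F (coordUnit k s) (coordImage F) rfl, coe_coordUnit_zpow, ← map_smul,
    smul_monomial, mul_one]

theorem continuousAlgHom_ext {F G : AnnulusAlgebra k s →A[k] AnnulusAlgebra k r}
    (h : F (coord k s) = G (coord k s)) : F = G := by
  have h1 : coordImage F = coordImage G := Units.ext h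
  have h2 : F.toContinuousLinearMap = G.toContinuousLinearMap :=
    continuousLinearMap_ext fun i => by
      change F _ = G _
      rw [map_monomial, map_monomial, h1]
  exact ContinuousAlgHom.ext fun a => DFunLike.congr_fun h2 a

/-- Substitution of a unit for the coordinate. -/
def subst (u : (AnnulusAlgebra k r)ˣ)
    (hu : ∀ i, ‖((u ^ i : (AnnulusAlgebra k r)ˣ) : AnnulusAlgebra k r)‖ ≤ 1 * weight s i) :
    AnnulusAlgebra k s →A[k] AnnulusAlgebra k r :=
  { toAlgHom := AlgHom.ofLinearMap (ofMonomials _ hu : AnnulusAlgebra k s →ₗ[k] AnnulusAlgebra k r)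
      (by
        change ofMonomials _ hu 1 = 1
        rw [one_eq_monomial, ofMonomials_monomial, one_smul, zpow_zero, Units.val_one])
      (fun a b => by
        change ofMonomials _ hu (a * b) = ofMonomials _ hu a * ofMonomials _ hu b
        let L := ofMonomials _ hu
        -- Multiplicativity is linear in each factor. It is checked on pairs of monomials (`h1`),
        -- extended to all series in one factor (`h2`) and, by commutativity, in the other (`h3`).
        let l1 (b : AnnulusAlgebra k s) : AnnulusAlgebra k s →L[k] AnnulusAlgebra k r :=
          L.comp ⟨LinearMap.mulRight k b, continuous_id.mul continuous_const⟩
        let l2 (b : AnnulusAlgebra k s) : AnnulusAlgebra k s →L[k] AnnulusAlgebra k r :=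
          ContinuousLinearMap.comp
            ⟨LinearMap.mulRight k (L b), continuous_id.mul continuous_const⟩ L
        have h1 (i j : ℤ) : L (monomial s i 1 * monomial s j 1)
            = L (monomial s i 1) * L (monomial s j 1) := by
          simp only [L]
          rw [monomial_mul_monomial, ofMonomials_monomial, ofMonomials_monomial,
            ofMonomials_monomial, zpow_add, Units.val_mul]
          simp only [mul_one, one_smul]
        have h2 (j : ℤ) : l1 (monomial s j 1) = l2 (monomial s j 1) :=
          continuousLinearMap_ext fun i => h1 i j
        have h3 (b : AnnulusAlgebra k s) : l1 b = l2 b := continuousLinearMap_ext fun i => by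
          have h4 : l1 (monomial s i 1) = l2 (monomial s i 1) := h2 i
          have h5 := DFunLike.congr_fun h4 b
          change L (b * monomial s i 1) = L b * L (monomial s i 1) at h5
          change L (monomial s i 1 * b) = L (monomial s i 1) * L b
          rw [mul_comm, h5, mul_comm]
        exact DFunLike.congr_fun (h3 b) a)
    cont := (ofMonomials _ hu).cont }

theorem subst_coord (u : (AnnulusAlgebra k r)ˣ)
    (hu : ∀ i, ‖((u ^ i : (AnnulusAlgebra k r)ˣ) : AnnulusAlgebra k r)‖ ≤ 1 * weight s i) :
    subst u hu (coord k s) = u := by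
  change ofMonomials _ hu (monomial s 1 1) = u
  rw [ofMonomials_monomial, one_smul, zpow_one]

/-- Chain rule: both sides are continuous and linear in `a`, and on `Tⁱ` the identity says that the
logarithmic derivative of an `i`-th power is `i` times that of the base. -/
theorem euler_map (F : AnnulusAlgebra k s →A[k] AnnulusAlgebra k r) (a : AnnulusAlgebra k s) :
    euler (F a) = F (euler a) * dlog (Additive.ofMul (coordImage F)) := by
  let l1 : AnnulusAlgebra k s →L[k] AnnulusAlgebra k r := euler.comp F.toContinuousLinearMap
  let l2 : AnnulusAlgebra k s →L[k] AnnulusAlgebra k r := ContinuousLinearMap.comp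
    ⟨LinearMap.mulRight k (dlog (Additive.ofMul (coordImage F))),
      continuous_id.mul continuous_const⟩
    (F.toContinuousLinearMap.comp euler)
  have : l1 = l2 := continuousLinearMap_ext fun i => by
    change euler (F _) = F (euler _) * _
    rw [map_monomial, one_smul, euler_unit, dlog_zpow, euler_monomial, map_monomial, mul_one,
      Algebra.smul_def, map_intCast]
    ring
  exact DFunLike.congr_fun this a

/-- Continuity bounds the dominant term of the image of a small element. -/
theorem HasLead.lt_one_of_map (hr : IsModulus k r)
    (F : AnnulusAlgebra k s →A[k] AnnulusAlgebra k r) {x : AnnulusAlgebra k s} (hx : ‖x‖ < 1)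
    {μ : k} {e : ℤ} (h : HasLead (F x) μ e) : ‖μ‖ < 1 ∧ ‖μ‖ * (r : ℝ) ^ e < 1 := by
  -- Continuity gives no bound on the norm of `F x`, but it preserves topological nilpotence, so
  -- some power of `F x` has norm less than `1`.
  have h1 : Tendsto (fun n : ℕ => ‖F x ^ n‖) atTop (𝓝 0) := by
    have h2 := tendsto_pow_atTop_nhds_zero_of_norm_lt_one hx
    have h3 := (F.cont.tendsto 0).comp h2
    have h4 : Tendsto (fun n : ℕ => F (x ^ n)) atTop (𝓝 (F 0)) := h3
    rw [map_zero] at h4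
    simpa using h4.norm
  obtain ⟨n, hn⟩ := (h1.eventually_lt_const one_pos).exists
  have h5 : HasLead (F x ^ n) (μ ^ n) (n * e) := by
    obtain ⟨u, hu⟩ := h.isUnit
    rw [← hu] at h ⊢
    simpa using h.zpow (n : ℤ)
  have h6 := h5.le_norm.trans_lt hn
  have hr0 : (0 : ℝ) < r := by exact_mod_cast hr.pos
  have h7 (y : ℝ) (hy : y ^ n < 1) : y < 1 := by
    by_contra! hcon
    exact absurd hy (not_lt.2 (one_le_pow₀ hcon))
  rw [norm_pow, mul_comm (n : ℤ), weight, zpow_mul, zpow_natCast] at h6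
  constructor
  · refine h7 _ (lt_of_le_of_lt ?_ h6)
    exact le_mul_of_one_le_right (pow_nonneg (norm_nonneg _) n) (le_max_left _ _)
  · refine h7 _ (lt_of_le_of_lt ?_ h6)
    rw [mul_pow]
    exact mul_le_mul_of_nonneg_left (le_max_right _ _) (pow_nonneg (norm_nonneg _) n)

/-- A morphism between annuli maps boundary radii to radii of the target. -/
theorem HasLead.radii (hr : IsModulus k r) (hs : IsModulus k s)
    {F : AnnulusAlgebra k s →A[k] AnnulusAlgebra k r} {κ : k} {d : ℤ}
    (h : HasLead (F (coord k s)) κ d) :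
    (s ≤ ‖κ‖ ∧ ‖κ‖ ≤ 1) ∧ (s ≤ ‖κ‖ * (r : ℝ) ^ d ∧ ‖κ‖ * (r : ℝ) ^ d ≤ 1) := by
  have hκ : 0 < ‖κ‖ := norm_pos_iff.2 h.1
  obtain ⟨a, ha, har⟩ := hr.1
  have har' : ‖a‖ = r := by rw [← har]; rfl
  have hr0 : (0 : ℝ) < r := by exact_mod_cast hr.pos
  have hs0 : (0 : ℝ) < s := by exact_mod_cast hs.pos
  -- If a boundary circle were mapped to radius `|c| > 1`, then `c⁻¹ T` would have norm less than
  -- `1` while the leading term of its image has absolute value `1` on that circle. For `lower` the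
  -- same is applied to `c T⁻¹`.
  have upper (c : k) (hc : c ≠ 0) (h1 : ‖c‖ = ‖κ‖ ∨ ‖c‖ = ‖κ‖ * (r : ℝ) ^ d) : ‖c‖ ≤ 1 := by
    by_contra! hlt
    have hx : ‖c⁻¹ • coord k s‖ < 1 := by
      rw [norm_smul_eq, coord, norm_monomial, norm_one, one_mul,
        weight_of_nonneg hs.le_one one_pos.le, mul_one, norm_inv]
      exact inv_lt_one_of_one_lt₀ hlt
    have hl : HasLead (F (c⁻¹ • coord k s)) (c⁻¹ * κ) (0 + d) := by
      have := (hasLead_monomial (r := r) 0 (inv_ne_zero hc)).mul h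
      rw [map_smul]
      convert this using 1
      rw [monomial_zero_mul]
    have := hl.lt_one_of_map hr F hx
    rw [zero_add, norm_mul, norm_inv, mul_assoc] at this
    rcases h1 with h1 | h1
    · rw [h1, inv_mul_cancel₀ hκ.ne'] at this
      exact lt_irrefl _ this.1
    · rw [h1, inv_mul_cancel₀ (mul_pos hκ (zpow_pos hr0 d)).ne'] at this
      exact lt_irrefl _ this.2
  have lower (c : k) (hc : c ≠ 0) (h1 : ‖c‖ = ‖κ‖ ∨ ‖c‖ = ‖κ‖ * (r : ℝ) ^ d) : s ≤ ‖c‖ := by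
    by_contra! hlt
    have hx : ‖monomial s (-1) c‖ < 1 := by
      rw [norm_monomial, weight_of_nonpos hs.pos hs.le_one (by norm_num), zpow_neg_one,
        ← div_eq_mul_inv, div_lt_one hs0]
      exact hlt
    have hu : HasLead ((coordImage F : (AnnulusAlgebra k r)ˣ) : AnnulusAlgebra k r) κ d := h
    have hl : HasLead (F (monomial s (-1) c)) (c * κ⁻¹) (0 + -d) := by
      have := (hasLead_monomial (r := r) 0 hc).mul (hu.of_mul_eq_one (Units.mul_inv _))
      rw [map_monomial, zpow_neg_one]
      convert this using 1
      rw [monomial_zero_mul]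
    have := hl.lt_one_of_map hr F hx
    rw [zero_add, norm_mul, norm_inv, mul_assoc, zpow_neg, ← mul_inv] at this
    rcases h1 with h1 | h1
    · rw [h1, mul_inv_cancel₀ hκ.ne'] at this
      exact lt_irrefl _ this.1
    · rw [h1, mul_inv_cancel₀ (mul_pos hκ (zpow_pos hr0 d)).ne'] at this
      exact lt_irrefl _ this.2
  -- The image radius of the inner boundary is realized by a scalar because `r` lies in the value
  -- group.
  have e : ‖κ * a ^ d‖ = ‖κ‖ * (r : ℝ) ^ d := by rw [norm_mul, norm_zpow, har']
  have h0 : κ * a ^ d ≠ 0 := mul_ne_zero h.1 (zpow_ne_zero d ha)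
  refine ⟨⟨lower κ h.1 (.inl rfl), upper κ h.1 (.inl rfl)⟩, ?_, ?_⟩
  · rw [← e]; exact lower _ h0 (.inr e)
  · rw [← e]; exact upper _ h0 (.inr e)

theorem norm_zpow_le_of_radii (hs0 : 0 < s) {u : (AnnulusAlgebra k r)ˣ} {κ : k} {d : ℤ}
    (h : HasLead (u : AnnulusAlgebra k r) κ d) (h1 : s ≤ ‖κ‖ ∧ ‖κ‖ ≤ 1)
    (h2 : s ≤ ‖κ‖ * (r : ℝ) ^ d ∧ ‖κ‖ * (r : ℝ) ^ d ≤ 1) (i : ℤ) :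
    ‖((u ^ i : (AnnulusAlgebra k r)ˣ) : AnnulusAlgebra k r)‖ ≤ 1 * weight s i := by
  refine (h.zpow i).norm_le.trans ?_
  rw [one_mul, weight, mul_max_of_nonneg _ _ (norm_nonneg _), mul_one, norm_zpow, mul_comm i,
    zpow_mul, ← mul_zpow]
  exact max_le (zpow_le_weight hs0 h1.1 h1.2 i) (zpow_le_weight hs0 h2.1 h2.2 i)

/-- Continuous homomorphisms between annulus algebras do not increase the norm. -/
theorem norm_map_le (hr : IsModulus k r) (hs : IsModulus k s)
    (F : AnnulusAlgebra k s →A[k] AnnulusAlgebra k r) (a : AnnulusAlgebra k s) : ‖F a‖ ≤ ‖a‖ := by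
  obtain ⟨κ, d, h⟩ := exists_hasLead_of_isUnit hr.pos hr.le_one (coordImage F).isUnit
  have hrad := HasLead.radii hr hs (F := F) h
  have := norm_map_le_of_monomial F.toContinuousLinearMap (C := 1)
    (fun i => by
      change ‖F _‖ ≤ _
      rw [map_monomial, one_smul]
      exact norm_zpow_le_of_radii hs.pos h hrad.1 hrad.2 i) a
  rwa [one_mul] at this

/-- Since `F` does not increase norms, it sends `1 + v` to a series of the same kind, so only the
leading monomial has to be followed. -/
theorem HasLead.map (hr : IsModulus k r) (hs : IsModulus k s)
    {F : AnnulusAlgebra k s →A[k] AnnulusAlgebra k r} {κ : k} {d : ℤ}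
    (h : HasLead (F (coord k s)) κ d) {g : AnnulusAlgebra k s} {μ : k} {n : ℤ}
    (hg : HasLead g μ n) : HasLead (F g) (μ * κ ^ n) (n * d) := by
  obtain ⟨hμ, v, hv, rfl⟩ := hg
  rw [map_mul, map_monomial, map_add, map_one]
  have hu : HasLead ((coordImage F : (AnnulusAlgebra k r)ˣ) : AnnulusAlgebra k r) κ d := h
  have := ((hasLead_monomial (r := r) 0 hμ).mul (hu.zpow n)).mul
    (hasLead_one_add ((norm_map_le hr hs F v).trans_lt hv))
  rw [zero_add, add_zero, mul_one] at this
  convert this using 1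
  rw [monomial_zero_mul]

theorem dlog_of_hasLead_zero {u : (AnnulusAlgebra k r)ˣ} {v : AnnulusAlgebra k r} (hv : ‖v‖ < 1)
    (hu : (u : AnnulusAlgebra k r) = 1 + v) : ‖dlog (Additive.ofMul u)‖ < 1 := by
  have h2 : dlog (Additive.ofMul u)
      = ((u⁻¹ : (AnnulusAlgebra k r)ˣ) : AnnulusAlgebra k r) * euler (u : AnnulusAlgebra k r) := by
    rw [euler_unit, Units.inv_mul_cancel_left]
  rw [h2, hu, map_add, euler_one, zero_add]
  have h3 := norm_inv_sub_one_le u hv (by rw [hu, add_sub_cancel_left])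
  exact (norm_mul_le_of_le_one_left (norm_le_one_of_near_one hv.le h3)
    (norm_euler_le v)).trans_lt hv

/-- The logarithmic derivative of a unit with dominant term of degree `n` is close to `n`. -/
theorem HasLead.norm_dlog_sub {u : (AnnulusAlgebra k r)ˣ} {κ : k} {n : ℤ}
    (h : HasLead (u : AnnulusAlgebra k r) κ n) : ‖dlog (Additive.ofMul u) - n‖ < 1 := by
  obtain ⟨hκ, v, hv, hg⟩ := h
  obtain ⟨w, hw⟩ := exists_unit_eq_one_add hv
  have hu : u = monomialUnit r n κ hκ * w := Units.ext (by rw [hg, Units.val_mul, hw]; rfl)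
  have h1 : dlog (Additive.ofMul (monomialUnit r n κ hκ)) = n := by
    have := euler_unit (monomialUnit r n κ hκ)
    have h2 : euler (monomial r n κ) = monomial r n κ * (n : AnnulusAlgebra k r) := by
      rw [euler_monomial, ← smul_monomial, Algebra.smul_def, map_intCast, mul_comm]
    exact (Units.mul_right_inj _).1 (this.symm.trans h2)
  rw [hu, dlog_mul, h1, add_sub_cancel_left]
  exact dlog_of_hasLead_zero hv hw

end AnnulusAlgebra
-- Changes of the coordinate.
namespace AnnulusAlgebra

variable {k : Type*} [NormedField k] [IsUltrametricDist k] [CompleteSpace k] {r s : ℝ≥0}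

/-! Automorphisms of annuli. -/

/-- Mutually inverse substitutions. -/
def equivOfInverse (F : AnnulusAlgebra k s →A[k] AnnulusAlgebra k r)
    (G : AnnulusAlgebra k r →A[k] AnnulusAlgebra k s) (h1 : G (F (coord k s)) = coord k s)
    (h2 : F (G (coord k r)) = coord k r) : AnnulusAlgebra k s ≃A[k] AnnulusAlgebra k r :=
  have e1 : G.comp F = ContinuousAlgHom.id k _ := continuousAlgHom_ext h1
  have e2 : F.comp G = ContinuousAlgHom.id k _ := continuousAlgHom_ext h2
  { AlgEquiv.ofAlgHom (F : AnnulusAlgebra k s →ₐ[k] AnnulusAlgebra k r) G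
      (AlgHom.ext fun a => DFunLike.congr_fun e2 a)
      (AlgHom.ext fun a => DFunLike.congr_fun e1 a) with
    continuous_toFun := F.cont
    continuous_invFun := G.cont }

/-- Multiplication of the coordinate by a constant of absolute value `1`. -/
theorem exists_scaling (r : ℝ≥0) {κ : k} (hκ : ‖κ‖ = 1) :
    ∃ σ : AnnulusAlgebra k r ≃A[k] AnnulusAlgebra k r, σ (coord k r) = κ • coord k r ∧
      σ.symm (coord k r) = κ⁻¹ • coord k r := by
  have hκ0 : κ ≠ 0 := norm_pos_iff.1 (by rw [hκ]; exact one_pos)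
  have hb (c : k) (hc : c ≠ 0) (h1 : ‖c‖ = 1) (i : ℤ) :
      ‖((monomialUnit r 1 c hc ^ i : (AnnulusAlgebra k r)ˣ) : AnnulusAlgebra k r)‖
        ≤ 1 * weight r i := by
    rw [coe_monomialUnit_zpow, norm_monomial, norm_zpow, h1, one_zpow, mul_one]
  have e (c : k) (hc : c ≠ 0) (h1 : ‖c‖ = 1) :
      subst _ (hb c hc h1) (coord k r) = c • coord k r := by
    rw [subst_coord, coord, smul_monomial, mul_one]; rfl
  have hi : ‖κ⁻¹‖ = 1 := by rw [norm_inv, hκ, inv_one]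
  refine ⟨equivOfInverse (subst _ (hb κ hκ0 hκ)) (subst _ (hb κ⁻¹ (inv_ne_zero hκ0) hi)) ?_ ?_,
    e κ hκ0 hκ, e κ⁻¹ (inv_ne_zero hκ0) hi⟩
  · rw [e κ hκ0 hκ, map_smul, e κ⁻¹ (inv_ne_zero hκ0) hi, smul_smul, mul_inv_cancel₀ hκ0, one_smul]
  · rw [e κ⁻¹ (inv_ne_zero hκ0) hi, map_smul, e κ hκ0 hκ, smul_smul, inv_mul_cancel₀ hκ0, one_smul]

/-- The inversion of an annulus. -/
theorem exists_inversion (hr : IsModulus k r) {a : k} (har : ‖a‖ = r) :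
    ∃ σ : AnnulusAlgebra k r ≃A[k] AnnulusAlgebra k r, σ (coord k r) = monomial r (-1) a ∧
      σ.symm (coord k r) = monomial r (-1) a := by
  have hr0 : (0 : ℝ) < r := by exact_mod_cast hr.pos
  have ha : a ≠ 0 := norm_pos_iff.1 (by rwa [har])
  have hb (i : ℤ) : ‖((monomialUnit r (-1) a ha ^ i : (AnnulusAlgebra k r)ˣ) :
      AnnulusAlgebra k r)‖ ≤ 1 * weight r i := by
    rw [coe_monomialUnit_zpow, norm_monomial, norm_zpow, har, one_mul, mul_neg_one, weight, weight,
      mul_max_of_nonneg _ _ (zpow_pos hr0 i).le, mul_one, ← zpow_add₀ hr0.ne', add_neg_cancel,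
      zpow_zero, max_comm]
  have e : subst _ hb (coord k r) = monomial r (-1) a := subst_coord _ hb
  have e2 : subst _ hb (monomial r (-1) a) = coord k r := by
    have h1 : coordImage (subst _ hb) = monomialUnit r (-1) a ha := Units.ext e
    rw [map_monomial, h1, coe_monomialUnit_zpow, smul_monomial, zpow_neg_one, mul_inv_cancel₀ ha,
      neg_one_mul, neg_neg, coord]
  exact ⟨equivOfInverse (subst _ hb) (subst _ hb) (by rw [e, e2]) (by rw [e, e2]), e, e⟩

/-- Closeness of two substitutions can be tested on the coordinate. -/
theorem norm_map_sub_map_le (hr : IsModulus k r) (hs : IsModulus k s)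
    (F G : AnnulusAlgebra k s →A[k] AnnulusAlgebra k r) {v : AnnulusAlgebra k r} (hv : ‖v‖ < 1)
    (h : F (coord k s) = G (coord k s) * (1 + v)) (a : AnnulusAlgebra k s) :
    ‖F a - G a‖ ≤ ‖v‖ * ‖a‖ := by
  obtain ⟨w, hw⟩ := exists_unit_eq_one_add hv
  have hu : coordImage F = coordImage G * w := Units.ext (by
    rw [coe_coordImage, h, Units.val_mul, hw]; rfl)
  refine norm_map_le_of_monomial (F.toContinuousLinearMap - G.toContinuousLinearMap)
    (fun i => ?_) a
  change ‖F _ - G _‖ ≤ _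
  have e : F (monomial s i 1) - G (monomial s i 1)
      = G (monomial s i 1) * (((w ^ i : (AnnulusAlgebra k r)ˣ) : AnnulusAlgebra k r) - 1) := by
    rw [map_monomial, map_monomial, hu, mul_zpow, Units.val_mul, one_smul, one_smul, mul_sub,
      mul_one]
  rw [e, mul_comm]
  refine (norm_mul_le _ _).trans (mul_le_mul ?_ ?_ (norm_nonneg _) (norm_nonneg _))
  · exact norm_zpow_sub_one_le w hv (by rw [hw, add_sub_cancel_left]) i
  · refine (norm_map_le hr hs G _).trans_eq ?_
    rw [norm_monomial, norm_one, one_mul]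

/-- Coordinates close to the standard one. -/
theorem exists_near_coord (hr : IsModulus k r) {v : AnnulusAlgebra k r} (hv : ‖v‖ < 1) :
    ∃ σ : AnnulusAlgebra k r ≃A[k] AnnulusAlgebra k r, σ (coord k r) = coord k r * (1 + v) := by
  obtain ⟨w, hw⟩ := exists_unit_eq_one_add hv
  have hu : HasLead ((coordUnit k r * w : (AnnulusAlgebra k r)ˣ) : AnnulusAlgebra k r) 1 1 :=
    ⟨one_ne_zero, v, hv, by rw [Units.val_mul, hw]; rfl⟩
  have hr1 : (r : ℝ) ≤ 1 := hr.le_one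
  have hb := norm_zpow_le_of_radii hr.pos hu (by simpa using hr1) (by simpa using hr1)
  have hE (a : AnnulusAlgebra k r) : ‖subst _ hb a - a‖ ≤ ‖v‖ * ‖a‖ :=
    norm_map_sub_map_le hr hr (subst _ hb) (ContinuousAlgHom.id k _) hv (by
      rw [subst_coord, Units.val_mul, hw]; rfl) a
  let E : AnnulusAlgebra k r →+ AnnulusAlgebra k r := (subst _ hb).toContinuousLinearMap.toAddMonoidHom
  -- Closeness to the identity yields bijectivity without constructing the inverse substitution; the
  -- inverse is isometric, hence continuous.
  have hbij : Function.Bijective E := bijective_of_near_id hv hE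
  let e := AlgEquiv.ofBijective (subst _ hb : AnnulusAlgebra k r →ₐ[k] AnnulusAlgebra k r) hbij
  refine ⟨{ e with
    continuous_toFun := (subst _ hb).cont
    continuous_invFun := ?_ }, ?_⟩
  · refine continuous_of_norm_map_le (e.symm : AnnulusAlgebra k r →+ AnnulusAlgebra k r) (C := 1)
      fun a => ?_
    have h1 : ‖E (e.symm a)‖ = ‖e.symm a‖ := norm_map_eq_of_near_id hv hE _
    have h2 : E (e.symm a) = a := e.apply_symm_apply a
    rw [h2] at h1
    rw [one_mul, h1]
    rfl
  · change subst _ hb (coord k r) = _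
    rw [subst_coord, Units.val_mul, hw]
    rfl

end AnnulusAlgebra

/-! ### Finite and étale morphisms. -/

open AnnulusAlgebra

/-- A morphism of annuli that is finite of degree `m`. -/
structure IsFiniteOfDegree {k A B : Type*} [NormedField k] [CommRing A] [TopologicalSpace A]
    [Algebra k A] [CommRing B] [TopologicalSpace B] [Algebra k B] (m : ℕ) (f : B →A[k] A) :
    Prop where
  finite : (f : B →+* A).Finite
  degree : letI : Algebra B A := (f : B →+* A).toAlgebra
    Module.finrank B A = m

theorem IsFiniteOfDegree.conj {k A B A' B' : Type*} [NormedField k] [CommRing A]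
    [TopologicalSpace A] [Algebra k A] [CommRing B] [TopologicalSpace B] [Algebra k B] [CommRing A']
    [TopologicalSpace A'] [Algebra k A'] [CommRing B'] [TopologicalSpace B'] [Algebra k B'] {m : ℕ}
    {f : B →A[k] A} (hf : IsFiniteOfDegree m f) (eY : A ≃A[k] A') (eX : B ≃A[k] B')
    (F : B' →A[k] A') (hF : ∀ b, F b = eY (f (eX.symm b))) : IsFiniteOfDegree m F := by
  have e : (F : B' →+* A') = ((eY : A ≃+* A') : A →+* A').comp
      ((f : B →+* A).comp ((eX.symm : B' ≃+* B) : B' →+* B)) := RingHom.ext hF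
  refine ⟨?_, ?_⟩
  · rw [e]
    refine RingHom.Finite.comp (RingHom.Finite.of_surjective _ (eY : A ≃+* A').surjective)
      (hf.finite.comp (RingHom.Finite.of_surjective _ (eX.symm : B' ≃+* B).surjective))
  · let : Algebra B A := (f : B →+* A).toAlgebra
    let : Algebra B' A' := (F : B' →+* A').toAlgebra
    rw [← hf.degree]
    refine (Algebra.finrank_eq_of_equiv_equiv (eX : B ≃+* B') (eY : A ≃+* A') ?_).symm
    ext b
    change F (eX b) = eY (f b)
    rw [hF, ContinuousAlgEquiv.symm_apply_apply]

/-- With this, a change of coordinates is a presentation of a finite morphism of degree `1`, and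
results on degrees apply to it. -/
theorem isFiniteOfDegree_id (k A : Type*) [NormedField k] [CommRing A] [TopologicalSpace A]
    [Algebra k A] [Nontrivial A] : IsFiniteOfDegree 1 (ContinuousAlgHom.id k A) := by
  refine ⟨RingHom.Finite.id A, ?_⟩
  change @Module.finrank A A _ _ (RingHom.id A).toAlgebra.toModule = 1
  exact Module.finrank_self A

theorem IsFiniteEtaleOfDegree.isFiniteOfDegree {k A B : Type*} [NormedField k] [CommRing A]
    [TopologicalSpace A] [Algebra k A] [CommRing B] [TopologicalSpace B] [Algebra k B] {m : ℕ}
    {f : B →A[k] A} (hf : IsFiniteEtaleOfDegree m f) : IsFiniteOfDegree m f :=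
  ⟨hf.finite, hf.degree⟩

/-- A nonzero element of the kernel would annihilate all of `A`, making its rank zero. -/
theorem IsFiniteOfDegree.injective {k A B : Type*} [NormedField k] [CommRing A]
    [TopologicalSpace A] [Algebra k A] [CommRing B] [TopologicalSpace B] [Algebra k B] {m : ℕ}
    {f : B →A[k] A} (hf : IsFiniteOfDegree m f) (hm : m ≠ 0) : Function.Injective f := by
  refine (injective_iff_map_eq_zero f).2 fun b hb => ?_
  by_contra hne
  let : Algebra B A := (f : B →+* A).toAlgebra
  have h1 : Module.rank B A = 0 := rank_eq_zero_iff.2 fun x => ⟨b, hne, by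
    rw [Algebra.smul_def]
    change f b * x = 0
    rw [hb, zero_mul]⟩
  refine hm ?_
  rw [← hf.degree]
  change Cardinal.toNat (Module.rank B A) = 0
  rw [h1, map_zero]

/-- Integral injective homomorphisms reflect units. This is the algebraic form of surjectivity on
points: a function vanishing somewhere on `X` cannot become invertible on `Y`. -/
theorem IsFiniteOfDegree.isUnit_of_map {k A B : Type*} [NormedField k] [CommRing A]
    [TopologicalSpace A] [Algebra k A] [CommRing B] [TopologicalSpace B] [Algebra k B] {m : ℕ}
    {f : B →A[k] A} (hf : IsFiniteOfDegree m f) (hm : m ≠ 0) {b : B} (hb : IsUnit (f b)) :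
    IsUnit b :=
  (RingHom.IsIntegral.isLocalHom hf.finite.to_isIntegral (hf.injective hm)).map_nonunit b hb

/-- The derivative of an étale morphism of annuli is invertible. -/
theorem isUnit_euler_presentation {k A B : Type*} [NormedField k] [IsUltrametricDist k]
    [CompleteSpace k] [CommRing A] [TopologicalSpace A] [Algebra k A] [CommRing B]
    [TopologicalSpace B] [Algebra k B] {r s : ℝ≥0} {m : ℕ}
    {f : B →A[k] A} (hf : IsFiniteEtaleOfDegree m f) (eY : MonicCoordinate k r A)
    (eX : MonicCoordinate k s B) : IsUnit (euler (presentation f eY eX)) := by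
  let F : AnnulusAlgebra k s →A[k] AnnulusAlgebra k r :=
    (eY : A →A[k] AnnulusAlgebra k r).comp (f.comp (eX.symm : AnnulusAlgebra k s →A[k] B))
  have hF (b : AnnulusAlgebra k s) : F b = eY (f (eX.symm b)) := rfl
  have hφ : presentation f eY eX = coordImage F := rfl
  rw [hφ, euler_unit]
  refine (coordImage F).isUnit.mul ?_
  set w := dlog (Additive.ofMul (coordImage F)) with hw
  let : Algebra B A := (f : B →+* A).toAlgebra
  -- Modulo the logarithmic derivative `w`, the Euler derivation kills the image of `B`, so it
  -- becomes a `B`-derivation of `A` into `A ⧸ J`. Étaleness makes it zero, and its value on the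
  -- invertible coordinate then shows that `w` divides a unit.
  let J : Ideal A := Ideal.span {eY.symm w}
  have hfb (b : B) : eY.symm (euler (eY (f b))) ∈ J := by
    have h1 := euler_map F (eX b)
    rw [hF, ContinuousAlgEquiv.symm_apply_apply] at h1
    rw [h1, map_mul]
    exact J.mul_mem_left _ (Ideal.subset_span rfl)
  have leib (a b : A) : eY.symm (euler (eY (a * b)))
      = a * eY.symm (euler (eY b)) + b * eY.symm (euler (eY a)) := by
    rw [map_mul, euler_mul, map_add, map_mul, map_mul, ContinuousAlgEquiv.symm_apply_apply,
      ContinuousAlgEquiv.symm_apply_apply]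
  let δ₀ : A →ₗ[B] A ⧸ J :=
    { toFun := fun a => Ideal.Quotient.mk J (eY.symm (euler (eY a)))
      map_add' := fun a b => by simp only [map_add]
      map_smul' := fun b a => by
        rw [Algebra.smul_def]
        change Ideal.Quotient.mk J (eY.symm (euler (eY (f b * a)))) = _
        rw [leib, map_add, map_mul, map_mul, Ideal.Quotient.eq_zero_iff_mem.2 (hfb b), mul_zero,
          add_zero, RingHom.id_apply, Algebra.smul_def]
        rfl }
  let δ : Derivation B A (A ⧸ J) := Derivation.mk' δ₀ fun a b => by
    change Ideal.Quotient.mk J (eY.symm (euler (eY (a * b)))) = _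
    rw [leib, map_add, map_mul, map_mul]
    rfl
  have het : Algebra.Etale B A := hf.etale
  have hsub : Subsingleton (Ω[A⁄B]) := Algebra.FormallyUnramified.subsingleton_kaehlerDifferential
  have hδ (a : A) : δ a = 0 := by
    rw [← δ.liftKaehlerDifferential_comp_D a, Subsingleton.elim (KaehlerDifferential.D B A a) 0,
      map_zero]
  have h1 : eY.symm (euler (eY (eY.symm (coord k r)))) ∈ J :=
    Ideal.Quotient.eq_zero_iff_mem.1 (hδ (eY.symm (coord k r)))
  rw [ContinuousAlgEquiv.apply_symm_apply, coord, euler_monomial, Int.cast_one, mul_one] at h1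
  obtain ⟨c, hc⟩ := Ideal.mem_span_singleton'.1 h1
  have h2 : eY c * w = coord k r := by
    rw [← ContinuousAlgEquiv.apply_symm_apply eY w, ← map_mul, hc,
      ContinuousAlgEquiv.apply_symm_apply, coord]
  have h3 : IsUnit (eY c * w) := by
    rw [h2]
    exact (coordUnit k r).isUnit
  exact isUnit_of_mul_isUnit_right h3

/-! ### The degree of a finite morphism is the degree of its dominant term, up to sign. -/

namespace AnnulusAlgebra

variable {k : Type*} [NormedField k] [IsUltrametricDist k] [CompleteSpace k] {r s : ℝ≥0}

/-- The zero `c` lies in the annulus: the term `T` cannot dominate at radius `s`, nor the constant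
term at radius `1`. -/
theorem not_isUnit_coord_sub (hs0 : 0 < s) (hs1 : s ≤ 1) {c : k} (h1 : s ≤ ‖c‖) (h2 : ‖c‖ ≤ 1) :
    ¬ IsUnit (coord k s - monomial s 0 c) := by
  intro hu
  obtain ⟨κ, n, h⟩ := exists_hasLead_of_isUnit hs0 hs1 hu
  have hd := h.isDominantTerm hs0
  have hc (i : ℤ) : (coord k s - monomial s 0 c).coeff i
      = (if i = 1 then 1 else 0) - if i = 0 then c else 0 := by
    rw [coeff_sub, coord, coeff_monomial, coeff_monomial]
  rcases eq_or_ne n 1 with rfl | hn1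
  · have := hd 0 (by norm_num) s le_rfl hs1
    rw [hc, hc] at this
    simp at this
    exact absurd this (not_lt.2 h1)
  rcases eq_or_ne n 0 with rfl | hn0
  · have := hd 1 (by norm_num) 1 hs1 le_rfl
    rw [hc, hc] at this
    simp at this
    exact absurd this (not_lt.2 h2)
  · have := h.norm_coeff
    rw [hc, if_neg hn1, if_neg hn0, sub_zero, norm_zero] at this
    exact h.1 (norm_eq_zero.1 this.symm)

theorem weight_pow {n : ℕ} (hs : s = r ^ n) (q : ℤ) : weight s q = weight r (n * q) := by
  rw [weight, weight, hs, NNReal.coe_pow, ← zpow_natCast, ← zpow_mul]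

section Components

variable {d : ℕ} [NeZero d] {κ : k} (hκ : ‖κ‖ = 1) (hs : s = r ^ d)
include hκ hs

theorem norm_component_le (j i : ℤ) :
    ‖(if i % d = j then monomial s (i / d) (κ ^ (-(i / d))) else 0 : AnnulusAlgebra k s)‖
      ≤ weight r (-j) * weight r i := by
  split_ifs with h
  · rw [norm_monomial, norm_zpow, hκ, one_zpow, one_mul, weight_pow hs]
    refine le_trans (le_of_eq ?_) (weight_add_le r _ _)
    congr 1
    have := Int.emod_add_mul_ediv i d
    rw [← h]
    linarith
  · rw [norm_zero]
    exact mul_nonneg (weight_pos _ _).le (weight_pos _ _).le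

/-- The component of degree `j` modulo `d` of a series in `T`, as a series in `κ T ^ d`. -/
def component (j : ℤ) : AnnulusAlgebra k r →L[k] AnnulusAlgebra k s :=
  ofMonomials _ (norm_component_le hκ hs j)

theorem component_monomial (j i : ℤ) : component hκ hs j (monomial r i 1)
    = if i % d = j then monomial s (i / d) (κ ^ (-(i / d))) else 0 := by
  rw [component, ofMonomials_monomial, one_smul]

/-- Reassembling the components after applying a linear map to them. -/
def reassemble (H : AnnulusAlgebra k s →L[k] AnnulusAlgebra k r) :
    AnnulusAlgebra k r →L[k] AnnulusAlgebra k r :=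
  ∑ j : Fin d, ContinuousLinearMap.comp
    ⟨LinearMap.mulLeft k (monomial r (j : ℤ) 1), continuous_const.mul continuous_id⟩
    (H.comp (component hκ hs j))

theorem reassemble_apply (H : AnnulusAlgebra k s →L[k] AnnulusAlgebra k r)
    (a : AnnulusAlgebra k r) : reassemble hκ hs H a
      = ∑ j : Fin d, monomial r (j : ℤ) 1 * H (component hκ hs j a) := by
  rw [reassemble, sum_apply]
  rfl

theorem reassemble_monomial (H : AnnulusAlgebra k s →L[k] AnnulusAlgebra k r) (i : ℤ) :
    reassemble hκ hs H (monomial r i 1)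
      = monomial r (i % d) 1 * H (monomial s (i / d) (κ ^ (-(i / d)))) := by
  have hd : (0 : ℤ) < d := by exact_mod_cast Nat.pos_of_ne_zero (NeZero.ne d)
  have h0 := Int.emod_nonneg i hd.ne'
  have h1 := Int.emod_lt_of_pos i hd
  rw [reassemble_apply, Finset.sum_eq_single ⟨(i % d).toNat, by omega⟩]
  · have e : ((((i % d).toNat : ℕ)) : ℤ) = i % d := Int.toNat_of_nonneg h0
    change monomial r (((i % d).toNat : ℕ) : ℤ) 1
      * H (component hκ hs (((i % d).toNat : ℕ) : ℤ) (monomial r i 1)) = _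
    rw [e, component_monomial, if_pos rfl]
  · intro j _ hj
    rw [component_monomial, if_neg, map_zero, mul_zero]
    intro h
    refine hj (Fin.ext ?_)
    change (j : ℕ) = (i % d).toNat
    omega
  · intro h
    exact absurd (Finset.mem_univ _) h

end Components

/-- A morphism with dominant term of positive degree `d` onto the full image annulus is free of
rank `d`. -/
theorem finrank_eq_of_hasLead {d : ℕ} (hd : d ≠ 0)
    (F : AnnulusAlgebra k s →A[k] AnnulusAlgebra k r) {κ : k} (hκ : ‖κ‖ = 1) (hs : s = r ^ d)
    (h : HasLead (F (coord k s)) κ d) :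
    letI : Algebra (AnnulusAlgebra k s) (AnnulusAlgebra k r) :=
      (F : AnnulusAlgebra k s →+* AnnulusAlgebra k r).toAlgebra
    Module.finrank (AnnulusAlgebra k s) (AnnulusAlgebra k r) = d := by
  have : NeZero d := ⟨hd⟩
  have hdz : (d : ℤ) ≠ 0 := by exact_mod_cast hd
  let : Algebra (AnnulusAlgebra k s) (AnnulusAlgebra k r) :=
    (F : AnnulusAlgebra k s →+* AnnulusAlgebra k r).toAlgebra
  have hsmul (b : AnnulusAlgebra k s) (a : AnnulusAlgebra k r) : b • a = F b * a := by
    rw [Algebra.smul_def]; rfl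
  obtain ⟨hκ0, v, hv, hφ⟩ := h
  obtain ⟨w, hw⟩ := exists_unit_eq_one_add hv
  have hb (i : ℤ) : ‖((monomialUnit r d κ hκ0 ^ i : (AnnulusAlgebra k r)ˣ) :
      AnnulusAlgebra k r)‖ ≤ 1 * weight s i := by
    rw [coe_monomialUnit_zpow, norm_monomial, norm_zpow, hκ, one_zpow, weight_pow hs, mul_comm i]
  -- `G` is the unperturbed substitution `T ↦ κ Tᵈ`, for which splitting by exponents modulo `d` and
  -- reassembling is the identity. Using `F` instead changes the result by a relative error at most
  -- `‖v‖`, so reassembling stays bijective and the first `d` powers of `T` form a basis.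
  let G : AnnulusAlgebra k s →A[k] AnnulusAlgebra k r := subst _ hb
  have hG : coordImage G = monomialUnit r d κ hκ0 := Units.ext (subst_coord _ hb)
  have hGm (q : ℤ) (c : k) : G (monomial s q c) = monomial r (d * q) (c * κ ^ q) := by
    rw [map_monomial, hG, coe_monomialUnit_zpow, smul_monomial, mul_comm q]
  have hFm (q : ℤ) (c : k) : F (monomial s q c)
      = G (monomial s q c) * ((w ^ q : (AnnulusAlgebra k r)ˣ) : AnnulusAlgebra k r) := by
    have hF : coordImage F = coordImage G * w := Units.ext (by
      rw [coe_coordImage, hφ, Units.val_mul, hw, hG]; rfl)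
    rw [map_monomial, map_monomial, hF, mul_zpow, Units.val_mul, smul_mul_assoc]
  have hGid (i : ℤ) : reassemble hκ hs G.toContinuousLinearMap (monomial r i 1)
      = monomial r i 1 := by
    rw [reassemble_monomial]
    change _ * G _ = _
    rw [hGm, monomial_mul_monomial, ← zpow_add₀ hκ0, neg_add_cancel, zpow_zero, one_mul,
      Int.emod_add_mul_ediv]
  have hG1 (a : AnnulusAlgebra k r) : reassemble hκ hs G.toContinuousLinearMap a = a :=
    DFunLike.congr_fun (continuousLinearMap_ext (g := ContinuousLinearMap.id k _) hGid) a
  have hE (a : AnnulusAlgebra k r) :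
      ‖reassemble hκ hs F.toContinuousLinearMap a - a‖ ≤ ‖v‖ * ‖a‖ := by
    refine norm_map_le_of_monomial (reassemble hκ hs F.toContinuousLinearMap
      - ContinuousLinearMap.id k _) (fun i => ?_) a
    change ‖reassemble hκ hs F.toContinuousLinearMap _ - monomial r i 1‖ ≤ _
    have e1 := hGid i
    rw [reassemble_monomial] at e1
    rw [reassemble_monomial]
    change ‖_ * F _ - _‖ ≤ _
    change _ * G _ = _ at e1
    rw [hFm, ← mul_assoc, e1, ← mul_sub_one, mul_comm]
    refine (norm_mul_le _ _).trans (mul_le_mul ?_ ?_ (norm_nonneg _) (norm_nonneg _))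
    · exact norm_zpow_sub_one_le w hv (by rw [hw, add_sub_cancel_left]) _
    · rw [norm_monomial, norm_one, one_mul]
  let E : AnnulusAlgebra k r →+ AnnulusAlgebra k r :=
    (reassemble hκ hs F.toContinuousLinearMap).toLinearMap.toAddMonoidHom
  have hbij : Function.Bijective E := bijective_of_near_id hv hE
  have hEa (a : AnnulusAlgebra k r) :
      E a = ∑ j : Fin d, component hκ hs j a • monomial r (j : ℤ) (1 : k) := by
    change reassemble hκ hs F.toContinuousLinearMap a = _
    rw [reassemble_apply]
    exact Finset.sum_congr rfl fun j _ => by rw [hsmul, mul_comm]; rfl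
  have hcomp (j₀ j : Fin d) (c : AnnulusAlgebra k s) :
      component hκ hs j₀ (monomial r (j : ℤ) 1 * G c) = if j = j₀ then c else 0 := by
    let l1 : AnnulusAlgebra k s →L[k] AnnulusAlgebra k s := (component hκ hs j₀).comp
      (ContinuousLinearMap.comp
        ⟨LinearMap.mulLeft k (monomial r (j : ℤ) 1), continuous_const.mul continuous_id⟩
        G.toContinuousLinearMap)
    let l2 : AnnulusAlgebra k s →L[k] AnnulusAlgebra k s :=
      if j = j₀ then ContinuousLinearMap.id k _ else 0
    have : l1 = l2 := continuousLinearMap_ext fun q => by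
      have hj := j.2
      have hm : ((j : ℤ) + d * q) % d = j := by
        rw [Int.add_mul_emod_self_left]
        exact Int.emod_eq_of_lt (by omega) (by exact_mod_cast hj)
      have hq : ((j : ℤ) + d * q) / d = q := by
        rw [Int.add_mul_ediv_left _ _ hdz, Int.ediv_eq_zero_of_lt (by omega) (by exact_mod_cast hj),
          zero_add]
      change component hκ hs j₀ (monomial r (j : ℤ) 1 * G (monomial s q 1)) = _
      rw [hGm, monomial_mul_monomial, one_mul, one_mul, ← mul_one (κ ^ q), ← smul_monomial,
        map_smul, component_monomial, hm, hq]
      by_cases hjj : j = j₀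
      · simp only [l2, if_pos hjj, hjj, if_true]
        rw [smul_monomial, ← zpow_add₀ hκ0, add_neg_cancel, zpow_zero]
        rfl
      · rw [if_neg fun h => hjj (Fin.ext (by exact_mod_cast h))]
        simp only [l2, if_neg hjj, smul_zero]
        rfl
    have h2 := DFunLike.congr_fun this c
    change component hκ hs j₀ (monomial r (j : ℤ) 1 * G c) = l2 c at h2
    rw [h2]
    by_cases hjj : j = j₀
    · simp only [l2, if_pos hjj]; rfl
    · simp only [l2, if_neg hjj]; rfl
  have hli : LinearIndependent (AnnulusAlgebra k s)
      (fun j : Fin d => monomial r (j : ℤ) (1 : k)) := by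
    rw [Fintype.linearIndependent_iff]
    intro c hc j₀
    have hca (j₀ : Fin d) :
        component hκ hs j₀ (∑ j : Fin d, monomial r (j : ℤ) 1 * G (c j)) = c j₀ := by
      rw [map_sum, Finset.sum_eq_single j₀]
      · rw [hcomp, if_pos rfl]
      · intro j _ hj
        rw [hcomp, if_neg hj]
      · intro h
        exact absurd (Finset.mem_univ _) h
    -- The element with components `c j` is sent by the injective map `E` to the given vanishing
    -- combination.
    have h0 : E (∑ j : Fin d, monomial r (j : ℤ) 1 * G (c j)) = 0 := by
      rw [hEa, ← hc]
      exact Finset.sum_congr rfl fun j _ => by rw [hca]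
    rw [← hca j₀, (injective_iff_map_eq_zero E).1 hbij.1 _ h0, map_zero]
  have hsp : ⊤ ≤ Submodule.span (AnnulusAlgebra k s)
      (Set.range fun j : Fin d => monomial r (j : ℤ) (1 : k)) := by
    intro a _
    obtain ⟨b, rfl⟩ := hbij.2 a
    rw [hEa]
    exact Submodule.sum_mem _ fun j _ =>
      Submodule.smul_mem _ _ (Submodule.subset_span ⟨j, rfl⟩)
  rw [Module.finrank_eq_card_basis (Module.Basis.mk hli hsp), Fintype.card_fin]

variable [IsAlgClosed k]

/-- A root of `X² - X - 1` satisfies `ζ (ζ - 1) = 1`, which excludes the residue classes of `0` and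
`1` in every residue characteristic. -/
theorem exists_norm_one_norm_sub_one (k : Type*) [NormedField k] [IsUltrametricDist k]
    [IsAlgClosed k] : ∃ ζ : k, ‖ζ‖ = 1 ∧ ‖1 - ζ‖ = 1 := by
  have hdeg : (Polynomial.X ^ 2 - Polynomial.X - 1 : Polynomial k).degree ≠ 0 := by
    have : (Polynomial.X ^ 2 - Polynomial.X - 1 : Polynomial k).degree = 2 := by
      compute_degree!
    rw [this]
    norm_num
  obtain ⟨ζ, hζ⟩ := IsAlgClosed.exists_root _ hdeg
  have h1 : ζ * (ζ - 1) = 1 := by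
    have : ζ ^ 2 - ζ - 1 = 0 := by simpa [Polynomial.IsRoot] using hζ
    linear_combination this
  have h2 : ‖ζ‖ * ‖ζ - 1‖ = 1 := by rw [← norm_mul, h1, norm_one]
  have h3 : ‖ζ‖ = 1 := by
    rcases lt_trichotomy ‖ζ‖ 1 with h | h | h
    · have h4 : ‖ζ - 1‖ ≤ 1 := norm_sub_le_of_le' h.le norm_one.le
      nlinarith [norm_nonneg ζ, norm_nonneg (ζ - 1)]
    · exact h
    · have h4 : ‖ζ - 1‖ = ‖ζ‖ := norm_eq_of_norm_sub_lt (by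
        rw [sub_sub_cancel_left, norm_neg, norm_one]; exact h)
      nlinarith [norm_nonneg ζ]
  refine ⟨ζ, h3, ?_⟩
  rw [norm_sub_rev]
  rwa [h3, one_mul] at h2

theorem degree_eq_of_pos (hr : IsModulus k r) (hs : IsModulus k s) {m : ℕ} (hm : m ≠ 0)
    {F : AnnulusAlgebra k s →A[k] AnnulusAlgebra k r} (hF : IsFiniteOfDegree m F) {κ : k} {d : ℤ}
    (hd : 0 < d) (h : HasLead (F (coord k s)) κ d) : d = m ∧ ‖κ‖ = 1 ∧ s = r ^ m := by
  have hr0 : (0 : ℝ) < r := by exact_mod_cast hr.pos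
  have hκ0 : 0 < ‖κ‖ := norm_pos_iff.2 h.1
  have hrad := h.radii hr hs
  have hFc (c : k) : F (coord k s - monomial s 0 c) = F (coord k s) - monomial r 0 c := by
    rw [map_sub, map_monomial, zpow_zero, Units.val_one, one_eq_monomial, smul_monomial, mul_one]
  -- If `|κ| < 1`, then `F(T) - 1` is a unit although `T - 1` is not, contradicting the reflection
  -- of units.
  have hκ : ‖κ‖ = 1 := by
    refine le_antisymm hrad.1.2 ?_
    by_contra! hlt
    refine not_isUnit_coord_sub hs.pos hs.le_one (c := (1 : k)) (by rw [norm_one]; exact hs.le_one)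
      norm_one.le (hF.isUnit_of_map hm ?_)
    rw [hFc, ← one_eq_monomial]
    have h1 : ‖-F (coord k s)‖ < 1 := by
      rw [norm_neg]
      refine h.norm_le.trans_lt ?_
      rwa [weight_of_nonneg hr.le_one hd.le, mul_one]
    have h2 := (hasLead_one_add h1).isUnit.neg
    rwa [neg_add_rev, neg_neg, ← sub_eq_add_neg] at h2
  -- If `s < rᵈ`, a scalar `b` with `|b| = s` is dominated everywhere by `κ Tᵈ`, so `F(T) - b` is a
  -- unit although `T - b` is not.
  have hsr : (s : ℝ) = (r : ℝ) ^ d := by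
    have hle := hrad.2.1
    rw [hκ, one_mul] at hle
    refine le_antisymm hle ?_
    by_contra! hlt
    obtain ⟨b, hb, hbs⟩ := hs.1
    have hbs' : ‖b‖ = s := by rw [← hbs]; rfl
    refine not_isUnit_coord_sub hs.pos hs.le_one (c := b) hbs'.ge (by rw [hbs']; exact hs.le_one)
      (hF.isUnit_of_map hm ?_)
    rw [hFc]
    obtain ⟨hκ0', v, hv, hφ⟩ := h
    have h1 : ‖v - monomial r (-d) (κ⁻¹ * b)‖ < 1 := by
      refine norm_sub_lt_of_lt hv ?_
      rw [norm_monomial, norm_mul, norm_inv, hκ, inv_one, one_mul, hbs',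
        weight_of_nonpos hr.pos hr.le_one (by omega), zpow_neg, ← div_eq_mul_inv,
        div_lt_one (zpow_pos hr0 d)]
      exact hlt
    have h2 : HasLead (F (coord k s) - monomial r 0 b) κ d := by
      refine ⟨hκ0', _, h1, ?_⟩
      have h3 : monomial r 0 b = monomial r d κ * monomial r (-d) (κ⁻¹ * b) := by
        rw [monomial_mul_monomial, add_neg_cancel, mul_inv_cancel_left₀ hκ0']
      rw [hφ, h3]
      ring
    exact h2.isUnit
  obtain ⟨n, rfl⟩ : ∃ n : ℕ, d = n := ⟨d.toNat, by omega⟩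
  have hsr' : s = r ^ n := by
    refine NNReal.coe_injective ?_
    rw [hsr, zpow_natCast, NNReal.coe_pow]
  have h1 := finrank_eq_of_hasLead (by omega) F hκ hsr' h
  have h2 := hF.degree
  obtain rfl : n = m := h1.symm.trans h2
  exact ⟨rfl, hκ, hsr'⟩

/-- The dominant term of a finite morphism of annuli has degree equal to the degree of the
morphism, up to sign. -/
theorem degree_eq (hr : IsModulus k r) (hs : IsModulus k s) {m : ℕ} (hm : m ≠ 0)
    {F : AnnulusAlgebra k s →A[k] AnnulusAlgebra k r} (hF : IsFiniteOfDegree m F) {κ : k} {d : ℤ}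
    (h : HasLead (F (coord k s)) κ d) :
    s = r ^ m ∧ ((d = m ∧ ‖κ‖ = 1) ∨ (d = -m ∧ ‖κ‖ = s)) := by
  rcases lt_trichotomy d 0 with hd | rfl | hd
  · obtain ⟨b, hb, hbs⟩ := hs.1
    have hbs' : ‖b‖ = s := by rw [← hbs]; rfl
    obtain ⟨σ, hσ, hσ'⟩ := exists_inversion hs hbs'
    let F' : AnnulusAlgebra k s →A[k] AnnulusAlgebra k r :=
      F.comp (σ.symm : AnnulusAlgebra k s →A[k] AnnulusAlgebra k s)
    have hF' : IsFiniteOfDegree m F' :=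
      hF.conj (ContinuousAlgEquiv.refl k _) σ F' fun _ => rfl
    have h1 : HasLead (F' (coord k s)) (b * κ ^ (-1 : ℤ)) (-1 * d) := by
      change HasLead (F (σ.symm (coord k s))) _ _
      rw [hσ']
      exact h.map hr hs (hasLead_monomial _ hb)
    obtain ⟨e1, e2, e3⟩ := degree_eq_of_pos hr hs hm hF' (by omega) h1
    refine ⟨e3, .inr ⟨by omega, ?_⟩⟩
    rw [norm_mul, zpow_neg_one, norm_inv, hbs', mul_inv_eq_one₀ (norm_pos_iff.2 h.1).ne'] at e2
    exact e2.symm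
  · exfalso
    -- In degree zero the image of `T` is concentrated near `κ` and misses `κ ζ`, which has the same
    -- absolute value but lies in another residue class.
    obtain ⟨ζ, h1, h2⟩ := exists_norm_one_norm_sub_one k
    have hrad := h.radii hr hs
    refine not_isUnit_coord_sub hs.pos hs.le_one (c := κ * ζ)
      (by rw [norm_mul, h1, mul_one]; exact hrad.1.1)
      (by rw [norm_mul, h1, mul_one]; exact hrad.1.2) (hF.isUnit_of_map hm ?_)
    obtain ⟨hκ0, v, hv, hφ⟩ := h
    have hζ : 1 - ζ ≠ 0 := norm_pos_iff.1 (by rw [h2]; exact one_pos)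
    have h3 : ‖(1 - ζ)⁻¹ • v‖ < 1 := by rwa [norm_smul_eq, norm_inv, h2, inv_one, one_mul]
    have h4 : HasLead (F (coord k s - monomial s 0 (κ * ζ))) (κ * (1 - ζ)) 0 := by
      refine ⟨mul_ne_zero hκ0 hζ, _, h3, ?_⟩
      rw [map_sub, map_monomial, hφ, zpow_zero, Units.val_one, monomial_zero_mul,
        monomial_zero_mul, smul_add, smul_add, smul_smul, mul_assoc, mul_inv_cancel₀ hζ, mul_one,
        mul_one_sub, sub_smul]
      abel
    exact h4.isUnit
  · obtain ⟨e1, e2, e3⟩ := degree_eq_of_pos hr hs hm hF hd h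
    exact ⟨e3, .inl ⟨e1, e2⟩⟩

end AnnulusAlgebra
-- Wild and tame parts of a series.
namespace AnnulusAlgebra

variable {k : Type*} [NormedField k] [IsUltrametricDist k] [CompleteSpace k] {r s : ℝ≥0}

theorem norm_intCast_eq (n : ℤ) : ‖(n : AnnulusAlgebra k r)‖ = ‖(n : k)‖ := by
  rw [← map_intCast (algebraMap k (AnnulusAlgebra k r)), norm_algebraMap']

/-! The terms of a series of exponents divisible by `p`, and the other ones. -/

/-- The sum of the terms with exponents not divisible by `p`. -/
def tamePart (p : ℕ) : AnnulusAlgebra k r →+ AnnulusAlgebra k r where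
  toFun a := ⟨fun i => if (p : ℤ) ∣ i then 0 else a.coeff i, by
    refine squeeze_zero (fun i => mul_nonneg (norm_nonneg _) (weight_pos r i).le) (fun i => ?_)
      a.tendsto_coeff
    refine mul_le_mul_of_nonneg_right ?_ (weight_pos r i).le
    beta_reduce
    split_ifs
    · rw [norm_zero]; exact norm_nonneg _
    · exact le_rfl⟩
  map_zero' := AnnulusAlgebra.ext fun i => ite_self 0
  map_add' a b := AnnulusAlgebra.ext fun i => by
    change (if (p : ℤ) ∣ i then 0 else (a + b).coeff i)
      = (if (p : ℤ) ∣ i then 0 else a.coeff i) + if (p : ℤ) ∣ i then 0 else b.coeff i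
    split_ifs
    · rw [add_zero]
    · rfl

theorem coeff_tamePart (p : ℕ) (a : AnnulusAlgebra k r) (i : ℤ) :
    (tamePart p a).coeff i = if (p : ℤ) ∣ i then 0 else a.coeff i := rfl

theorem tamePart_tamePart (p : ℕ) (a : AnnulusAlgebra k r) :
    tamePart p (tamePart p a) = tamePart p a := by
  ext i
  rw [coeff_tamePart, coeff_tamePart]
  split_ifs <;> rfl

/-- The tame part is controlled by the derivative. -/
theorem norm_monomial_mul_tamePart_le {p : ℕ} (hp : p.Prime) (hkp : ‖(p : k)‖ < 1) (n : ℤ) (c : k)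
    (a : AnnulusAlgebra k r) :
    ‖monomial r n c * tamePart p a‖ ≤ ‖monomial r n c * euler a‖ := by
  refine norm_le_iff.2 fun i => le_trans ?_ (term_le_norm _ i)
  refine mul_le_mul_of_nonneg_right ?_ (weight_pos r i).le
  rw [coeff_monomial_mul, coeff_monomial_mul, norm_mul, norm_mul]
  refine mul_le_mul_of_nonneg_left ?_ (norm_nonneg c)
  rw [coeff_tamePart, coeff_euler]
  split_ifs with h
  · rw [norm_zero]; exact norm_nonneg _
  · rw [norm_mul, norm_intCast_eq_one_of_not_dvd hp hkp h, one_mul]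

/-- The series in `T ^ p` formed by the terms with exponents divisible by `p`. -/
def wildPart {p : ℕ} [NeZero p] (hs : s = r ^ p) : AnnulusAlgebra k r →L[k] AnnulusAlgebra k s :=
  component (norm_one (α := k)) hs 0

theorem coeff_wildPart {p : ℕ} [NeZero p] (hs : s = r ^ p) (a : AnnulusAlgebra k r) (q : ℤ) :
    (wildPart hs a).coeff q = a.coeff (p * q) := by
  have hp : (p : ℤ) ≠ 0 := by exact_mod_cast NeZero.ne p
  let l1 : AnnulusAlgebra k r →L[k] k := (coeffL k s q).comp (wildPart hs)
  have : l1 = coeffL k r (p * q) := continuousLinearMap_ext fun i => by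
    change (component (norm_one (α := k)) hs 0 (monomial r i 1)).coeff q = (monomial r i 1).coeff (p * q)
    rw [component_monomial, coeff_monomial]
    split_ifs with h1 h2 h2
    · rw [coeff_monomial, if_pos, one_zpow]
      rw [← h2, Int.mul_ediv_cancel_left _ hp]
    · rw [coeff_monomial, if_neg]
      rintro rfl
      exact h2 (Int.mul_ediv_cancel' (Int.dvd_of_emod_eq_zero h1))
    · exact absurd (by rw [← h2, Int.mul_emod_right]) h1
    · rw [coeff_zero]
  exact DFunLike.congr_fun this a

theorem norm_wildPart_le {p : ℕ} [NeZero p] (hs : s = r ^ p) (a : AnnulusAlgebra k r) :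
    ‖wildPart hs a‖ ≤ ‖a‖ := by
  refine norm_le_iff.2 fun q => ?_
  rw [coeff_wildPart, weight_pow hs]
  exact term_le_norm a _

theorem eq_zero_of_wildPart_of_tamePart {p : ℕ} [NeZero p] (hs : s = r ^ p)
    {a : AnnulusAlgebra k r} (h1 : wildPart hs (monomial r (-p) 1 * a) = 0)
    (h2 : tamePart p a = 0) : a = 0 := by
  ext i
  by_cases h : (p : ℤ) ∣ i
  · obtain ⟨q, rfl⟩ := h
    have := congrArg (fun b => b.coeff (q - 1)) h1
    simp only [coeff_wildPart, coeff_monomial_mul, one_mul, coeff_zero] at this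
    rw [coeff_zero, ← this]
    congr 1
    ring
  · have := congrArg (fun b => b.coeff i) h2
    simp only [coeff_tamePart, if_neg h] at this
    exact this

section

variable (hr : IsModulus k r) (hs : IsModulus k s) {p : ℕ} [NeZero p] (hsr : s = r ^ p)
  {F : AnnulusAlgebra k s →A[k] AnnulusAlgebra k r} {u : AnnulusAlgebra k r} (hu : ‖u‖ < 1)
  (hF : F (coord k s) = monomial r p 1 * (1 + u))
include hr hs hu hF

/-- For the substitution `T ↦ Tᵖ` the wild part recovers `h` exactly, and `F` differs from it by the
factor `1 + u`. -/
theorem norm_wildPart_map_sub_le (h : AnnulusAlgebra k s) :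
    ‖wildPart hsr (monomial r (-p) 1 * (F (coord k s) * F h)) - h‖ ≤ ‖u‖ * ‖h‖ := by
  have hb (i : ℤ) : ‖((monomialUnit r p (1 : k) one_ne_zero ^ i : (AnnulusAlgebra k r)ˣ) :
      AnnulusAlgebra k r)‖ ≤ 1 * weight s i := by
    rw [coe_monomialUnit_zpow, norm_monomial, one_zpow, norm_one, weight_pow hsr, mul_comm i]
  let G : AnnulusAlgebra k s →A[k] AnnulusAlgebra k r := subst _ hb
  have hGc : G (coord k s) = monomial r p 1 := subst_coord _ hb
  have hG : coordImage G = monomialUnit r p 1 one_ne_zero := Units.ext hGc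
  have h1 : wildPart hsr (G h) = h := by
    let l1 : AnnulusAlgebra k s →L[k] AnnulusAlgebra k s :=
      (wildPart hsr).comp G.toContinuousLinearMap
    have : l1 = ContinuousLinearMap.id k _ := continuousLinearMap_ext fun q => by
      change wildPart hsr (G (monomial s q 1)) = monomial s q 1
      ext i
      have hp : (p : ℤ) ≠ 0 := by exact_mod_cast NeZero.ne p
      rw [coeff_wildPart, map_monomial, hG, coe_monomialUnit_zpow, one_smul, coeff_monomial,
        coeff_monomial, one_zpow, mul_comm q]
      simp only [mul_right_inj' hp]
    exact DFunLike.congr_fun this h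
  have h2 : monomial r (-p) 1 * (F (coord k s) * F h) = (1 + u) * F h := by
    rw [hF, ← mul_assoc, ← mul_assoc, monomial_mul_monomial, neg_add_cancel, mul_one,
      ← one_eq_monomial, one_mul]
  have h3 : ‖(1 + u) * F h - G h‖ ≤ ‖u‖ * ‖h‖ := by
    have e : (1 + u) * F h - G h = (F h - G h) + u * F h := by ring
    rw [e]
    refine norm_add_le_of_le' (norm_map_sub_map_le hr hs F G hu (by rw [hF, hGc]) h) ?_
    exact (norm_mul_le _ _).trans
      (mul_le_mul_of_nonneg_left (norm_map_le hr hs F h) (norm_nonneg u))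
  nth_rewrite 2 [← h1]
  rw [h2, ← map_sub]
  exact (norm_wildPart_le hsr _).trans h3

/-- The terms with exponents divisible by `p` can be prescribed by a change of the coordinate of
the target. -/
theorem exists_unique_wildPart : ∃ P : AnnulusAlgebra k s → AnnulusAlgebra k s,
    (∀ b, wildPart hsr (monomial r (-p) 1 * (F (coord k s) * F (P b))) = b) ∧
      (∀ a b, P (a - b) = P a - P b) ∧ ∀ b, ‖P b‖ = ‖b‖ := by
  let E : AnnulusAlgebra k s →+ AnnulusAlgebra k s :=
    AddMonoidHom.mk' (fun h => wildPart hsr (monomial r (-p) 1 * (F (coord k s) * F h)))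
      fun a b => by rw [map_add, mul_add, mul_add, map_add]
  have hE (h : AnnulusAlgebra k s) : ‖E h - h‖ ≤ ‖u‖ * ‖h‖ :=
    norm_wildPart_map_sub_le hr hs hsr hu hF h
  have hbij := bijective_of_near_id hu hE
  choose P hP using hbij.2
  refine ⟨P, hP, fun a b => hbij.1 ?_, fun b => ?_⟩
  · rw [map_sub, hP, hP, hP]
  · rw [← norm_map_eq_of_near_id hu hE, hP]

end

/-! ### Derivatives of coordinate changes and of power maps. -/

theorem euler_coord : euler (coord k r) = coord k r := by
  rw [coord, euler_monomial, Int.cast_one, mul_one]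

/-- The right side is a multiple of the derivative of the presentation. Relative to the dominant
term of that derivative, a change of the target coordinate thus contributes no more than the norm of
`h`. -/
theorem euler_coord_mul_map (F : AnnulusAlgebra k s →A[k] AnnulusAlgebra k r)
    (h : AnnulusAlgebra k s) : euler (F (coord k s) * F h)
      = F (h + euler h) * euler (F (coord k s)) := by
  rw [← map_mul, euler_map, euler_map, euler_mul, euler_coord, map_add, map_mul, map_mul, map_add]
  ring

theorem euler_monomial_mul (n : ℤ) (c : k) (a : AnnulusAlgebra k r) :
    euler (monomial r n c * a) = monomial r n c * (n * a + euler a) := by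
  rw [euler_mul, euler_monomial, mul_comm (n : k), mul_add, add_comm]
  congr 1
  have : monomial r n (c * n) = (n : AnnulusAlgebra k r) * monomial r n c := by
    rw [mul_comm, ← smul_monomial, Algebra.smul_def, map_intCast]
  rw [this]
  ring

/-- The derivative of a difference of power maps is, to first order, linear. -/
theorem exists_euler_zpow_sub_zpow {A B : (AnnulusAlgebra k r)ˣ} {η : ℝ} (hη : η < 1)
    (hA : ‖A.val - 1‖ ≤ η) (hB : ‖B.val - 1‖ ≤ η) (j : ℤ)
    (c : k) : ∃ R : AnnulusAlgebra k r, ‖R‖ ≤ η * ‖A.val - B.val‖ ∧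
      euler (monomial r j c * ((A ^ j).val
        - (B ^ j).val))
        = monomial r j (j * c) * (j * (A.val - B.val)
          + euler (A.val - B.val) + R) := by
  have hη0 : 0 ≤ η := (norm_nonneg _).trans hA
  have hδ := norm_nonneg (A.val - B.val)
  set R1 := (A ^ j).val
    - (B ^ j).val - j * (A.val - B.val) with hR1
  set R2 := ((A ^ (j - 1)).val - 1)
      * euler (A.val - B.val)
    + ((A ^ (j - 1)).val
      - (B ^ (j - 1)).val) * euler B.val with hR2
  -- The factor `j` stands in front of everything, remainder included. For `j = p` this makes the
  -- derivative comparable with `p Tᵖ`, which the difference of `p`-th powers itself need not be.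
  refine ⟨R1 + R2, norm_add_le_of_le' (norm_zpow_sub_zpow_sub_le A B hη hA hB j)
    (norm_add_le_of_le' ?_ ?_), ?_⟩
  · exact (norm_mul_le _ _).trans (mul_le_mul (norm_zpow_sub_one_le A hη hA _) (norm_euler_le _)
      (norm_nonneg _) hη0)
  · have h1 : ‖euler B.val‖ ≤ η := by
      have : euler B.val = euler (B.val - 1) := by
        rw [map_sub, euler_one, sub_zero]
      rw [this]
      exact (norm_euler_le _).trans hB
    have h2 := norm_zpow_sub_zpow_le A B hη hA hB (j - 1)
    have h3 : max ‖((j - 1 : ℤ) : AnnulusAlgebra k r)‖ η ≤ 1 :=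
      max_le (norm_intCast_le_one _) hη.le
    have h4 := h2.trans (mul_le_of_le_one_left hδ h3)
    rw [mul_comm]
    exact (norm_mul_le _ _).trans (mul_le_mul h1 h4 (norm_nonneg _) hη0)
  · rw [euler_monomial_mul, map_sub, euler_zpow, euler_zpow, hR2, map_sub]
    have : monomial r j (j * c) = (j : AnnulusAlgebra k r) * monomial r j c := by
      rw [← smul_monomial, Algebra.smul_def, map_intCast]
    rw [this, hR1]
    ring

/-! ### The normal form, obtained by a contraction. -/

/-- Data of a monic series `φ = T ^ p (1 + u)` with derivative `μ T ^ l (1 + v)`, and of a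
binomial `T ^ p + c T ^ n` with derivative of the same dominant term. -/
structure NormalFormData (p : ℕ) (φ u v : AnnulusAlgebra k r) (l : ℤ) (μ : k) (n : ℤ) (c : k) :
    Prop where
  norm_u : ‖u‖ < 1
  eq_u : φ = monomial r p 1 * (1 + u)
  ne_zero : μ ≠ 0
  norm_v : ‖v‖ < 1
  eq_v : euler φ = monomial r l μ * (1 + v)
  norm_c : ‖monomial r (n - p) c‖ < 1
  cases : (c = 0 ∧ l = p ∧ μ = p) ∨ (n = l ∧ μ = n * c ∧ ‖monomial r (p - l) (μ⁻¹ * p)‖ < 1)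

/-- The binomial `T ^ p + c T ^ n` evaluated at `T w`. -/
def binomialAt (p : ℕ) (n : ℤ) (c : k) (w : (AnnulusAlgebra k r)ˣ) : AnnulusAlgebra k r :=
  monomial r p 1 * (w ^ (p : ℤ)).val
    + monomial r n c * (w ^ n).val

theorem binomialAt_sub (p : ℕ) (n : ℤ) (c : k) (A B : (AnnulusAlgebra k r)ˣ) :
    binomialAt p n c A - binomialAt p n c B
      = monomial r p 1 * ((A ^ (p : ℤ)).val
          - (B ^ (p : ℤ)).val)
        + monomial r n c * ((A ^ n).val
          - (B ^ n).val) := by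
  rw [binomialAt, binomialAt]
  ring

namespace NormalFormData

variable {p : ℕ} {φ u v : AnnulusAlgebra k r} {l : ℤ} {μ : k} {n : ℤ} {c : k}
  (H : NormalFormData p φ u v l μ n c)
include H

theorem exists_euler_binomial : ∃ v' : AnnulusAlgebra k r, ‖v'‖ < 1 ∧
    euler (binomialAt p n c 1 : AnnulusAlgebra k r) = monomial r l μ * (1 + v') := by
  rw [binomialAt, one_zpow, one_zpow, Units.val_one, mul_one, mul_one, map_add, euler_monomial,
    euler_monomial, mul_one]
  rcases H.cases with ⟨rfl, rfl, rfl⟩ | ⟨rfl, h, h'⟩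
  · exact ⟨0, by simp, by simp [monomial_zero_right]⟩
  · refine ⟨_, h', ?_⟩
    rw [mul_add, monomial_mul_monomial, mul_one, mul_inv_cancel_left₀ H.ne_zero, add_sub_cancel,
      ← h, add_comm, Int.cast_natCast]

/-- Linearization of the binomial, measured by derivatives. After division by `μ Tˡ` the first-order
parts cancel; what remains is a second-order remainder with factor `η` and, in the tame case, the
contribution of `p Tᵖ`, whose quotient by `μ Tˡ` has norm less than `1`. -/
theorem exists_bound {η : ℝ} (hη : η < 1) : ∃ θ < 1, 0 ≤ θ ∧
    ∀ A B : (AnnulusAlgebra k r)ˣ, ‖A.val - 1‖ ≤ η →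
      ‖B.val - 1‖ ≤ η →
      ‖monomial r (-l) μ⁻¹ * euler (monomial r l μ * (A.val - B.val)
        - (binomialAt p n c A - binomialAt p n c B))‖ ≤ θ * ‖A.val - B.val‖ := by
  have hinv : monomial r (-l) μ⁻¹ * monomial r l μ = 1 := by
    rw [monomial_mul_monomial, neg_add_cancel, inv_mul_cancel₀ H.ne_zero, one_eq_monomial]
  rcases H.cases with ⟨hc, hl, hμ⟩ | ⟨rfl, h, h'⟩
  · refine ⟨max η 0, max_lt hη one_pos, le_max_right _ _, fun A B hA hB => ?_⟩
    obtain ⟨R, hR, e⟩ := exists_euler_zpow_sub_zpow hη hA hB p (1 : k)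
    rw [binomialAt_sub, map_sub, map_add, e, euler_monomial_mul, hc, monomial_zero_right, zero_mul,
      map_zero, add_zero, mul_one, Int.cast_natCast, ← hμ, ← hl, ← mul_sub, ← mul_assoc, hinv,
      one_mul, sub_add_cancel_left, norm_neg]
    exact hR.trans (mul_le_mul_of_nonneg_right (le_max_left _ _) (norm_nonneg _))
  · set q := ‖monomial r (p - n) (μ⁻¹ * p)‖ with hq
    refine ⟨max η q, max_lt hη h', le_max_of_le_right (norm_nonneg _), fun A B hA hB => ?_⟩
    obtain ⟨R1, hR1, e1⟩ := exists_euler_zpow_sub_zpow hη hA hB p (1 : k)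
    obtain ⟨R2, hR2, e2⟩ := exists_euler_zpow_sub_zpow hη hA hB n c
    have hδ := norm_nonneg (A.val - B.val)
    have e3 : monomial r (-n) μ⁻¹ * (monomial r n μ * (n * (A.val - B.val)
          + euler (A.val - B.val))
        - (monomial r p (p : k) * ((p : ℤ) * (A.val - B.val)
          + euler (A.val - B.val) + R1)
          + monomial r n μ * (n * (A.val - B.val)
          + euler (A.val - B.val) + R2)))
        = -(monomial r (p - n) (μ⁻¹ * p) * ((p : ℤ) * (A.val - B.val)
          + euler (A.val - B.val) + R1)) - R2 := by
      have : monomial r (p - n) (μ⁻¹ * p) = monomial r (-n) μ⁻¹ * monomial r p (p : k) := by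
        rw [monomial_mul_monomial, neg_add_eq_sub]
      rw [this]
      linear_combination (-R2) * hinv
    rw [binomialAt_sub, map_sub, map_add, e1, e2, euler_monomial_mul, ← h, mul_one,
      Int.cast_natCast, e3]
    refine norm_sub_le_of_le' ?_ (hR2.trans (mul_le_mul_of_nonneg_right (le_max_left _ _) hδ))
    rw [norm_neg]
    refine (norm_mul_le _ _).trans (mul_le_mul (le_max_right _ _) ?_ (norm_nonneg _)
      (le_max_of_le_right (norm_nonneg _)))
    refine norm_add_le_of_le' (norm_add_le_of_le' ?_ (norm_euler_le _)) ?_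
    · exact norm_mul_le_of_le_one_left (norm_intCast_le_one _) le_rfl
    · exact hR1.trans (mul_le_of_le_one_left hδ hη.le)

/-- Here the comparison is with `Tᵖ`. The `p`-th power contracts by `|p|` up to the second-order
factor `η`, and the second term is small because `c Tⁿ` is dominated by `Tᵖ`. -/
theorem norm_binomialAt_sub_le {A B : (AnnulusAlgebra k r)ˣ} {η : ℝ} (hη : η < 1)
    (hA : ‖A.val - 1‖ ≤ η) (hB : ‖B.val - 1‖ ≤ η) :
    ‖monomial r (-p) 1 * (binomialAt p n c A - binomialAt p n c B)‖
      ≤ max (max ‖(p : k)‖ η) ‖monomial r (n - p) c‖ * ‖A.val - B.val‖ := by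
  have hδ := norm_nonneg (A.val - B.val)
  rw [binomialAt_sub, mul_add, ← mul_assoc, ← mul_assoc, monomial_mul_monomial,
    monomial_mul_monomial, neg_add_cancel, one_mul, one_mul, ← one_eq_monomial, one_mul,
    neg_add_eq_sub]
  refine norm_add_le_of_le' ?_ ?_
  · have := norm_zpow_sub_zpow_le A B hη hA hB p
    rw [norm_intCast_eq, Int.cast_natCast] at this
    exact this.trans (mul_le_mul_of_nonneg_right (le_max_left _ _) hδ)
  · have h1 := norm_zpow_sub_zpow_le A B hη hA hB n
    have h2 : max ‖(n : AnnulusAlgebra k r)‖ η ≤ 1 := max_le (norm_intCast_le_one _) hη.le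
    exact (norm_mul_le _ _).trans (mul_le_mul (le_max_right _ _)
      (h1.trans (mul_le_of_le_one_left hδ h2)) (norm_nonneg _)
      (le_max_of_le_right (norm_nonneg _)))

end NormalFormData

/-- After changes of coordinates close to the identity, a monic series becomes a binomial with a
derivative of the same dominant term. -/
theorem NormalFormData.exists_coordinates (hr : IsModulus k r) (hs : IsModulus k s) {p : ℕ}
    (hp : p.Prime) (hkp : ‖(p : k)‖ < 1) (hsr : s = r ^ p)
    {F : AnnulusAlgebra k s →A[k] AnnulusAlgebra k r} {u v : AnnulusAlgebra k r} {l : ℤ} {μ : k}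
    {n : ℤ} {c : k} (H : NormalFormData p (F (coord k s)) u v l μ n c) :
    ∃ (g : AnnulusAlgebra k s) (w : (AnnulusAlgebra k r)ˣ), ‖g‖ < 1 ∧
      ‖w.val - 1‖ < 1 ∧
      F (coord k s * (1 + g)) = binomialAt p n c w := by
  have : NeZero p := ⟨hp.ne_zero⟩
  obtain ⟨P, hP, hPsub, hPnorm⟩ := exists_unique_wildPart hr hs hsr H.norm_u H.eq_u
  obtain ⟨v', hv', ev'⟩ := H.exists_euler_binomial
  set φ := F (coord k s) with hφ
  have hinv : monomial r (-l) μ⁻¹ * monomial r l μ = 1 := by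
    rw [monomial_mul_monomial, neg_add_cancel, inv_mul_cancel₀ H.ne_zero, one_eq_monomial]
  -- `U ε` is `1 + ε` when `‖ε‖ < 1` and an irrelevant unit otherwise, so that the maps below are
  -- defined everywhere; the argument stays in the ball of radius `η`.
  have hU (ε : AnnulusAlgebra k r) : ∃ w : (AnnulusAlgebra k r)ˣ,
      ‖ε‖ < 1 → w.val = 1 + ε := by
    by_cases h : ‖ε‖ < 1
    · obtain ⟨w, hw⟩ := exists_unit_eq_one_add h
      exact ⟨w, fun _ => hw⟩
    · exact ⟨1, fun h' => absurd h' h⟩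
  choose U hU using hU
  have hU0 : U 0 = 1 := Units.ext (by rw [hU 0 (by simp)]; simp)
  -- The radius is chosen so that the first iterate `K 0` lies in the ball: `v - v'` compares the
  -- two derivatives, and the other two norms bound `G 0`.
  set η := max (max ‖v‖ ‖v'‖) (max ‖monomial r (n - p) c‖ ‖u‖) with hη
  have hη1 : η < 1 := max_lt (max_lt H.norm_v hv') (max_lt H.norm_c H.norm_u)
  have hη0 : 0 ≤ η := le_max_of_le_left (le_max_of_le_left (norm_nonneg _))
  have hUη (ε : AnnulusAlgebra k r) (h : ‖ε‖ ≤ η) : ‖(U ε : AnnulusAlgebra k r) - 1‖ ≤ η := by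
    rwa [hU ε (h.trans_lt hη1), add_sub_cancel_left]
  have hUsub (a b : AnnulusAlgebra k r) (ha : ‖a‖ ≤ η) (hb : ‖b‖ ≤ η) :
      (U a : AnnulusAlgebra k r) - U b = a - b := by
    rw [hU a (ha.trans_lt hη1), hU b (hb.trans_lt hη1), add_sub_add_left_eq_sub]
  -- Given `w = 1 + ε`, this is the change of the target coordinate that makes both sides agree in
  -- the exponents divisible by `p`.
  let G (ε : AnnulusAlgebra k r) : AnnulusAlgebra k s :=
    P (wildPart hsr (monomial r (-p) 1 * (binomialAt p n c (U ε) - φ)))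
  let Φ (ε : AnnulusAlgebra k r) : AnnulusAlgebra k r :=
    monomial r l μ * ε + (φ + φ * F (G ε)) - binomialAt p n c (U ε)
  -- At a fixed point the tame part of `Φ ε` is `μ Tˡ ε`, which is then purely tame. Hence the
  -- difference of the two sides of the equation, `Φ ε - μ Tˡ ε`, has no tame part.
  let K (ε : AnnulusAlgebra k r) : AnnulusAlgebra k r :=
    monomial r (-l) μ⁻¹ * tamePart p (Φ ε)
  set θ₁ := max (max ‖(p : k)‖ η) ‖monomial r (n - p) c‖ with hθ₁
  have hθ₁1 : θ₁ < 1 := max_lt (max_lt hkp hη1) H.norm_c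
  have hG (a b : AnnulusAlgebra k r) (ha : ‖a‖ ≤ η) (hb : ‖b‖ ≤ η) :
      ‖G a - G b‖ ≤ θ₁ * ‖a - b‖ := by
    change ‖P _ - P _‖ ≤ _
    rw [← hPsub, hPnorm, ← map_sub, ← mul_sub, sub_sub_sub_cancel_right, ← hUsub a b ha hb]
    exact (norm_wildPart_le hsr _).trans
      (H.norm_binomialAt_sub_le hη1 (hUη a ha) (hUη b hb))
  have hG0 : ‖G 0‖ ≤ η := by
    change ‖P _‖ ≤ _
    rw [hPnorm, hU0]
    refine (norm_wildPart_le hsr _).trans ?_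
    rw [binomialAt, H.eq_u, one_zpow, one_zpow, Units.val_one, mul_one, mul_one, mul_add, mul_one,
      add_sub_add_left_eq_sub, mul_sub, ← mul_assoc, monomial_mul_monomial, monomial_mul_monomial,
      neg_add_cancel, one_mul, one_mul, ← one_eq_monomial, one_mul, neg_add_eq_sub]
    exact norm_sub_le_of_le' (le_max_of_le_right (le_max_left _ _))
      (le_max_of_le_right (le_max_right _ _))
  have hDF (h : AnnulusAlgebra k s) : ‖monomial r (-l) μ⁻¹ * euler (φ * F h)‖ ≤ ‖h‖ := by
    have e : monomial r (-l) μ⁻¹ * euler (φ * F h) = (1 + v) * F (h + euler h) := by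
      rw [euler_coord_mul_map, ← hφ, H.eq_v]
      linear_combination (F (h + euler h) * (1 + v)) * hinv
    rw [e]
    refine norm_mul_le_of_le_one_left (norm_add_le_of_le' norm_one.le H.norm_v.le) ?_
    exact (norm_map_le hr hs F _).trans (norm_add_le_of_le' le_rfl (norm_euler_le h))
  obtain ⟨θ₂, hθ₂1, hθ₂0, hθ₂⟩ := H.exists_bound hη1
  have hK (a b : AnnulusAlgebra k r) (ha : ‖a‖ ≤ η) (hb : ‖b‖ ≤ η) :
      ‖K a - K b‖ ≤ max θ₁ θ₂ * ‖a - b‖ := by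
    change ‖_ * _ - _ * _‖ ≤ _
    rw [← mul_sub, ← map_sub]
    refine (norm_monomial_mul_tamePart_le hp hkp _ _ _).trans ?_
    -- The first bracket is the linearization error; the second term inherits the Lipschitz constant
    -- of `G`.
    have e : Φ a - Φ b = (monomial r l μ * (a - b)
        - (binomialAt p n c (U a) - binomialAt p n c (U b))) + φ * F (G a - G b) := by
      rw [map_sub]
      simp only [Φ]
      ring
    rw [e, map_add, mul_add]
    refine norm_add_le_of_le' ?_ ?_
    · have := hθ₂ _ _ (hUη a ha) (hUη b hb)
      rw [hUsub a b ha hb] at this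
      exact this.trans (mul_le_mul_of_nonneg_right (le_max_right _ _) (norm_nonneg _))
    · exact ((hDF _).trans (hG a b ha hb)).trans
        (mul_le_mul_of_nonneg_right (le_max_left _ _) (norm_nonneg _))
  have hK0 : ‖K 0‖ ≤ η := by
    refine (norm_monomial_mul_tamePart_le hp hkp _ _ _).trans ?_
    have e : monomial r (-l) μ⁻¹ * euler (Φ 0)
        = v - v' + monomial r (-l) μ⁻¹ * euler (φ * F (G 0)) := by
      simp only [Φ]
      rw [mul_zero, zero_add, hU0, map_sub, map_add, ev', H.eq_v]
      linear_combination (v - v') * hinv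
    rw [e]
    exact norm_add_le_of_le' (norm_sub_le_of_le' (le_max_of_le_left (le_max_left _ _))
      (le_max_of_le_left (le_max_right _ _))) ((hDF _).trans hG0)
  obtain ⟨a, ha, hfix⟩ := exists_fixedPoint_of_ball K hη0 (le_max_of_le_right hθ₂0)
    (max_lt hθ₁1 hθ₂1) hK0 hK
  have hz : φ + φ * F (G a) - binomialAt p n c (U a) = 0 := by
    refine eq_zero_of_wildPart_of_tamePart hsr ?_ ?_
    · have e : monomial r (-p) 1 * (φ + φ * F (G a) - binomialAt p n c (U a))
          = monomial r (-p) 1 * (φ * F (G a))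
            - monomial r (-p) 1 * (binomialAt p n c (U a) - φ) := by ring
      rw [e, map_sub, hP, sub_self]
    · have h1 : tamePart p (Φ a) = monomial r l μ * a := by
        have h2 : monomial r l μ * K a = monomial r l μ * a := by rw [hfix]
        rw [← h2]
        change _ = monomial r l μ * (monomial r (-l) μ⁻¹ * tamePart p (Φ a))
        linear_combination (-tamePart p (Φ a)) * hinv
      have h3 : tamePart p (monomial r l μ * a) = monomial r l μ * a := by
        rw [← h1, tamePart_tamePart]
      have e : φ + φ * F (G a) - binomialAt p n c (U a) = Φ a - monomial r l μ * a := by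
        simp only [Φ]
        ring
      rw [e, map_sub, h1, h3, sub_self]
  refine ⟨G a, U a, ?_, (hUη a ha).trans_lt hη1, ?_⟩
  · have h1 := hG a 0 ha (by simpa using hη0)
    rw [sub_zero] at h1
    have h2 := norm_add_le_of_le' (h1.trans ((mul_le_of_le_one_left (norm_nonneg _) hθ₁1.le).trans
      ha)) hG0
    rw [sub_add_cancel] at h2
    exact h2.trans_lt hη1
  · rw [map_mul, map_add, map_one, mul_add, mul_one]
    exact sub_eq_zero.1 hz

end AnnulusAlgebra
-- Dependence on the coordinates and orientation.
open AnnulusAlgebra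

variable {k : Type*} [NormedField k] [IsUltrametricDist k] [CompleteSpace k] {r s : ℝ≥0}

namespace AnnulusAlgebra

theorem dlog_map (F : AnnulusAlgebra k s →A[k] AnnulusAlgebra k r) (u : (AnnulusAlgebra k s)ˣ) :
    dlog (Additive.ofMul (Units.map (F : AnnulusAlgebra k s →* AnnulusAlgebra k r) u))
      = F (dlog (Additive.ofMul u)) * dlog (Additive.ofMul (coordImage F)) := by
  have h1 := euler_unit (Units.map (F : AnnulusAlgebra k s →* AnnulusAlgebra k r) u)
  have h2 := euler_map F u
  rw [euler_unit, map_mul, mul_assoc] at h2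
  exact (Units.mul_right_inj (Units.map (F : AnnulusAlgebra k s →* AnnulusAlgebra k r) u)).1
    (h1.symm.trans h2)

theorem HasLead.dlog {u : (AnnulusAlgebra k r)ˣ} {κ : k} {n : ℤ}
    (h : HasLead (u : AnnulusAlgebra k r) κ n) (hn : ‖(n : k)‖ = 1) :
    HasLead (dlog (Additive.ofMul u)) (n : k) 0 := by
  have hn0 : (n : k) ≠ 0 := norm_pos_iff.1 (by rw [hn]; exact one_pos)
  refine ⟨hn0, (n : k)⁻¹ • (AnnulusAlgebra.dlog (Additive.ofMul u) - n), ?_, ?_⟩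
  · rw [norm_smul_eq, norm_inv, hn, inv_one, one_mul]
    exact h.norm_dlog_sub
  · have e : (n : AnnulusAlgebra k r) = (n : k) • 1 := by
      rw [Algebra.smul_def, map_intCast, mul_one]
    rw [monomial_zero_mul, smul_add, smul_smul, mul_inv_cancel₀ hn0, one_smul, ← e,
      add_sub_cancel]

theorem HasLead.smul {g : AnnulusAlgebra k r} {κ : k} {n : ℤ} (h : HasLead g κ n) {c : k}
    (hc : c ≠ 0) : HasLead (c • g) (c * κ) n := by
  have := (hasLead_monomial (r := r) 0 hc).mul h
  rwa [monomial_zero_mul, zero_add] at this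

theorem norm_intCast_of_abs_one {d : ℤ} (hd : d = 1 ∨ d = -1) : ‖(d : k)‖ = 1 := by
  rcases hd with rfl | rfl <;> simp

end AnnulusAlgebra

section Coordinates

variable {A : Type*} [CommRing A] [TopologicalSpace A] [Algebra k A]
variable {B : Type*} [CommRing B] [TopologicalSpace B] [Algebra k B]

/-- The morphism `f` in coordinates. -/
def coordHom (f : B →A[k] A) (eY : MonicCoordinate k r A) (eX : MonicCoordinate k s B) :
    AnnulusAlgebra k s →A[k] AnnulusAlgebra k r :=
  (eY : A →A[k] AnnulusAlgebra k r).comp (f.comp (eX.symm : AnnulusAlgebra k s →A[k] B))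

theorem coe_coordImage_coordHom (f : B →A[k] A) (eY : MonicCoordinate k r A)
    (eX : MonicCoordinate k s B) :
    (coordImage (coordHom f eY eX) : AnnulusAlgebra k r) = presentation f eY eX := rfl

/-- The change of coordinates. -/
abbrev transition (e e' : MonicCoordinate k r A) : AnnulusAlgebra k r →A[k] AnnulusAlgebra k r :=
  coordHom (ContinuousAlgHom.id k A) e' e

theorem transition_apply (e e' : MonicCoordinate k r A) (a : A) :
    transition e e' (e a) = e' a := by
  change e' (e.symm (e a)) = _
  rw [ContinuousAlgEquiv.symm_apply_apply]

theorem exists_hasLead_presentation [IsAlgClosed k] (hr : IsModulus k r) (hs : IsModulus k s)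
    {m : ℕ} (hm : m ≠ 0) {f : B →A[k] A} (hf : IsFiniteOfDegree m f) (eY : MonicCoordinate k r A)
    (eX : MonicCoordinate k s B) : s = r ^ m ∧ ∃ κ d, HasLead (presentation f eY eX) κ d ∧
      ((d = m ∧ ‖κ‖ = 1) ∨ (d = -m ∧ ‖κ‖ = s)) := by
  obtain ⟨κ, d, h⟩ := exists_hasLead_of_isUnit hr.pos hr.le_one
    (coordImage (coordHom f eY eX)).isUnit
  have h' : HasLead (coordHom f eY eX (coord k s)) κ d := h
  have := degree_eq hr hs hm (hf.conj eY eX (coordHom f eY eX) fun _ => rfl) h'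
  exact ⟨this.1, κ, d, h, this.2⟩

theorem exists_hasLead_transition [IsAlgClosed k] (hr : IsModulus k r)
    (e e' : MonicCoordinate k r A) : ∃ a d, HasLead (transition e e' (coord k r)) a d ∧
      ((d = 1 ∧ ‖a‖ = 1) ∨ (d = -1 ∧ ‖a‖ = r)) := by
  have : Nontrivial A := e.symm.injective.nontrivial
  obtain ⟨-, a, d, h, hd⟩ := exists_hasLead_presentation hr hr one_ne_zero
    (isFiniteOfDegree_id k A) e' e
  rw [Nat.cast_one] at hd
  exact ⟨a, d, h, hd⟩

/-- Degrees of dominant terms multiply under composition, so the transition between two coordinates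
of the same orientation cannot have degree `-1`. -/
theorem SameOrientation.hasLead_transition [IsAlgClosed k] (hr : IsModulus k r)
    {o e e' : MonicCoordinate k r A} (h : SameOrientation o e) (h' : SameOrientation o e') :
    ∃ a, HasLead (transition e e' (coord k r)) a 1 ∧ ‖a‖ = 1 := by
  obtain ⟨a, d, ha, hd⟩ := exists_hasLead_transition hr e e'
  have h1 := ha.map hr hr (IsDominantTerm.hasLead hr.pos hr.le_one h)
  rw [transition_apply, one_mul] at h1
  have hd1 := (h1.unique hr.pos hr.le_one (IsDominantTerm.hasLead hr.pos hr.le_one h')).1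
  subst hd1
  rcases hd with hd | hd
  · exact ⟨a, ha, hd.2⟩
  · omega

theorem sameOrientation_of_hasLead (hr : IsModulus k r) {o e e' : MonicCoordinate k r A}
    (h : SameOrientation o e) {a : k} (ha : HasLead (transition e e' (coord k r)) a 1) :
    SameOrientation o e' := by
  have h1 := ha.map hr hr (IsDominantTerm.hasLead hr.pos hr.le_one h)
  rw [transition_apply, one_mul] at h1
  exact h1.isDominantTerm hr.pos

theorem sameOrientation_refl (hr : IsModulus k r) (o : MonicCoordinate k r A) :
    SameOrientation o o := by
  rw [SameOrientation, ContinuousAlgEquiv.apply_symm_apply]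
  exact (hasLead_monomial 1 one_ne_zero).isDominantTerm hr.pos

/-- The logarithmic derivative of a presentation depends on the coordinates only up to the change
of coordinates on the source and factors of absolute value `1`. -/
theorem hasLead_dlog_of_transition [IsAlgClosed k] (hr : IsModulus k r) (hs : IsModulus k s)
    (f : B →A[k] A) {eY eY' : MonicCoordinate k r A} (eX eX' : MonicCoordinate k s B) {κ a : k}
    {m d : ℤ} (h : HasLead (dlog (Additive.ofMul (coordImage (coordHom f eY eX)))) κ m)
    (ha : HasLead (transition eY eY' (coord k r)) a d) :
    ∃ κ', HasLead (dlog (Additive.ofMul (coordImage (coordHom f eY' eX')))) κ' (m * d) ∧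
      ‖κ'‖ = ‖κ‖ * ‖a‖ ^ m := by
  obtain ⟨b, e, hb, he⟩ := exists_hasLead_transition hs eX' eX
  have he1 : ‖(e : k)‖ = 1 := norm_intCast_of_abs_one (he.imp And.left And.left)
  have hd1 : ‖(d : k)‖ = 1 := by
    obtain ⟨a', d', ha', hd'⟩ := exists_hasLead_transition hr eY eY'
    rw [(ha.unique hr.pos hr.le_one ha').1]
    exact norm_intCast_of_abs_one (hd'.imp And.left And.left)
  let T := transition eY eY'
  let X := transition eX' eX
  let F := coordHom f eY eX
  -- The new presentation is the change of `x`, followed by `f` in the old coordinates and the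
  -- change of `y`. The chain rule gives three factors; the two from the coordinate changes have
  -- constant dominant terms `±1`.
  have e1 : coordImage (coordHom f eY' eX')
      = Units.map ((T.comp F : AnnulusAlgebra k s →A[k] AnnulusAlgebra k r) :
        AnnulusAlgebra k s →* AnnulusAlgebra k r) (coordImage X) := by
    refine Units.ext ?_
    change eY' (f (eX'.symm (coord k s)))
      = transition eY eY' (eY (f (eX.symm (eX (eX'.symm (coord k s))))))
    rw [transition_apply, ContinuousAlgEquiv.symm_apply_apply]
  have e2 : coordImage (T.comp F)
      = Units.map (T : AnnulusAlgebra k r →* AnnulusAlgebra k r) (coordImage F) := Units.ext rfl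
  have hX : HasLead (coordImage X : AnnulusAlgebra k s) b e := hb
  have hT : HasLead (coordImage T : AnnulusAlgebra k r) a d := ha
  obtain ⟨κF, dF, hF⟩ := exists_hasLead_of_isUnit hr.pos hr.le_one (coordImage (T.comp F)).isUnit
  have hF' : HasLead ((T.comp F) (coord k s)) κF dF := hF
  have h1 := hF'.map hr hs (hX.dlog he1)
  have h2 := (ha.map hr hr h).mul (hT.dlog hd1)
  have h3 := h1.mul h2
  rw [e1, dlog_map, e2, dlog_map]
  rw [zero_mul, zero_add, add_zero, zpow_zero, mul_one] at h3
  refine ⟨_, h3, ?_⟩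
  rw [norm_mul, norm_mul, norm_mul, he1, hd1, one_mul, mul_one, norm_zpow]

theorem hasLead_dlog_of_euler {u : (AnnulusAlgebra k r)ˣ} {κ μ : k} {d l : ℤ}
    (hu : HasLead (u : AnnulusAlgebra k r) κ d) (h : HasLead (euler (u : AnnulusAlgebra k r)) μ l) :
    HasLead (dlog (Additive.ofMul u)) (κ⁻¹ * μ) (l - d) := by
  have := (hu.of_mul_eq_one (Units.mul_inv u)).mul h
  rwa [euler_unit, Units.inv_mul_cancel_left, neg_add_eq_sub] at this

/-- The Euler derivation is `T` times the derivative, whence the shift of the degree by one. -/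
theorem isDominantTerm_derivCoeff_iff (hr0 : 0 < r) (a : AnnulusAlgebra k r) (n : ℤ) :
    IsDominantTerm r (derivCoeff a.coeff) (n - 1) ↔ IsDominantTerm r (euler a).coeff n := by
  have hr : (0 : ℝ) < r := by exact_mod_cast hr0
  have e (i : ℤ) : derivCoeff a.coeff (i - 1) = (euler a).coeff i := by
    rw [derivCoeff, sub_add_cancel, coeff_euler]
  have key (i : ℤ) (ρ : ℝ) (hρ : 0 < ρ) :
      ‖derivCoeff a.coeff (i - 1)‖ * ρ ^ (i - 1) < ‖derivCoeff a.coeff (n - 1)‖ * ρ ^ (n - 1)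
        ↔ ‖(euler a).coeff i‖ * ρ ^ i < ‖(euler a).coeff n‖ * ρ ^ n := by
    rw [e, e, zpow_sub_one₀ hρ.ne', zpow_sub_one₀ hρ.ne', ← mul_assoc, ← mul_assoc,
      mul_lt_mul_iff_left₀ (inv_pos.2 hρ)]
  constructor
  · intro h i hi ρ h1 h2
    exact (key i ρ (hr.trans_le h1)).1 (h (i - 1) (by omega) ρ h1 h2)
  · intro h i hi ρ h1 h2
    have := (key (i + 1) ρ (hr.trans_le h1)).2 (h (i + 1) (by omega) ρ h1 h2)
    rwa [add_sub_cancel_right] at this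

end Coordinates

/-! ### Monic series and the dominant term of the derivative. -/

section Monic

variable {p : ℕ}

/-- The derivative of a monic series is dominated by the term of degree `p` or by a tame term. -/
theorem exists_hasLead_euler (hr : IsModulus k r) {φ : AnnulusAlgebra k r} (hφ : HasLead φ 1 p)
    (h1 : φ.coeff p = 1) (hu : IsUnit (euler φ)) :
    ∃ l : ℤ, HasLead (euler φ) (l * φ.coeff l) l ∧ (l = p ∨ ¬ (p : ℤ) ∣ l) := by
  obtain ⟨μ, l, h⟩ := exists_hasLead_of_isUnit hr.pos hr.le_one hu
  refine ⟨l, h.self hr.pos hr.le_one, ?_⟩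
  by_contra! hcon
  have h2 := h.isDominantTerm hr.pos p (Ne.symm hcon.1) 1 hr.le_one le_rfl
  have h3 := hφ.isDominantTerm hr.pos l hcon.1 1 hr.le_one le_rfl
  rw [coeff_euler, coeff_euler, h1, one_zpow, one_zpow, mul_one, mul_one, mul_one, norm_mul,
    Int.cast_natCast] at h2
  rw [h1, one_zpow, one_zpow, mul_one, mul_one, norm_one] at h3
  -- At radius `1`, divisibility of `l` by `p` and `|c_l| < 1` prevent the term of degree `l` from
  -- exceeding the term `p` of degree `p`.
  have h4 : ‖(l : k)‖ * ‖φ.coeff l‖ ≤ ‖(p : k)‖ * 1 :=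
    mul_le_mul (norm_intCast_le_of_dvd hcon.2) h3.le (norm_nonneg _) (norm_nonneg _)
  rw [mul_one] at h4
  exact absurd h2 (not_lt.2 h4)

/-- The required bounds are single-term bounds: `c_l` is the coefficient of `u` in degree `l - p`,
and `p / μ` that of `v` in degree `p - l`. -/
theorem exists_normalFormData {φ : AnnulusAlgebra k r} (hφ : HasLead φ 1 p)
    (h1 : φ.coeff p = 1) {l : ℤ} (h : HasLead (euler φ) (l * φ.coeff l) l) :
    ∃ u v, NormalFormData p φ u v l (l * φ.coeff l) l (if l = p then 0 else φ.coeff l) := by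
  obtain ⟨-, u, hu, eu⟩ := hφ
  obtain ⟨hμ, v, hv, ev⟩ := h
  have key (a : AnnulusAlgebra k r) (ha : ‖a‖ < 1) (i : ℤ) : ‖monomial r i (a.coeff i)‖ < 1 := by
    rw [norm_monomial]
    exact (term_le_norm a i).trans_lt ha
  refine ⟨u, v, hu, eu, hμ, hv, ev, ?_, ?_⟩
  · split_ifs with hl
    · rw [monomial_zero_right, norm_zero]; exact one_pos
    · have h2 := HasLead.coeff_add eu (l - p)
      rw [add_sub_cancel, if_neg (sub_ne_zero.2 hl), zero_add, one_mul] at h2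
      rw [h2]
      exact key u hu _
  · split_ifs with hl
    · exact .inl ⟨rfl, hl, by rw [hl, h1, mul_one, Int.cast_natCast]⟩
    · refine .inr ⟨rfl, rfl, ?_⟩
      have h2 := HasLead.coeff_add ev (p - l)
      rw [add_sub_cancel, if_neg (sub_ne_zero.2 (Ne.symm hl)), zero_add, coeff_euler, h1, mul_one,
        Int.cast_natCast] at h2
      rw [h2, inv_mul_cancel_left₀ hμ]
      exact key v hv _

theorem isDominantTameTermOfSeries_of_hasLead (hr : IsModulus k r) {φ : AnnulusAlgebra k r} {l : ℤ}
    {μ : k} (h : HasLead (euler φ) μ l) (hl : l = p ∨ ¬ (p : ℤ) ∣ l) :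
    IsDominantTameTermOfSeries p φ (monomial r l (if l = p then 0 else φ.coeff l)) := by
  have hd := (isDominantTerm_derivCoeff_iff hr.pos φ l).2 (h.isDominantTerm hr.pos)
  by_cases hlp : l = p
  · rw [if_pos hlp, monomial_zero_right]
    rw [hlp] at hd
    exact .inl ⟨hd, rfl⟩
  · rw [if_neg hlp]
    exact .inr ⟨l, hl.resolve_left hlp, hd, rfl⟩

end Monic

/-! ### Monic presentations and dominant tame terms of covers. -/

section Main

variable {A : Type*} [CommRing A] [TopologicalSpace A] [Algebra k A]
variable {B : Type*} [CommRing B] [TopologicalSpace B] [Algebra k B]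
variable {p : ℕ}

theorem IsMonicPresentation.hasLead (hr : IsModulus k r) {m : ℕ} {f : B →A[k] A}
    {o : MonicCoordinate k r A} {φ : AnnulusAlgebra k r} (h : IsMonicPresentation m s f o φ) :
    HasLead φ 1 m := by
  have := IsDominantTerm.hasLead hr.pos hr.le_one h.2.1
  rwa [h.2.2] at this

theorem IsMonicPresentation.isUnit_euler {m : ℕ} {f : B →A[k] A} (hf : IsFiniteEtaleOfDegree m f)
    {o : MonicCoordinate k r A} {φ : AnnulusAlgebra k r} (h : IsMonicPresentation m s f o φ) :
    IsUnit (euler φ) := by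
  obtain ⟨⟨eY, eX, -, rfl⟩, -⟩ := h
  exact isUnit_euler_presentation hf eY eX

/-- Monic presentations for the same orientation have derivatives with dominant terms of the same
degree and size. -/
theorem IsMonicPresentation.hasLead_euler_eq [IsAlgClosed k] (hr : IsModulus k r)
    (hs : IsModulus k s) {m : ℕ} {f : B →A[k] A} {o : MonicCoordinate k r A}
    {φ φ' : AnnulusAlgebra k r} (h : IsMonicPresentation m s f o φ)
    (h' : IsMonicPresentation m s f o φ') {μ μ' : k} {l l' : ℤ} (hl : HasLead (euler φ) μ l)
    (hl' : HasLead (euler φ') μ' l') : l = l' ∧ ‖μ‖ = ‖μ'‖ := by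
  have hφ := h.hasLead hr
  have hφ' := h'.hasLead hr
  obtain ⟨⟨eY, eX, ho, rfl⟩, -⟩ := h
  obtain ⟨⟨eY', eX', ho', rfl⟩, -⟩ := h'
  obtain ⟨a, ha, ha1⟩ := ho.hasLead_transition hr ho'
  rw [← coe_coordImage_coordHom] at hφ hφ' hl hl'
  -- The transition has degree `1` and `|a| = 1`, so the dominant degree and size of the logarithmic
  -- derivative are unchanged; both presentations lead with `Tᵐ`, so the same holds for their
  -- derivatives.
  obtain ⟨κ, h1, h2⟩ := hasLead_dlog_of_transition hr hs f eX eX'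
    (hasLead_dlog_of_euler hφ hl) ha
  have h3 := h1.unique hr.pos hr.le_one (hasLead_dlog_of_euler hφ' hl')
  rw [h2, ha1, one_zpow, inv_one, one_mul, one_mul, mul_one, mul_one] at h3
  exact ⟨by omega, h3.2⟩

/-- The dominant tame term of one monic presentation is a dominant tame term of the cover. -/
theorem IsMonicPresentation.isDominantTameTerm [IsAlgClosed k] (hr : IsModulus k r)
    (hs : IsModulus k s) (hp : p.Prime) (hkp : ‖(p : k)‖ < 1) {f : B →A[k] A}
    (hf : IsFiniteEtaleOfDegree p f) {o : MonicCoordinate k r A}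
    {φ : AnnulusAlgebra k r} (h : IsMonicPresentation p s f o φ) {l : ℤ}
    (hl : HasLead (euler φ) (l * φ.coeff l) l) :
    IsDominantTameTerm p s f o (monomial r l (if l = p then 0 else φ.coeff l)) := by
  refine ⟨⟨φ, h⟩, fun φ' h' => ?_⟩
  obtain ⟨l', hl', hdvd⟩ := exists_hasLead_euler hr (h'.hasLead hr) h'.2.2 (h'.isUnit_euler hf)
  obtain ⟨rfl, he⟩ := h.hasLead_euler_eq hr hs h' hl hl'
  have ht := isDominantTameTermOfSeries_of_hasLead hr hl' hdvd
  by_cases hlp : l = p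
  · refine ⟨_, 1, ht, norm_one, ?_⟩
    rw [if_pos hlp, if_pos hlp, one_smul]
  · refine ⟨_, φ.coeff l / φ'.coeff l, ht, ?_, ?_⟩
    · rw [norm_mul, norm_mul,
        norm_intCast_eq_one_of_not_dvd hp hkp (hdvd.resolve_left hlp), one_mul, one_mul] at he
      rw [norm_div, he, div_self]
      exact norm_ne_zero_iff.2 (right_ne_zero_of_mul hl'.1)
    · rw [if_neg hlp, if_neg hlp, smul_monomial,
        div_mul_cancel₀ _ (right_ne_zero_of_mul hl'.1)]

/-- Every orientation admits a monic presentation. -/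
theorem exists_monicPresentation [IsAlgClosed k] (hr : IsModulus k r) (hs : IsModulus k s)
    {m : ℕ} (hm : m ≠ 0) {f : B →A[k] A} (hf : IsFiniteOfDegree m f) (o : MonicCoordinate k r A)
    (eX₀ : MonicCoordinate k s B) :
    ∃ eX : MonicCoordinate k s B, IsMonicPresentation m s f o (presentation f o eX) := by
  have key (eX : MonicCoordinate k s B) {κ : k} (h : HasLead (presentation f o eX) κ m)
      (hκ : ‖κ‖ = 1) : ∃ eX' : MonicCoordinate k s B,
      IsMonicPresentation m s f o (presentation f o eX') := by
    have h' := h.self hr.pos hr.le_one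
    have h1 : ‖(presentation f o eX).coeff m‖ = 1 := by rw [h.norm_coeff, hκ]
    obtain ⟨σ, -, hσ⟩ := exists_scaling s h1
    have e : presentation f o (eX.trans σ)
        = ((presentation f o eX).coeff m)⁻¹ • presentation f o eX := by
      change o (f (eX.symm (σ.symm (coord k s)))) = _
      rw [hσ, map_smul, map_smul, map_smul]
      rfl
    refine ⟨eX.trans σ, ⟨o, eX.trans σ, sameOrientation_refl hr o, rfl⟩, ?_, ?_⟩
    · rw [e]
      exact (h'.smul (inv_ne_zero h'.1)).isDominantTerm hr.pos
    · rw [e, coeff_smul, inv_mul_cancel₀ h'.1]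
  -- A dominant degree `-m` is corrected by inverting the coordinate on the target, which leaves the
  -- orientation `o` of the source untouched.
  obtain ⟨-, κ, d, h, ⟨rfl, hκ⟩ | ⟨rfl, hκ⟩⟩ := exists_hasLead_presentation hr hs hm hf o eX₀
  · exact key eX₀ h hκ
  · obtain ⟨b, hb, hbs⟩ := hs.1
    have hbs' : ‖b‖ = s := by rw [← hbs]; rfl
    obtain ⟨σ, -, hσ⟩ := exists_inversion hs hbs'
    have h' : HasLead (coordHom f o eX₀ (coord k s)) κ (-m) := h
    have h1 := h'.map hr hs (hasLead_monomial (r := s) (-1) hb)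
    refine key (eX₀.trans σ) (κ := b * κ ^ (-1 : ℤ)) ?_ ?_
    · rw [neg_one_mul, neg_neg] at h1
      change HasLead (o (f (eX₀.symm (σ.symm (coord k s))))) _ _
      rw [hσ]
      exact h1
    · have hs0 : (s : ℝ) ≠ 0 := by exact_mod_cast hs.pos.ne'
      rw [norm_mul, hbs', norm_zpow, hκ, zpow_neg_one, mul_inv_cancel₀ hs0]

/-- Every monic presentation can be improved to the sum of `T ^ p` and the dominant tame term. -/
theorem IsMonicPresentation.exists_binomial [IsAlgClosed k] (hr : IsModulus k r)
    (hs : IsModulus k s) (hp : p.Prime) (hkp : ‖(p : k)‖ < 1) {f : B →A[k] A}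
    (hf : IsFiniteEtaleOfDegree p f) {o : MonicCoordinate k r A}
    {φ : AnnulusAlgebra k r} (h : IsMonicPresentation p s f o φ) {l : ℤ}
    (hl : HasLead (euler φ) (l * φ.coeff l) l) :
    IsMonicPresentation p s f o
      (coord k r ^ p + monomial r l (if l = p then 0 else φ.coeff l)) := by
  have hφ := h.hasLead hr
  obtain ⟨u, v, H⟩ := exists_normalFormData hφ h.2.2 hl
  obtain ⟨⟨eY, eX, ho, rfl⟩, -⟩ := h
  obtain ⟨hsr, -⟩ := exists_hasLead_presentation hr hs hp.ne_zero hf.isFiniteOfDegree eY eX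
  set c := if l = p then 0 else (presentation f eY eX).coeff l with hc
  obtain ⟨g, w, hg, hw, e⟩ := NormalFormData.exists_coordinates hr hs hp hkp hsr
    (F := coordHom f eY eX) H
  obtain ⟨σ, hσ⟩ := exists_near_coord hr hw
  obtain ⟨τ, hτ⟩ := exists_near_coord hs hg
  rw [add_sub_cancel] at hσ
  have hσu : σ (coordUnit k r : AnnulusAlgebra k r)
      = (coordUnit k r * w : (AnnulusAlgebra k r)ˣ) := by
    rw [Units.val_mul]
    exact hσ
  -- Substituting `T w` for `T` turns the binomial into `binomialAt`, so the new coordinate on `Y`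
  -- is obtained through the inverse of `σ`.
  have hσm (i : ℤ) (b : k) : σ (monomial r i b) = monomial r i b * (w ^ i).val := by
    have e1 : monomial r i b = b • ((coordUnit k r ^ i : (AnnulusAlgebra k r)ˣ) :
        AnnulusAlgebra k r) := by
      rw [coe_coordUnit_zpow, smul_monomial, mul_one]
    rw [e1, map_smul, map_coe_zpow σ _ _ hσu, mul_zpow, Units.val_mul, smul_mul_assoc]
  have hpres : presentation f (eY.trans σ.symm) (eX.trans τ.symm)
      = coord k r ^ p + monomial r l c := by
    change σ.symm (eY (f (eX.symm (τ (coord k s))))) = _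
    rw [hτ]
    change σ.symm (coordHom f eY eX _) = _
    rw [e]
    refine σ.injective ?_
    change σ (σ.symm _) = σ _
    rw [ContinuousAlgEquiv.apply_symm_apply, map_add, coord_pow, hσm, hσm, binomialAt]
  have hlead : HasLead (coord k r ^ p + monomial r l c) 1 p := by
    refine ⟨one_ne_zero, _, H.norm_c, ?_⟩
    rw [mul_add, monomial_mul_monomial, mul_one, one_mul, add_sub_cancel, coord_pow]
  refine ⟨⟨eY.trans σ.symm, eX.trans τ.symm, ?_, hpres⟩, hlead.isDominantTerm hr.pos, ?_⟩
  -- From `σ(T) = T w` it follows that `σ⁻¹(T) = T σ⁻¹(w)⁻¹`, where `σ⁻¹(w)` is close to `1`; hence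
  -- the orientation is preserved.
  · have h1 : HasLead (σ.symm (coord k r)) 1 1 := by
      let S : AnnulusAlgebra k r →A[k] AnnulusAlgebra k r := σ.symm
      let W : (AnnulusAlgebra k r)ˣ := Units.map (S : AnnulusAlgebra k r →* AnnulusAlgebra k r) w
      have hW : HasLead (W : AnnulusAlgebra k r) 1 0 := by
        have e4 : (W : AnnulusAlgebra k r) = 1 + S ((w : AnnulusAlgebra k r) - 1) := by
          rw [map_sub, map_one, add_sub_cancel]
          rfl
        rw [e4]
        exact hasLead_one_add ((norm_map_le hr hr S _).trans_lt hw)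
      have h4 := (hasLead_monomial (r := r) 1 (one_ne_zero (α := k))).mul
        (hW.of_mul_eq_one (Units.mul_inv W))
      rw [inv_one, mul_one, neg_zero, add_zero] at h4
      convert h4 using 1
      refine (Units.eq_mul_inv_iff_mul_eq W).2 ?_
      change σ.symm (coord k r) * σ.symm w = coord k r
      rw [← map_mul, ← hσ, ContinuousAlgEquiv.symm_apply_apply]
    refine sameOrientation_of_hasLead hr ho (a := 1) ?_
    change HasLead (σ.symm (eY (eY.symm (coord k r)))) 1 1
    rwa [ContinuousAlgEquiv.apply_symm_apply]
  · rw [AnnulusAlgebra.coeff_add, coord_pow, coeff_monomial, coeff_monomial, if_pos rfl]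
    by_cases hlp : l = p
    · rw [if_pos hlp.symm, hc, if_pos hlp, add_zero]
    · rw [if_neg (Ne.symm hlp), add_zero]

theorem IsMonicPresentation.isKummer {f : B →A[k] A} {o : MonicCoordinate k r A} {m : ℕ}
    (h : IsMonicPresentation m s f o (coord k r ^ m)) : IsKummer m r s f := by
  obtain ⟨⟨eY, eX, -, h⟩, -⟩ := h
  exact ⟨eY, eX, h⟩

/-- Reversing the orientation replaces the degree `l` of the tame term by `2 p - l`. -/
theorem hasLead_euler_of_inversion [IsAlgClosed k] (hr : IsModulus k r) (hs : IsModulus k s)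
    {m : ℕ} {f : B →A[k] A} {o o' : MonicCoordinate k r A} {eX eX' : MonicCoordinate k s B}
    (h : IsMonicPresentation m s f o (presentation f o eX))
    (h' : IsMonicPresentation m s f o' (presentation f o' eX')) {a μ μ' : k} {l l' : ℤ}
    (ha : HasLead (transition o o' (coord k r)) a (-1))
    (hl : HasLead (euler (presentation f o eX)) μ l)
    (hl' : HasLead (euler (presentation f o' eX')) μ' l') : l' = 2 * m - l := by
  have hφ := h.hasLead hr
  have hφ' := h'.hasLead hr
  rw [← coe_coordImage_coordHom] at hφ hφ' hl hl'
  obtain ⟨κ, h1, -⟩ := hasLead_dlog_of_transition hr hs f eX eX'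
    (hasLead_dlog_of_euler hφ hl) ha
  have := (h1.unique hr.pos hr.le_one (hasLead_dlog_of_euler hφ' hl')).1
  omega

end Main

end BerkovichAnnulus
end

open BerkovichAnnulus BerkovichAnnulus.AnnulusAlgebra in
theorem theorem3p7 {k : Type*} [NormedField k] [IsUltrametricDist k] [CompleteSpace k]
    [IsAlgClosed k] (p : ℕ) (hp : p.Prime) (hkp : ‖(p : k)‖ < 1)
    (r s : ℝ≥0)
    {A : Type*} [CommRing A] [TopologicalSpace A] [Algebra k A]
    {B : Type*} [CommRing B] [TopologicalSpace B] [Algebra k B]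
    (hY : IsClosedAnnulus k r A) (hX : IsClosedAnnulus k s B)
    (f : B →A[k] A) (hf : IsFiniteEtaleOfDegree p f) :
    (∀ o : MonicCoordinate k r A,
      (∃ t : AnnulusAlgebra k r,
        IsDominantTameTerm p s f o t ∧
        IsMonicPresentation p s f o (coord k r ^ p + t)) ∧
      (IsMonicPresentation p s f o (coord k r ^ p) → IsDominantTameTerm p s f o 0) ∧
      (∀ (n : ℤ) (c : k), ¬ IsKummer p r s f →
        IsMonicPresentation p s f o (coord k r ^ p + monomial r n c) →
        IsDominantTameTerm p s f o (monomial r n c))) ∧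
    (IsKummer p r s f ∨
      ∃ (o : MonicCoordinate k r A) (n : ℤ) (c : k), (p : ℤ) < n ∧ ¬ (p : ℤ) ∣ n ∧ c ≠ 0 ∧
        IsDominantTameTerm p s f o (monomial r n c) ∧
        IsMonicPresentation p s f o (coord k r ^ p + monomial r n c)) := by
  have hr : IsModulus k r := ⟨hY.1, hY.2.1⟩
  have hs : IsModulus k s := ⟨hX.1, hX.2.1⟩
  obtain ⟨eX₀⟩ := hX.2.2
  have lead {o : MonicCoordinate k r A} {φ : AnnulusAlgebra k r}
      (h : IsMonicPresentation p s f o φ) :=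
    exists_hasLead_euler hr (h.hasLead hr) h.2.2 (h.isUnit_euler hf)
  have hcoeff (n : ℤ) (c : k) (i : ℤ) : (coord k r ^ p + monomial r n c).coeff i
      = (if i = p then 1 else 0) + if i = n then c else 0 := by
    rw [AnnulusAlgebra.coeff_add, coord_pow, coeff_monomial, coeff_monomial]
  have kummer {o : MonicCoordinate k r A} {φ : AnnulusAlgebra k r}
      (h : IsMonicPresentation p s f o φ) {l : ℤ} (hl : HasLead (euler φ) (l * φ.coeff l) l)
      (hlp : l = p) : IsKummer p r s f := by
    have := h.exists_binomial hr hs hp hkp hf hl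
    rw [if_pos hlp, monomial_zero_right, add_zero] at this
    exact this.isKummer
  refine ⟨fun o => ⟨?_, fun h => ?_, fun n c hK h => ?_⟩, ?_⟩
  · obtain ⟨eX, h⟩ := exists_monicPresentation hr hs hp.ne_zero hf.isFiniteOfDegree o eX₀
    obtain ⟨l, hl, -⟩ := lead h
    exact ⟨_, h.isDominantTameTerm hr hs hp hkp hf hl, h.exists_binomial hr hs hp hkp hf hl⟩
  · obtain ⟨l, hl, -⟩ := lead h
    have h1 := h.isDominantTameTerm hr hs hp hkp hf hl
    -- The dominant coefficient of the derivative is nonzero, and `Tᵖ` has no coefficient outside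
    -- degree `p`.
    have hlp : l = p := by
      by_contra hne
      refine right_ne_zero_of_mul hl.1 ?_
      rw [coord_pow, coeff_monomial, if_neg hne]
    rwa [if_pos hlp, monomial_zero_right] at h1
  · obtain ⟨l, hl, -⟩ := lead h
    -- Dominance in degree `p` would produce a presentation `x = yᵖ` by the normal form. This leaves
    -- `n` as the only possible degree.
    have hlp : l ≠ p := fun hlp => hK (kummer h hl hlp)
    have h1 := h.isDominantTameTerm hr hs hp hkp hf hl
    have hln : l = n := by
      by_contra hne
      refine right_ne_zero_of_mul hl.1 ?_
      rw [hcoeff, if_neg hlp, if_neg hne, add_zero]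
    rwa [if_neg hlp, hcoeff, if_neg hlp, zero_add, if_pos hln, hln] at h1
  · by_contra! hcon
    obtain ⟨hK, hcon⟩ := hcon
    obtain ⟨o⟩ := hY.2.2
    -- For any orientation, `l = p` gives a Kummer cover and `l > p` gives the required binomial, so
    -- the contrary assumption forces `l < p`.
    have high (o : MonicCoordinate k r A) {φ : AnnulusAlgebra k r}
        (h : IsMonicPresentation p s f o φ) {l : ℤ} (hl : HasLead (euler φ) (l * φ.coeff l) l)
        (hdvd : l = p ∨ ¬ (p : ℤ) ∣ l) : l < p := by
      have hlp : l ≠ p := fun hlp => hK (kummer h hl hlp)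
      by_contra hlt
      have h1 := h.isDominantTameTerm hr hs hp hkp hf hl
      have h2 := h.exists_binomial hr hs hp hkp hf hl
      rw [if_neg hlp] at h1 h2
      exact hcon o l _ (by omega) (hdvd.resolve_left hlp) (right_ne_zero_of_mul hl.1) h1 h2
    obtain ⟨a, ha, har⟩ := hr.1
    have har' : ‖a‖ = r := by rw [← har]; rfl
    obtain ⟨σ, hσ, -⟩ := exists_inversion hr har'
    obtain ⟨eX, h⟩ := exists_monicPresentation hr hs hp.ne_zero hf.isFiniteOfDegree o eX₀
    obtain ⟨eX', h'⟩ := exists_monicPresentation hr hs hp.ne_zero hf.isFiniteOfDegree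
      (o.trans σ) eX₀
    obtain ⟨l, hl, hdvd⟩ := lead h
    obtain ⟨l', hl', hdvd'⟩ := lead h'
    have hσ' : HasLead (transition o (o.trans σ) (coord k r)) a (-1) := by
      change HasLead (σ (o (o.symm (coord k r)))) a (-1)
      rw [ContinuousAlgEquiv.apply_symm_apply, hσ]
      exact hasLead_monomial (-1) ha
    -- Inverting the coordinate on `Y` gives `l + l' = 2 p`, so `l` and `l'` cannot both be less
    -- than `p`.
    have h1 := hasLead_euler_of_inversion hr hs h h' hσ' hl hl'
    have h2 := high o h hl hdvd
    have h3 := high (o.trans σ) h' hl' hdvd'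
    omega
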